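/- Digraphs are finite and loopless, and may have multiple arcs. Let $G$ be a digraph and let $X,Y\subseteq V(G)$. A directed path from $X$ to $Y$ is a directed path (without repeated vertices) whose first vertex lies in $X$ and whose last vertex lies in $Y$; it is nontrivial if its two end vertices are distinct. (Internal vertices may lie in $X\cup Y$, and $X$ and $Y$ may intersect.) (1) The maximum number of vertex-disjoint nontrivial directed paths from $X$ to $Y$ in $G$ can be computed in polynomial time. Precisely, there are one program of a unit-cost random access machine (whose only arithmetic operations are addition and truncated subtraction of natural numbers) and one polynomial $p$ such that, for every digraph $G$ on $\{0,\dots,n-1\}$ with $m$ arcs and all $X,Y\subseteq V(G)$, given as the list of $2+2n+2m$ numbers consisting of $n$, $m$, the indicator vectors of $X$ and of $Y$, and the tail and head of each arc (in any order of the arcs), the program halts after at most $p(2+2n+2m)$ steps and outputs this maximum. (2) Delete from $G$ all arcs entering a vertex of $X\setminus Y$ and all arcs leaving a vertex of $Y\setminus X$. Let $G'$ be the undirected graph whose vertex set is $V(G)$ together with a new copy $v'$ of each vertex $v\in V(G)\setminus(X\cup Y)$, and whose edges are: $\{v,v'\}$ for each $v\in V(G)\setminus(X\cup Y)$ and, for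 each remaining arc $(u,v)$, the edge $\{u,v\}$ if $v\in X\cup Y$ and the edge $\{u,v'\}$ otherwise. Then, for every integer $k\ge 0$, $G$ contains $k$ vertex-disjoint nontrivial directed paths from $X$ to $Y$ if and only if $G'$ has a matching of size $k+|V(G)\setminus(X\cup Y)|$. -/

import Mathlib

/-! ### Digraphs and vertex-disjoint paths -/

/-- A (multi)digraph on the vertex set `V`: a finite multiset of arcs, each an ordered pair
`(tail, head)` of distinct vertices. -/
structure MultiDigraph (V : Type*) where
  arcs : Multiset (V × V)
  ne_of_mem : ∀ a ∈ arcs, a.1 ≠ a.2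

namespace MultiDigraph

variable {V : Type*}

/-- `p` is the sequence of vertices of a directed path of `G` (no vertex is repeated) whose first
vertex lies in `X`, whose last vertex lies in `Y`, and which is nontrivial: its two end vertices are
distinct. -/
def IsNontrivialPath (G : MultiDigraph V) (X Y : Finset V) (p : List V) : Prop :=
  p.Nodup ∧ p.IsChain (fun u v => (u, v) ∈ G.arcs) ∧
    ∃ x ∈ X, ∃ y ∈ Y, p.head? = some x ∧ p.getLast? = some y ∧ x ≠ y

/-- `G` contains `k` vertex-disjoint directed nontrivial paths from `X` to `Y`. -/
def HasDisjointPaths (G : MultiDigraph V) (X Y : Finset V) (k : ℕ) : Prop :=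
  ∃ P : Fin k → List V, (∀ i, G.IsNontrivialPath X Y (P i)) ∧
    ∀ i j, i ≠ j → (P i).Disjoint (P j)

/-- The arcs of `G` that are kept for the auxiliary graph: arcs into a vertex of `X \ Y` and arcs
out of a vertex of `Y \ X` are deleted. -/
def KeptArc [DecidableEq V] (G : MultiDigraph V) (X Y : Finset V) (u v : V) : Prop :=
  (u, v) ∈ G.arcs ∧ v ∉ X \ Y ∧ u ∉ Y \ X

/-- The auxiliary undirected graph. Its vertices are the vertices `v` of `G` (`Sum.inl v`) and a
copy `v'` (`Sum.inr v`) of each vertex `v` outside `X ∪ Y`. Its edges are `{v, v'}` for each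
`v` outside `X ∪ Y` and, for each kept arc `(u, v)`, the edge `{u, v}` if `v` is in `X ∪ Y` and the
edge `{u, v'}` otherwise. -/
def auxGraph [DecidableEq V] (G : MultiDigraph V) (X Y : Finset V) :
    SimpleGraph (V ⊕ {v : V // v ∉ X ∪ Y}) :=
  SimpleGraph.fromRel fun a b =>
    (∃ v : {v : V // v ∉ X ∪ Y}, a = Sum.inl v.1 ∧ b = Sum.inr v) ∨
    (∃ u v : V, G.KeptArc X Y u v ∧ v ∈ X ∪ Y ∧ a = Sum.inl u ∧ b = Sum.inl v) ∨
    (∃ (u : V) (v : {v : V // v ∉ X ∪ Y}), G.KeptArc X Y u v.1 ∧ a = Sum.inl u ∧ b = Sum.inr v)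

end MultiDigraph

/-! ### A random access machine with unit costs

Programs act on natural-number variables and one-dimensional arrays of natural numbers. The only
arithmetic is addition and truncated subtraction, so a run of `t` steps creates only numbers whose
bit length is at most linear in `t` and in the bit lengths of the initial contents; such machines
and Turing machines simulate each other with polynomial overhead. -/

namespace RAM

/-- The memory: the contents of each variable and of each cell of each array. -/
structure State where
  var : ℕ → ℕ
  arr : ℕ → ℕ → ℕ

/-- Expressions; variables and arrays are named by natural numbers. -/
inductive Expr where
  | const (c : ℕ)
  | var (x : ℕ)
  | read (a : ℕ) (i : Expr)
  | add (e₁ e₂ : Expr)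
  | sub (e₁ e₂ : Expr)

/-- The value of an expression; subtraction is truncated at `0`. -/
def Expr.eval (s : State) : Expr → ℕ
  | .const c => c
  | .var x => s.var x
  | .read a i => s.arr a (i.eval s)
  | .add e₁ e₂ => e₁.eval s + e₂.eval s
  | .sub e₁ e₂ => e₁.eval s - e₂.eval s

/-- The number of elementary operations made when an expression is evaluated. -/
def Expr.cost : Expr → ℕ
  | .const _ => 1
  | .var _ => 1
  | .read _ i => i.cost + 1
  | .add e₁ e₂ => e₁.cost + e₂.cost + 1
  | .sub e₁ e₂ => e₁.cost + e₂.cost + 1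

/-- Programs. A test succeeds when its expression is nonzero. -/
inductive Prog where
  | skip
  | assign (x : ℕ) (e : Expr)
  | write (a : ℕ) (i e : Expr)
  | seq (c₁ c₂ : Prog)
  | cond (e : Expr) (c₁ c₂ : Prog)
  | loop (e : Expr) (c : Prog)

/-- Store `v` in the variable `x`. -/
def State.setVar (s : State) (x v : ℕ) : State :=
  { s with var := Function.update s.var x v }

/-- Store `v` in cell `i` of the array `a`. -/
def State.setArr (s : State) (a i v : ℕ) : State :=
  { s with arr := Function.update s.arr a (Function.update (s.arr a) i v) }

/-- `Runs c s t s'`: started in `s`, the program `c` halts in `s'` after exactly `t` steps. -/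
inductive Runs : Prog → State → ℕ → State → Prop where
  | skip (s : State) : Runs .skip s 1 s
  | assign (s : State) (x : ℕ) (e : Expr) :
      Runs (.assign x e) s (e.cost + 1) (s.setVar x (e.eval s))
  | write (s : State) (a : ℕ) (i e : Expr) :
      Runs (.write a i e) s (i.cost + e.cost + 1) (s.setArr a (i.eval s) (e.eval s))
  | seq {s s₁ s₂ : State} {c₁ c₂ : Prog} {t₁ t₂ : ℕ} :
      Runs c₁ s t₁ s₁ → Runs c₂ s₁ t₂ s₂ → Runs (.seq c₁ c₂) s (t₁ + t₂) s₂
  | cond_true {s s₁ : State} {e : Expr} {c₁ c₂ : Prog} {t : ℕ} :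
      e.eval s ≠ 0 → Runs c₁ s t s₁ → Runs (.cond e c₁ c₂) s (e.cost + 1 + t) s₁
  | cond_false {s s₁ : State} {e : Expr} {c₁ c₂ : Prog} {t : ℕ} :
      e.eval s = 0 → Runs c₂ s t s₁ → Runs (.cond e c₁ c₂) s (e.cost + 1 + t) s₁
  | loop_true {s s₁ s₂ : State} {e : Expr} {c : Prog} {t₁ t₂ : ℕ} :
      e.eval s ≠ 0 → Runs c s t₁ s₁ → Runs (.loop e c) s₁ t₂ s₂ →
        Runs (.loop e c) s (e.cost + 1 + t₁ + t₂) s₂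
  | loop_false {s : State} {e : Expr} {c : Prog} :
      e.eval s = 0 → Runs (.loop e c) s (e.cost + 1) s

/-- The initial memory on the input word list `w`: array `0` holds `w`, all else is `0`. -/
def start (w : List ℕ) : State where
  var := fun _ => 0
  arr := fun a i => if a = 0 then w.getD i 0 else 0

/-- Some single program, on every instance `I` written as the list of numbers `enc I`, halts within
a number of steps polynomial in the length of that list, with a correct answer for `I` in
variable `0`. -/
def SolvableInPolyTime {ι : Type*} (enc : ι → List ℕ) (correct : ι → ℕ → Prop) : Prop :=
  ∃ (c : Prog) (p : Polynomial ℕ), ∀ I : ι, ∃ (t : ℕ) (s : State),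
    Runs c (start (enc I)) t s ∧ t ≤ p.eval (enc I).length ∧ correct I (s.var 0)

end RAM

/-! ### Instances of the disjoint paths problem -/

/-- An input of the problem: a digraph with vertices `0, …, n - 1`, given by a list of its arcs
(with repetitions for multiple arcs, in any order), and two sets of vertices. -/
structure PathsInstance where
  n : ℕ
  arcs : List (Fin n × Fin n)
  ne_of_mem : ∀ a ∈ arcs, a.1 ≠ a.2
  X : Finset (Fin n)
  Y : Finset (Fin n)

namespace PathsInstance

/-- The digraph of the instance. -/
def graph (I : PathsInstance) : MultiDigraph (Fin I.n) where
  arcs := (I.arcs : Multiset (Fin I.n × Fin I.n))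
  ne_of_mem := fun a ha => I.ne_of_mem a (Multiset.mem_coe.mp ha)

/-- The input word list: the number of vertices, the number of arcs, the indicator vectors of `X`
and of `Y`, and then the tail and the head of each arc. -/
def encode (I : PathsInstance) : List ℕ :=
  I.n :: I.arcs.length ::
    (List.ofFn (fun v : Fin I.n => if v ∈ I.X then 1 else 0) ++
      List.ofFn (fun v : Fin I.n => if v ∈ I.Y then 1 else 0) ++
      I.arcs.flatMap (fun a => [(a.1 : ℕ), (a.2 : ℕ)]))

end PathsInstance

/-! For (2), cut each path to a stretch that starts in X, ends in Y and has all internal vertices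
outside X ∪ Y (`IsNontrivialPath.exists_segment`). All its arcs are kept. An arc (u, v) of a stretch
gives the edge from u to v, or to the copy of v, and every vertex outside X ∪ Y that lies on no
stretch is matched with its copy. This matching covers all such vertices, all copies and the two
ends of each stretch (`Segments.exists_involution`).

Conversely, an exchange makes the matching cover every copy without losing edges
(`exists_involution_covering`). Direct each matching edge along an arc. At most one head sits at
each copy, so at least k heads are vertices of X ∪ Y. From such a head go back to the tail of its
edge, then to the tail of the edge at the copy of that tail, and so on. Matching edges are disjoint
and V is finite, so the walk stops in X ∪ Y. The deletion of arcs forces the start of the resulting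
path into X and its end into Y (`hasDisjointPaths_of_involution`).

By (2), for (1) it suffices to find a maximum matching of the auxiliary graph and to subtract the
number of vertices outside X ∪ Y. Matchings are involutions with the exposed vertices as fixed
points. Edmonds' search grows a forest whose outer vertices are grouped into factor-critical
blossoms. If no edge continues the search, then each blossom is odd and, through edges, reaches only
itself and inner vertices; counting then shows that no matching leaves fewer vertices exposed
(`Forest.deficiency_le`). An edge between two blossoms starts a climb towards the roots, which
either shrinks a cycle to a new blossom (`Climb.merge`) or reaches two roots and shows that a larger
matching exists (`Climb.exists_deficiency_lt`). The invariants record only the existence of perfect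
matchings of certain sets, so no alternating path is ever stored.

The search therefore only decides whether the current matching M can be improved. An improvement is
found by self-reduction: edges are deleted as long as present edges together with M still allow a
larger matching. Every edge that survives lies in every larger matching, so the surviving edges,
with the edges of M disjoint from them, are a larger matching (`exists_larger_of_critical`).

All loops run for a counter below one fixed bound, the input length, which also bounds the numbers
of vertices and edges of the auxiliary graph. The polynomial time bound follows by induction on the
program (`exists_polynomial_runs`), and correctness uses an invariant rule (`rep_induction`). -/

namespace RAM

/-! ### Bounded-loop programs: semantics, frame rules and running time. -/

/-- Programs whose only loops are of the form `for i < v₁`, where `v₁` is the variable `1`. -/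
inductive LoopProg where
  | skip
  | assign (x : ℕ) (e : Expr)
  | write (a : ℕ) (i e : Expr)
  | seq (c d : LoopProg)
  | cond (e : Expr) (c d : LoopProg)
  | rep (i : ℕ) (c : LoopProg)

namespace LoopProg

/-- The translation into general programs. -/
def toProg : LoopProg → Prog
  | skip => .skip
  | assign x e => .assign x e
  | write a i e => .write a i e
  | seq c d => .seq c.toProg d.toProg
  | cond e c d => .cond e c.toProg d.toProg
  | rep i c => .seq (.assign i (.const 0))
      (.loop (.sub (.var 1) (.var i)) (.seq c.toProg (.assign i (.add (.var i) (.const 1)))))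

/-- The final memory. -/
def run : LoopProg → State → State
  | skip, s => s
  | assign x e, s => s.setVar x (e.eval s)
  | write a i e, s => s.setArr a (i.eval s) (e.eval s)
  | seq c d, s => d.run (c.run s)
  | cond e c d, s => if e.eval s ≠ 0 then c.run s else d.run s
  | rep i c, s => (fun s => (c.run s).setVar i ((c.run s).var i + 1))^[s.var 1] (s.setVar i 0)

/-- The program never writes to the variable `x`. -/
def keepsVar (x : ℕ) : LoopProg → Bool
  | skip => true
  | assign y _ => x != y
  | write _ _ _ => true
  | seq c d => c.keepsVar x && d.keepsVar x
  | cond _ c d => c.keepsVar x && d.keepsVar x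
  | rep i c => x != i && c.keepsVar x

/-- The program never writes to the array `a`. -/
def keepsArr (a : ℕ) : LoopProg → Bool
  | skip => true
  | assign _ _ => true
  | write b _ _ => a != b
  | seq c d => c.keepsArr a && d.keepsArr a
  | cond _ c d => c.keepsArr a && d.keepsArr a
  | rep _ c => c.keepsArr a

/-- Loop bodies change neither their counter nor the bound. -/
def wf : LoopProg → Bool
  | seq c d => c.wf && d.wf
  | cond _ c d => c.wf && d.wf
  | rep i c => i != 1 && c.keepsVar i && c.keepsVar 1 && c.wf
  | _ => true

/-- A frame rule with a syntactic, Boolean side condition: for a concrete program it is settled by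
`decide`, without executing the program. `run_arr` does the same for arrays. -/
theorem run_var {x : ℕ} : ∀ {c : LoopProg} (_ : c.keepsVar x = true) (s : State),
    (c.run s).var x = s.var x
  | skip, _, s => rfl
  | assign y e, h, s => by
      simp only [keepsVar, bne_iff_ne, ne_eq] at h
      simp [run, State.setVar, Function.update_of_ne h]
  | write _ _ _, _, s => rfl
  | seq c d, h, s => by
      simp only [keepsVar, Bool.and_eq_true] at h
      rw [run, run_var h.2, run_var h.1]
  | cond e c d, h, s => by
      simp only [keepsVar, Bool.and_eq_true] at h
      rw [run]
      split
      · exact run_var h.1 s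
      · exact run_var h.2 s
  | rep i c, h, s => by
      simp only [keepsVar, Bool.and_eq_true, bne_iff_ne, ne_eq] at h
      rw [run]
      have key : ∀ (n : ℕ) (s : State),
          ((fun s => (c.run s).setVar i ((c.run s).var i + 1))^[n] s).var x = s.var x := by
        intro n
        induction n with
        | zero => intro s; rfl
        | succ n ih =>
          intro s
          rw [Function.iterate_succ_apply, ih]
          simp [State.setVar, Function.update_of_ne h.1, run_var h.2]
      rw [key]
      simp [State.setVar, Function.update_of_ne h.1]

theorem run_arr {a : ℕ} : ∀ {c : LoopProg} (_ : c.keepsArr a = true) (s : State),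
    (c.run s).arr a = s.arr a
  | skip, _, s => rfl
  | assign y e, h, s => rfl
  | write b _ _, h, s => by
      simp only [keepsArr, bne_iff_ne, ne_eq] at h
      simp [run, State.setArr, Function.update_of_ne h]
  | seq c d, h, s => by
      simp only [keepsArr, Bool.and_eq_true] at h
      rw [run, run_arr h.2, run_arr h.1]
  | cond e c d, h, s => by
      simp only [keepsArr, Bool.and_eq_true] at h
      rw [run]
      split
      · exact run_arr h.1 s
      · exact run_arr h.2 s
  | rep i c, h, s => by
      simp only [keepsArr] at h
      rw [run]
      have key : ∀ (n : ℕ) (s : State),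
          ((fun s => (c.run s).setVar i ((c.run s).var i + 1))^[n] s).arr a = s.arr a := by
        intro n
        induction n with
        | zero => intro s; rfl
        | succ n ih =>
          intro s
          rw [Function.iterate_succ_apply, ih]
          exact run_arr h s
      rw [key]
      rfl

/-- The invariant rule for loops. -/
theorem rep_induction {i : ℕ} {c : LoopProg} (hw : (rep i c).wf = true) (s : State)
    (P : ℕ → State → Prop) (h0 : P 0 (s.setVar i 0))
    (hs : ∀ k < s.var 1, ∀ s', s'.var 1 = s.var 1 → s'.var i = k → P k s' →
      P (k + 1) ((c.run s').setVar i (k + 1))) :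
    P (s.var 1) ((rep i c).run s) := by
  simp only [wf, Bool.and_eq_true, bne_iff_ne, ne_eq] at hw
  obtain ⟨⟨⟨hi, hc⟩, hc1⟩, -⟩ := hw
  have hi' : (1 : ℕ) ≠ i := fun h => hi h.symm
  have key : ∀ k ≤ s.var 1,
      P k ((fun s => (c.run s).setVar i ((c.run s).var i + 1))^[k] (s.setVar i 0)) ∧
      ((fun s => (c.run s).setVar i ((c.run s).var i + 1))^[k] (s.setVar i 0)).var 1 = s.var 1 ∧
      ((fun s => (c.run s).setVar i ((c.run s).var i + 1))^[k] (s.setVar i 0)).var i = k := by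
    intro k
    induction k with
    | zero =>
      intro _
      exact ⟨h0, by simp [State.setVar, Function.update_of_ne hi'], by simp [State.setVar]⟩
    | succ k ih =>
      intro hk
      obtain ⟨h1, h2, h3⟩ := ih (by omega)
      rw [Function.iterate_succ_apply']
      set s' := (fun s => (c.run s).setVar i ((c.run s).var i + 1))^[k] (s.setVar i 0)
      have e : (c.run s').var i = k := by rw [run_var hc, h3]
      refine ⟨?_, ?_, ?_⟩
      · simp only [e]
        exact hs k (by omega) s' h2 h3 h1
      · simp [State.setVar, Function.update_of_ne hi', run_var hc1, h2]
      · simp [State.setVar, e]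
  exact (key _ le_rfl).1

/-- Loop programs halt in time polynomial in the loop bound. -/
theorem exists_polynomial_runs : ∀ {c : LoopProg} (_ : c.wf = true) (_ : c.keepsVar 1 = true),
    ∃ p : Polynomial ℕ, ∀ s : State, ∃ t, Runs c.toProg s t (c.run s) ∧ t ≤ p.eval (s.var 1)
  | skip, _, _ => ⟨1, fun s => ⟨1, Runs.skip s, by simp⟩⟩
  | assign x e, _, _ => ⟨Polynomial.C (e.cost + 1), fun s => ⟨_, Runs.assign s x e, by simp⟩⟩
  | write a i e, _, _ =>
      ⟨Polynomial.C (i.cost + e.cost + 1), fun s => ⟨_, Runs.write s a i e, by simp⟩⟩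
  | seq c d, hw, hk => by
      simp only [wf, keepsVar, Bool.and_eq_true] at hw hk
      obtain ⟨p, hp⟩ := exists_polynomial_runs hw.1 hk.1
      obtain ⟨q, hq⟩ := exists_polynomial_runs hw.2 hk.2
      refine ⟨p + q, fun s => ?_⟩
      obtain ⟨t, ht, htp⟩ := hp s
      obtain ⟨t', ht', htq⟩ := hq (c.run s)
      rw [run_var hk.1] at htq
      exact ⟨t + t', Runs.seq ht ht', by rw [Polynomial.eval_add]; omega⟩
  | cond e c d, hw, hk => by
      simp only [wf, keepsVar, Bool.and_eq_true] at hw hk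
      obtain ⟨p, hp⟩ := exists_polynomial_runs hw.1 hk.1
      obtain ⟨q, hq⟩ := exists_polynomial_runs hw.2 hk.2
      refine ⟨p + q + Polynomial.C (e.cost + 1), fun s => ?_⟩
      obtain ⟨t, ht, htp⟩ := hp s
      obtain ⟨t', ht', htq⟩ := hq s
      rw [run]
      by_cases he : e.eval s = 0
      · rw [if_neg (by simpa using he)]
        exact ⟨_, Runs.cond_false he ht', by
          rw [Polynomial.eval_add, Polynomial.eval_add, Polynomial.eval_C]; omega⟩
      · rw [if_pos he]
        exact ⟨_, Runs.cond_true he ht, by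
          rw [Polynomial.eval_add, Polynomial.eval_add, Polynomial.eval_C]; omega⟩
  | rep i c, hw, hk => by
      simp only [wf, keepsVar, Bool.and_eq_true, bne_iff_ne, ne_eq] at hw hk
      obtain ⟨⟨⟨hi, hc⟩, hc1⟩, hw⟩ := hw
      obtain ⟨p, hp⟩ := exists_polynomial_runs hw hc1
      -- A round costs 4 for the test and 4 for the increment besides the body; the initial
      -- assignment costs 2 and the final failing test 4.
      refine ⟨Polynomial.X * (p + Polynomial.C 8) + Polynomial.C 6, fun s => ?_⟩
      -- Induction on the number `n` of rounds left. The body preserves variable `1`, so the same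
      -- value of `p` bounds every round.
      have key : ∀ (n : ℕ) (s : State), s.var 1 = s.var i + n →
          ∃ t, Runs (.loop (.sub (.var 1) (.var i))
              (.seq c.toProg (.assign i (.add (.var i) (.const 1))))) s t
              ((fun s => (c.run s).setVar i ((c.run s).var i + 1))^[n] s) ∧
            t ≤ n * (p.eval (s.var 1) + 8) + 4 := by
        intro n
        induction n with
        | zero =>
          intro s hs
          exact ⟨_, Runs.loop_false (by simp [Expr.eval, hs]), by simp [Expr.cost]⟩
        | succ n ih =>
          intro s hs
          obtain ⟨t, ht, htp⟩ := hp s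
          obtain ⟨t', ht', htq⟩ := ih ((c.run s).setVar i ((c.run s).var i + 1)) (by
            simp [State.setVar, Function.update_of_ne hk.1, run_var hc1, run_var hc]; omega)
          rw [Function.iterate_succ_apply]
          refine ⟨_, Runs.loop_true (by simp only [Expr.eval]; omega)
            (Runs.seq ht (Runs.assign _ i _)) ht', ?_⟩
          have e : ((c.run s).setVar i ((c.run s).var i + 1)).var 1 = s.var 1 := by
            simp [State.setVar, Function.update_of_ne hk.1, run_var hc1]
          rw [e] at htq
          simp only [Expr.cost]
          rw [Nat.succ_mul]
          omega
      obtain ⟨t, ht, htp⟩ := key (s.var 1) (s.setVar i 0) (by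
        simp [State.setVar, Function.update_of_ne hk.1])
      refine ⟨_, Runs.seq (Runs.assign s i _) ht, ?_⟩
      have e : (s.setVar i 0).var 1 = s.var 1 := by
        simp [State.setVar, Function.update_of_ne hk.1]
      rw [e] at htp
      simp only [Expr.cost, Polynomial.eval_add, Polynomial.eval_mul, Polynomial.eval_X,
        Polynomial.eval_C]
      omega

end LoopProg

end RAM

/-! ### Perfect matchings, factor-critical sets and the invariants of Edmonds' search. -/

namespace Blossom

open Finset

/-- `S` has a perfect matching in `H`. -/
inductive PM (H : SimpleGraph ℕ) : Finset ℕ → Prop where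
  | empty : PM H ∅
  | pair {S : Finset ℕ} {u v : ℕ} : PM H S → u ∉ S → v ∉ S → H.Adj u v →
      PM H (insert u (insert v S))

/-- `S` is factor-critical in `H`. -/
def FC (H : SimpleGraph ℕ) (S : Finset ℕ) : Prop := ∀ z ∈ S, PM H (S.erase z)

/-- The involution `f` is a matching of `H` on `{0, …, N - 1}`; its fixed points are the exposed
vertices. -/
structure IsMatch (H : SimpleGraph ℕ) (N : ℕ) (f : ℕ → ℕ) : Prop where
  lt : ∀ w < N, f w < N
  inv : ∀ w < N, f (f w) = w
  adj : ∀ w < N, f w ≠ w → H.Adj w (f w)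

/-- The number of exposed vertices. -/
def deficiency (N : ℕ) (f : ℕ → ℕ) : ℕ := #{w ∈ range N | f w = w}

variable {H : SimpleGraph ℕ} {N : ℕ} {M : ℕ → ℕ} {lab cls par rank : ℕ → ℕ}

/-- The union is given through membership in a free set `U`, so that later identities between sets
become propositional goals for `grind`. -/
theorem PM.union {S T U : Finset ℕ} (hS : PM H S) (hT : PM H T) (hU : ∀ w, w ∈ U ↔ w ∈ S ∨ w ∈ T)
    (hd : ∀ w ∈ S, w ∉ T) : PM H U := by
  induction hS generalizing U with
  | empty =>
    have : U = T := by ext w; simp [hU w]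
    rwa [this]
  | @pair S u v hS hu hv huv ih =>
    have : U = insert u (insert v (S ∪ T)) := by ext w; simp [hU w, or_assoc]
    rw [this]
    refine PM.pair (ih (U := S ∪ T) (by simp) fun w hw => hd w (by simp [hw])) ?_ ?_ huv
    · simp [hu, hd u (by simp)]
    · simp [hv, hd v (by simp)]

theorem PM.edge {u v : ℕ} (h : H.Adj u v) {U : Finset ℕ} (hU : ∀ w, w ∈ U ↔ w = u ∨ w = v) :
    PM H U := by
  have : U = insert u (insert v ∅) := by ext w; simp [hU w]
  rw [this]
  exact PM.pair PM.empty (by simp) (by simp) h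

theorem PM.even_card {S : Finset ℕ} (hS : PM H S) : Even #S := by
  induction hS with
  | empty => simp
  | @pair S u v hS hu hv huv ih =>
    rw [card_insert_of_notMem (by simp [hu, huv.ne]), card_insert_of_notMem hv]
    simpa [Nat.even_add_one] using ih

theorem PM.exists_involution {S : Finset ℕ} (hS : PM H S) :
    ∃ f : ℕ → ℕ, ∀ w ∈ S, f w ∈ S ∧ f (f w) = w ∧ H.Adj w (f w) := by
  induction hS with
  | empty => exact ⟨id, by simp⟩
  | @pair S u v hS hu hv huv ih =>
    obtain ⟨f, hf⟩ := ih
    refine ⟨fun w => if w = u then v else if w = v then u else f w, fun w hw => ?_⟩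
    have huv' := huv.ne
    by_cases h1 : w = u
    · subst h1; simp [huv, huv'.symm]
    by_cases h2 : w = v
    · subst h2; simp [huv.symm, huv'.symm]
    have hw : w ∈ S := by simpa [h1, h2] using hw
    obtain ⟨ha, hb, hc⟩ := hf w hw
    have h3 : f w ≠ u := fun h => hu (h ▸ ha)
    have h4 : f w ≠ v := fun h => hv (h ▸ ha)
    simp [h1, h2, h3, h4, ha, hb, hc]

theorem FC.odd_card {S : Finset ℕ} (hS : FC H S) (h : S.Nonempty) : Odd #S := by
  obtain ⟨z, hz⟩ := h
  rw [← card_erase_add_one hz]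
  exact (hS z hz).even_card.add_one

/-- In `ZMod 2` the ones attached to `w` and `f w` cancel. -/
theorem even_card_of_involution {S : Finset ℕ} (f : ℕ → ℕ)
    (hf : ∀ w ∈ S, f w ∈ S ∧ f (f w) = w ∧ f w ≠ w) : Even #S := by
  have h : ∑ _w ∈ S, (1 : ZMod 2) = 0 :=
    sum_involution (fun w _ => f w) (fun _ _ => by decide) (fun w hw _ => (hf w hw).2.2)
      (fun w hw => (hf w hw).1) (fun w hw => (hf w hw).2.1)
  rw [sum_const, nsmul_one] at h
  exact (ZMod.natCast_eq_zero_iff_even).mp h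

/-- The matchings behind one step of the search for a blossom: the factor-critical set `K` and the
inner vertex `a` join the set `S`. -/
theorem PM.climb {S K S' : Finset ℕ} {a b x x' y : ℕ}
    (mS : ∀ w, w ∈ S' ↔ w ∈ S ∨ w ∈ K ∨ w = a) (dSK : ∀ w ∈ S, w ∉ K) (aS : a ∉ S) (aK : a ∉ K)
    (xK : x ∈ K) (bK : b ∈ K) (x'S : x' ∉ S) (x'K : x' ∉ K) (yK : y ∉ K) (ya : y ≠ a)
    (hba : H.Adj b a) (hpa : H.Adj x' a) (hfc : FC H K) (hpm : PM H S)
    (hends : PM H (insert x (insert y S)))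
    (herase : ∀ z ∈ S, PM H (insert x (S.erase z)) ∨ PM H (insert y (S.erase z))) :
    PM H S' ∧ (x' ≠ y → PM H (insert x' (insert y S'))) ∧
      ∀ z ∈ S', PM H (insert x' (S'.erase z)) ∨ PM H (insert y (S'.erase z)) := by
  have x'a : x' ≠ a := hpa.ne
  have pm_ab : PM H (insert a K) :=
    PM.union (hfc b bK) (PM.edge hba (U := {b, a}) (by simp)) (by grind) (by grind)
  have pm_ax : ∀ z ∈ K, PM H (insert x' (insert a (K.erase z))) := fun z hz =>
    PM.union (hfc z hz) (PM.edge hpa (U := {x', a}) (by simp)) (by grind) (by grind)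
  refine ⟨PM.union hpm pm_ab (by grind) (by grind), fun hne =>
    PM.union hends (pm_ax x xK) (by grind) (by grind), fun z hz => ?_⟩
  rcases (mS z).mp hz with h | h | rfl
  · have hza : z ≠ a := fun h' => aS (h' ▸ h)
    have hzK := dSK z h
    rcases herase z h with h1 | h1
    · exact Or.inl (PM.union h1 (pm_ax x xK) (by grind) (by grind))
    · exact Or.inr (PM.union h1 pm_ab (by grind) (by grind))
  · exact Or.inl (PM.union hpm (pm_ax z h) (by grind) (by grind))
  · exact Or.inr (PM.union hends (hfc x xK) (by grind) (by grind))

/-- The matchings behind the shrinking of a blossom. -/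
theorem FC.merge {S K U : Finset ℕ} {x y : ℕ} (mU : ∀ w, w ∈ U ↔ w ∈ S ∨ w ∈ K)
    (dSK : ∀ w ∈ S, w ∉ K) (xK : x ∈ K) (yK : y ∈ K) (hfc : FC H K) (hpm : PM H S)
    (herase : ∀ z ∈ S, PM H (insert x (S.erase z)) ∨ PM H (insert y (S.erase z))) : FC H U := by
  intro t ht
  rcases (mU t).mp ht with h | h
  · have := dSK t h
    rcases herase t h with h' | h'
    · exact PM.union h' (hfc x xK) (by grind) (by grind)
    · exact PM.union h' (hfc y yK) (by grind) (by grind)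
  · exact PM.union hpm (hfc t h) (by grind) (by grind)

/-- The state of Edmonds' search for the matching `M`: vertices are free, inner or outer
(`lab` is `0`, `1`, `2`), outer vertices are grouped into factor-critical blossoms, named by their
bases, and inner vertices have a parent outside. -/
structure Forest (H : SimpleGraph ℕ) (N : ℕ) (M lab cls par rank : ℕ → ℕ) : Prop where
  isMatch : IsMatch H N M
  lab_le : ∀ w < N, lab w ≤ 2
  cls_lt : ∀ w < N, cls w < N
  cls_self : ∀ w < N, lab w ≠ 2 → cls w = w
  lab_cls : ∀ w < N, lab w = 2 → lab (cls w) = 2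
  cls_cls : ∀ w < N, cls (cls w) = cls w
  mate_outer : ∀ w < N, lab w = 2 → cls w ≠ w → M w ≠ w ∧ lab (M w) = 2 ∧ cls (M w) = cls w
  root : ∀ b < N, lab b = 2 → cls b = b → rank b = 0 → M b = b
  nonroot : ∀ b < N, lab b = 2 → cls b = b → rank b ≠ 0 → M b ≠ b ∧ lab (M b) = 1
  inner : ∀ a < N, lab a = 1 → par a < N ∧ lab (M a) = 2 ∧ cls (M a) = M a ∧ lab (par a) = 2 ∧
    H.Adj (par a) a ∧ rank (cls (par a)) < rank (M a)
  fc : ∀ b < N, lab b = 2 → cls b = b → FC H {w ∈ range N | cls w = b}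
  exposed : ∀ w < N, M w = w → lab w = 2

namespace Forest

theorem init (hM : IsMatch H N M) (hlab : ∀ w < N, lab w = if M w = w then 2 else 0)
    (hcls : ∀ w < N, cls w = w) (hrank : ∀ w < N, rank w = 0) :
    Forest H N M lab cls par rank where
  isMatch := hM
  lab_le w hw := by rw [hlab w hw]; split <;> simp
  cls_lt w hw := by rwa [hcls w hw]
  cls_self w hw _ := hcls w hw
  lab_cls w hw h := by rwa [hcls w hw]
  cls_cls w hw := by rw [hcls w hw, hcls w hw]
  mate_outer w hw _ h := absurd (hcls w hw) h
  root w hw h _ _ := by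
    rw [hlab w hw] at h
    by_contra h'
    simp [h'] at h
  nonroot w hw _ _ h := absurd (hrank w hw) h
  inner w hw h := by
    rw [hlab w hw] at h
    split at h <;> simp at h
  fc b hb _ _ z hz := by
    have hz' : z < N ∧ cls z = b := by simpa using hz
    have : ({w ∈ range N | cls w = b} : Finset ℕ).erase z = ∅ := by
      ext w
      simp only [mem_erase, mem_filter, mem_range, notMem_empty, iff_false]
      rintro ⟨h1, h2, h3⟩
      rw [hcls w h2] at h3
      rw [hcls z hz'.1] at hz'
      omega
    rw [this]
    exact PM.empty
  exposed w hw h := by rw [hlab w hw, if_pos h]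

/-- The mate of a free vertex is free. -/
theorem mate_free (F : Forest H N M lab cls par rank) {v : ℕ} (hv : v < N) (h : lab v = 0) :
    M v ≠ v ∧ lab (M v) = 0 := by
  have hlt := F.isMatch.lt v hv
  have hinv := F.isMatch.inv v hv
  have hne : M v ≠ v := fun h' => by have := F.exposed v hv h'; omega
  refine ⟨hne, ?_⟩
  have h2 := F.lab_le _ hlt
  by_contra h0
  rcases (by omega : lab (M v) = 1 ∨ lab (M v) = 2) with h1 | h1
  · have := (F.inner _ hlt h1).2.1
    rw [hinv] at this; omega
  · by_cases hc : cls (M v) = M v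
    · by_cases hr : rank (M v) = 0
      · have := F.root _ hlt h1 hc hr
        rw [hinv] at this; exact hne this.symm
      · have := (F.nonroot _ hlt h1 hc hr).2
        rw [hinv] at this; omega
    · have := (F.mate_outer _ hlt h1 hc).2.1
      rw [hinv] at this; omega

/-- The mate of the free vertex `v` is free as well, so both can join the forest: `v` as an inner
vertex below `u`, its mate as a one-vertex blossom. Ranks must increase along the forest, whence the
rank one above that of the blossom of `u`. -/
theorem grow (F : Forest H N M lab cls par rank) {u v : ℕ} (hu : u < N) (hv : v < N)
    (huv : H.Adj u v) (hlu : lab u = 2) (hlv : lab v = 0) :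
    Forest H N M (Function.update (Function.update lab v 1) (M v) 2) cls
      (Function.update par v u) (Function.update rank (M v) (rank (cls u) + 1)) := by
  obtain ⟨hne, hlw⟩ := F.mate_free hv hlv
  have hw := F.isMatch.lt v hv
  have hinv := F.isMatch.inv v hv
  have hcv := F.cls_self v hv (by omega)
  have hcw := F.cls_self _ hw (by omega)
  have hcu := F.lab_cls u hu hlu
  set w := M v with hwdef
  set lab' := Function.update (Function.update lab v 1) w 2 with hlab'
  have lab_w : lab' w = 2 := by simp [hlab']
  have lab_v : lab' v = 1 := by simp [hlab', Function.update_of_ne (Ne.symm hne)]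
  have lab_o : ∀ z, z ≠ v → z ≠ w → lab' z = lab z := fun z h1 h2 => by
    simp [hlab', Function.update_of_ne h1, Function.update_of_ne h2]
  have lab_2 : ∀ z, lab z = 2 → lab' z = 2 := fun z hz => by
    rw [lab_o z (by rintro rfl; omega) (by rintro rfl; omega), hz]
  have lab_2' : ∀ z, lab' z = 2 → z ≠ w → lab z = 2 := fun z hz h => by
    have : z ≠ v := by rintro rfl; omega
    rwa [lab_o z this h] at hz
  have lab_1' : ∀ z, lab' z = 1 → z ≠ v → lab z = 1 := fun z hz h => by
    have : z ≠ w := by rintro rfl; omega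
    rwa [lab_o z h this] at hz
  have lab_1 : ∀ z, lab z = 1 → lab' z = 1 := fun z hz => by
    rw [lab_o z (by rintro rfl; omega) (by rintro rfl; omega), hz]
  have clsw : ∀ z < N, cls z = w → z = w := fun z hz h => by
    by_contra hne'
    by_cases h2 : lab z = 2
    · have := F.lab_cls z hz h2
      rw [h] at this; omega
    · exact hne' ((F.cls_self z hz h2).symm.trans h)
  constructor
  · exact F.isMatch
  · intro z hz
    by_cases h1 : z = w
    · rw [h1, lab_w]
    by_cases h2 : z = v
    · rw [h2, lab_v]; omega
    rw [lab_o z h2 h1]; exact F.lab_le z hz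
  · exact F.cls_lt
  · intro z hz h
    exact F.cls_self z hz fun h' => h (lab_2 z h')
  · intro z hz h
    by_cases h1 : z = w
    · rw [h1, hcw, lab_w]
    · exact lab_2 _ (F.lab_cls z hz (lab_2' z h h1))
  · exact F.cls_cls
  · intro z hz h hc
    have h1 : z ≠ w := by rintro rfl; exact hc hcw
    obtain ⟨ha, hb, hc⟩ := F.mate_outer z hz (lab_2' z h h1) hc
    exact ⟨ha, lab_2 _ hb, hc⟩
  · intro z hz h hc hr
    have h1 : z ≠ w := by rintro rfl; simp at hr
    rw [Function.update_of_ne h1] at hr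
    exact F.root z hz (lab_2' z h h1) hc hr
  · intro z hz h hc hr
    by_cases h1 : z = w
    · subst h1
      rw [hinv]
      exact ⟨hne.symm, lab_v⟩
    rw [Function.update_of_ne h1] at hr
    have := F.nonroot z hz (lab_2' z h h1) hc hr
    exact ⟨this.1, lab_1 _ this.2⟩
  · intro z hz h
    by_cases h1 : z = v
    · subst h1
      rw [Function.update_self]
      have : cls u ≠ w := by intro h'; rw [h'] at hcu; omega
      simp only [← hwdef, Function.update_self, Function.update_of_ne this]
      exact ⟨hu, lab_w, hcw, lab_2 _ hlu, huv, Nat.lt_succ_self _⟩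
    · obtain ⟨ha, hb, hc, hd, he, hf⟩ := F.inner z hz (lab_1' z h h1)
      rw [Function.update_of_ne h1]
      have h2 : M z ≠ w := by intro h'; rw [h'] at hb; omega
      have h3 : cls (par z) ≠ w := by
        intro h'; have := F.lab_cls _ ha hd; rw [h'] at this; omega
      rw [Function.update_of_ne h2, Function.update_of_ne h3]
      exact ⟨ha, lab_2 _ hb, hc, lab_2 _ hd, he, hf⟩
  · intro b hb h hc
    by_cases h1 : b = w
    · subst h1
      intro z hz
      have hz' : z < N ∧ cls z = w := by simpa using hz
      have hzw := clsw z hz'.1 hz'.2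
      have : ({x ∈ range N | cls x = w} : Finset ℕ).erase z = ∅ := by
        ext x
        simp only [mem_erase, mem_filter, mem_range, notMem_empty, iff_false]
        rintro ⟨h1, h2, h3⟩
        exact h1 ((clsw x h2 h3).trans hzw.symm)
      rw [this]
      exact PM.empty
    · exact F.fc b hb (lab_2' b h h1) hc
  · intro z hz h
    exact lab_2 _ (F.exposed z hz h)

/-- The search fails only if the matching is maximum. -/
theorem deficiency_le (F : Forest H N M lab cls par rank)
    (hcl : ∀ u < N, ∀ v < N, H.Adj u v → M u ≠ v → lab u = 2 →
      lab v = 1 ∨ (lab v = 2 ∧ cls u = cls v))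
    {f : ℕ → ℕ} (hf : IsMatch H N f) : deficiency N M ≤ deficiency N f := by
  -- Edges of `M` need not be scanned: the mate of an outer vertex is inner or lies in the same
  -- blossom.
  have hcl' : ∀ u < N, ∀ v < N, H.Adj u v → lab u = 2 →
      lab v = 1 ∨ (lab v = 2 ∧ cls u = cls v) := by
    intro u hu v hv huv hl
    by_cases h : M u = v
    · subst h
      by_cases hc : cls u = u
      · by_cases hr : rank u = 0
        · exact absurd (F.root u hu hl hc hr).symm huv.ne
        · exact Or.inl (F.nonroot u hu hl hc hr).2
      · have := F.mate_outer u hu hl hc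
        exact Or.inr ⟨this.2.1, this.2.2.symm⟩
    · exact hcl u hu v hv huv h hl
  set A : Finset ℕ := {a ∈ range N | lab a = 1} with hA
  set B : Finset ℕ := {b ∈ range N | lab b = 2 ∧ cls b = b} with hB
  set E : Finset ℕ := {w ∈ range N | M w = w} with hE
  set E' : Finset ℕ := {w ∈ range N | f w = w} with hE'
  -- Exposed vertices and mates of inner vertices are different bases of blossoms.
  have h1 : #E + #A ≤ #B := by
    rw [← card_image_of_injOn (s := A) (f := M), ← card_union_of_disjoint]
    · refine card_le_card fun b hb => ?_
      simp only [hE, hA, hB, mem_union, mem_image, mem_filter, mem_range] at hb ⊢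
      rcases hb with ⟨h1, h2⟩ | ⟨a, ⟨h1, h2⟩, rfl⟩
      · refine ⟨h1, F.exposed b h1 h2, ?_⟩
        by_contra hc
        exact (F.mate_outer b h1 (F.exposed b h1 h2) hc).1 h2
      · have := F.inner a h1 h2
        exact ⟨F.isMatch.lt a h1, this.2.1, this.2.2.1⟩
    · rw [disjoint_left]
      intro b hb hb'
      simp only [hE, hA, mem_image, mem_filter, mem_range] at hb hb'
      obtain ⟨a, ⟨h1, h2⟩, rfl⟩ := hb'
      rw [F.isMatch.inv a h1] at hb
      have := F.exposed a h1 hb.2.symm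
      omega
    · intro a ha a' ha' h
      simp only [hA, coe_filter, mem_range, Set.mem_ofPred_eq] at ha ha'
      have := congrArg M h
      rwa [F.isMatch.inv a ha.1, F.isMatch.inv a' ha'.1] at this
  -- The blossom is odd, so `f` cannot pair it up inside itself. A vertex not paired inside is
  -- exposed by `f`, or matched by `f` along an edge leaving the blossom, which must end at an inner
  -- vertex.
  have h2 : ∀ b ∈ B, ∃ w < N, cls w = b ∧ f w ∈ E' ∪ A := by
    intro b hb
    simp only [hB, mem_filter, mem_range] at hb
    obtain ⟨hb, hl, hc⟩ := hb
    by_contra hno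
    push Not at hno
    have hodd := (F.fc b hb hl hc).odd_card ⟨b, by simp [hb, hc]⟩
    refine Nat.not_even_iff_odd.mpr hodd (even_card_of_involution f fun w hw => ?_)
    have hw' : w < N ∧ cls w = b := by simpa using hw
    have hlw : lab w = 2 := by
      by_contra h
      have := F.cls_self w hw'.1 h
      rw [hw'.2] at this
      exact h (this ▸ hl)
    have hn := hno w hw'.1 hw'.2
    simp only [hE', hA, mem_union, mem_filter, mem_range, not_or, not_and] at hn
    have hflt := hf.lt w hw'.1
    have hne : f w ≠ w := fun h => hn.1 hflt (by rw [h, h])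
    refine ⟨?_, hf.inv w hw'.1, hne⟩
    rcases hcl' w hw'.1 _ hflt (hf.adj w hw'.1 hne) hlw with h | ⟨-, h⟩
    · exact absurd h (hn.2 hflt)
    · simp [hflt, ← h, hw'.2]
  choose! g hg using h2
  have h3 : #B ≤ #(E' ∪ A) := by
    refine card_le_card_of_injOn (fun b => f (g b)) (fun b hb => (hg b hb).2.2) ?_
    intro b hb b' hb' h
    have := congrArg f h
    simp only [hf.inv _ (hg b hb).1, hf.inv _ (hg b' hb').1] at this
    rw [← (hg b hb).2.1, ← (hg b' hb').2.1, this]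
  have h4 := card_union_le E' A
  have h5 : deficiency N M = #E := rfl
  have h6 : deficiency N f = #E' := rfl
  omega

end Forest

/-- The state of the search for the blossom closed by an outer edge: `x` and `y` are the current
ends, `mk` marks the bases of the blossoms and the inner vertices passed so far. -/
structure Climb (H : SimpleGraph ℕ) (N : ℕ) (M lab cls rank mk : ℕ → ℕ) (x y : ℕ) : Prop where
  x_lt : x < N
  y_lt : y < N
  lab_x : lab x = 2
  lab_y : lab y = 2
  mk_outer : ∀ b < N, mk b ≠ 0 → lab b = 2 → cls b = b ∧ b ≠ cls x ∧ b ≠ cls y ∧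
    rank (cls x) ≤ rank b ∧ rank (cls y) ≤ rank b ∧ rank b ≠ 0 ∧ mk (M b) ≠ 0
  mk_inner : ∀ a < N, mk a ≠ 0 → lab a ≠ 2 → lab a = 1 ∧ mk (M a) ≠ 0
  pm : PM H {w ∈ range N | mk (cls w) ≠ 0}
  pm_ends : cls x ≠ cls y → PM H (insert x (insert y {w ∈ range N | mk (cls w) ≠ 0}))
  pm_erase : ∀ z < N, mk (cls z) ≠ 0 →
    PM H (insert x (({w ∈ range N | mk (cls w) ≠ 0} : Finset ℕ).erase z)) ∨
    PM H (insert y (({w ∈ range N | mk (cls w) ≠ 0} : Finset ℕ).erase z))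

namespace Climb

variable {mk : ℕ → ℕ} {x y : ℕ}

theorem init (F : Forest H N M lab cls par rank) (hmk : ∀ w < N, mk w = 0) (hx : x < N)
    (hy : y < N) (hlx : lab x = 2) (hly : lab y = 2) (hxy : H.Adj x y) :
    Climb H N M lab cls rank mk x y := by
  have h0 : ({w ∈ range N | mk (cls w) ≠ 0} : Finset ℕ) = ∅ := by
    ext w
    simp only [mem_filter, mem_range, notMem_empty, iff_false, not_and, not_not]
    exact fun hw => hmk _ (F.cls_lt w hw)
  refine ⟨hx, hy, hlx, hly, fun b hb h => absurd (hmk b hb) h, fun b hb h => absurd (hmk b hb) h,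
    ?_, ?_, fun z hz h => absurd (hmk _ (F.cls_lt z hz)) h⟩
  · rw [h0]; exact PM.empty
  · rw [h0]; exact fun _ => PM.edge hxy (by simp)

theorem symm (C : Climb H N M lab cls rank mk x y) : Climb H N M lab cls rank mk y x where
  x_lt := C.y_lt
  y_lt := C.x_lt
  lab_x := C.lab_y
  lab_y := C.lab_x
  mk_outer b hb h h' := by
    obtain ⟨h1, h2, h3, h4, h5, h6⟩ := C.mk_outer b hb h h'
    exact ⟨h1, h3, h2, h5, h4, h6⟩
  mk_inner := C.mk_inner
  pm := C.pm
  pm_ends h := by rw [insert_comm]; exact C.pm_ends h.symm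
  pm_erase z hz h := (C.pm_erase z hz h).symm

/-- A blossom above the ends has not been marked. -/
theorem mk_cls_x (F : Forest H N M lab cls par rank) (C : Climb H N M lab cls rank mk x y) :
    mk (cls x) = 0 := by
  by_contra h
  exact (C.mk_outer _ (F.cls_lt x C.x_lt) h (F.lab_cls x C.x_lt C.lab_x)).2.1 rfl

/-- The end of larger rank moves, from its blossom through the mate of the base to the parent of
that mate. `PM.climb` transports the perfect matchings; the choice of the end keeps all marked bases
at least as high in rank as both ends. -/
theorem step (F : Forest H N M lab cls par rank) (C : Climb H N M lab cls rank mk x y)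
    (hxy : cls x ≠ cls y) (hr : rank (cls y) ≤ rank (cls x)) (h0 : rank (cls x) ≠ 0) :
    Climb H N M lab cls rank (Function.update (Function.update mk (cls x) 1) (M (cls x)) 1)
      (par (M (cls x))) y ∧
    #{w ∈ range N | mk (cls w) ≠ 0} <
      #{w ∈ range N |
        Function.update (Function.update mk (cls x) 1) (M (cls x)) 1 (cls w) ≠ 0} := by
  have hmx := mk_cls_x F C
  have hmy := mk_cls_x F C.symm
  have hb := F.cls_lt x C.x_lt
  have hlb := F.lab_cls x C.x_lt C.lab_x
  have hcb := F.cls_cls x C.x_lt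
  obtain ⟨hMb, hla⟩ := F.nonroot _ hb hlb hcb h0
  have ha := F.isMatch.lt _ hb
  have hMa := F.isMatch.inv _ hb
  obtain ⟨hp, -, -, hlp, hpa, hrk⟩ := F.inner _ ha hla
  have hca := F.cls_self _ ha (by omega)
  have hba := F.isMatch.adj _ hb hMb
  rw [hMa] at hrk
  have hxK : cls x = cls x := rfl
  set b := cls x with hbdef
  set a := M b with hadef
  set x' := par a with hx'def
  set mk' := Function.update (Function.update mk b 1) a 1 with hmk'
  have hma : mk a = 0 := by
    by_contra h
    have := (C.mk_inner a ha h (by omega)).2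
    rw [hMa] at this
    exact this hmx
  have mk'_iff : ∀ z, mk' z ≠ 0 ↔ mk z ≠ 0 ∨ z = b ∨ z = a := fun z => by
    by_cases h1 : z = a
    · simp [hmk', h1]
    by_cases h2 : z = b
    · simp [hmk', h2, Ne.symm hMb]
    · simp [hmk', h1, h2]
  have cls_a : ∀ z < N, cls z = a ↔ z = a := fun z hz => by
    refine ⟨fun h => ?_, fun h => h ▸ hca⟩
    by_cases h2 : lab z = 2
    · have := F.lab_cls z hz h2
      rw [h] at this; omega
    · exact (F.cls_self z hz h2).symm.trans h
  have hcx' : cls x' ≠ b := fun h => by rw [h] at hrk; omega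
  have hcx'a : cls x' ≠ a := fun h => by
    have := F.lab_cls x' hp hlp
    rw [h] at this; omega
  -- The new blossom has smaller rank than the old one, while every marked base has rank at least
  -- that of the old one. So the climb never re-enters its own trail.
  have hmkx' : mk (cls x') = 0 := by
    by_contra h
    have := (C.mk_outer _ (F.cls_lt _ hp) h (F.lab_cls x' hp hlp)).2.2.2.1
    rw [← hbdef] at this
    omega
  have hcya : cls y ≠ a := fun h => by
    have := F.lab_cls y C.y_lt C.lab_y
    rw [h] at this; omega
  have hfc := F.fc b hb hlb hcb
  set K : Finset ℕ := {w ∈ range N | cls w = b} with hK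
  set S : Finset ℕ := {w ∈ range N | mk (cls w) ≠ 0} with hS
  set S' : Finset ℕ := {w ∈ range N | mk' (cls w) ≠ 0} with hS'
  have mS : ∀ w, w ∈ S' ↔ w ∈ S ∨ w ∈ K ∨ w = a := fun w => by
    simp only [hS', hS, hK, mem_filter, mem_range, mk'_iff]
    constructor
    · rintro ⟨h1, h2 | h2 | h2⟩
      · exact Or.inl ⟨h1, h2⟩
      · exact Or.inr (Or.inl ⟨h1, h2⟩)
      · exact Or.inr (Or.inr ((cls_a w h1).mp h2))
    · rintro (⟨h1, h2⟩ | ⟨h1, h2⟩ | rfl)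
      · exact ⟨h1, Or.inl h2⟩
      · exact ⟨h1, Or.inr (Or.inl h2)⟩
      · exact ⟨ha, Or.inr (Or.inr hca)⟩
  have dSK : ∀ w ∈ S, w ∉ K := fun w hw hw' => by
    simp only [hS, hK, mem_filter, mem_range] at hw hw'
    rw [hw'.2] at hw
    exact hw.2 hmx
  have aS : a ∉ S := by simp [hS, hca, hma]
  have aK : a ∉ K := by simp [hK, hca, hMb]
  have xK : x ∈ K := by simp [hK, C.x_lt, hbdef]
  have bK : b ∈ K := by simp [hK, hb, hcb]
  have xS : x ∉ S := fun h => dSK x h xK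
  have x'S : x' ∉ S := by simp [hS, hmkx']
  have x'K : x' ∉ K := by simp [hK, hcx']
  have x'a : x' ≠ a := hpa.ne
  have yK : y ∉ K := by simp [hK, Ne.symm hxy]
  have ya : y ≠ a := fun h => by rw [h, hca] at hcya; exact hcya rfl
  obtain ⟨pm1, pm2, pm3⟩ := PM.climb mS dSK aS aK xK bK x'S x'K yK ya hba hpa hfc C.pm
    (C.pm_ends hxy) (fun z hz => by
      simp only [hS, mem_filter, mem_range] at hz
      exact C.pm_erase z hz.1 hz.2)
  refine ⟨⟨hp, C.y_lt, hlp, C.lab_y, ?_, ?_, pm1, fun hne => pm2 fun h => hne (h ▸ rfl),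
    fun z hz hm => pm3 z (by simpa [hS', hz] using hm)⟩, ?_⟩
  · intro c hc hm hl
    rcases (mk'_iff c).mp hm with h | h | h
    · obtain ⟨h1, h2, h3, h4, h5, h6, h7⟩ := C.mk_outer c hc h hl
      rw [← hbdef] at h4
      refine ⟨h1, fun h => ?_, h3, by omega, h5, h6, (mk'_iff _).mpr (Or.inl h7)⟩
      rw [h] at h4
      omega
    · subst h
      exact ⟨hcb, hcx'.symm, hxy, hrk.le, hr, h0, (mk'_iff _).mpr (Or.inr (Or.inr rfl))⟩
    · subst h; omega
  · intro c hc hm hl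
    rcases (mk'_iff c).mp hm with h | h | h
    · obtain ⟨h1, h2⟩ := C.mk_inner c hc h hl
      exact ⟨h1, (mk'_iff _).mpr (Or.inl h2)⟩
    · subst h; omega
    · subst h
      exact ⟨hla, by rw [hMa]; exact (mk'_iff _).mpr (Or.inr (Or.inl rfl))⟩
  · refine card_lt_card (Finset.ssubset_iff_subset_ne.mpr ⟨fun w hw => (mS w).mpr (Or.inl hw), ?_⟩)
    intro h
    exact aS (by rw [h]; exact (mS a).mpr (Or.inr (Or.inr rfl)))

/-- The marked set is closed under the matching. -/
theorem mk_mate (F : Forest H N M lab cls par rank) (C : Climb H N M lab cls rank mk x y) {w : ℕ}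
    (hw : w < N) (h : mk (cls w) ≠ 0) : mk (cls (M w)) ≠ 0 := by
  by_cases hl : lab w = 2
  · by_cases hc : cls w = w
    · rw [hc] at h
      obtain ⟨-, -, -, -, -, h6, h7⟩ := C.mk_outer w hw h hl
      have := (F.nonroot w hw hl hc h6).2
      rwa [F.cls_self _ (F.isMatch.lt w hw) (by omega)]
    · rwa [(F.mate_outer w hw hl hc).2.2]
  · rw [F.cls_self w hw hl] at h
    obtain ⟨h1, h2⟩ := C.mk_inner w hw h hl
    rwa [(F.inner w hw h1).2.2.1]

theorem mk_mate_iff (F : Forest H N M lab cls par rank) (C : Climb H N M lab cls rank mk x y)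
    {w : ℕ} (hw : w < N) : mk (cls (M w)) ≠ 0 ↔ mk (cls w) ≠ 0 := by
  refine ⟨fun h => ?_, C.mk_mate F hw⟩
  have := C.mk_mate F (F.isMatch.lt w hw) h
  rwa [F.isMatch.inv w hw] at this

/-- An exposed vertex is outer; as a base it would be a root of rank `0`, whereas marked bases have
nonzero rank, and vertices other than bases are matched inside their blossom. -/
theorem mate_ne (F : Forest H N M lab cls par rank) (C : Climb H N M lab cls rank mk x y)
    {w : ℕ} (hw : w < N) (h : mk (cls w) ≠ 0) : M w ≠ w := by
  intro h'
  have hl := F.exposed w hw h'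
  by_cases hc : cls w = w
  · rw [hc] at h
    exact (F.nonroot w hw hl hc (C.mk_outer w hw h hl).2.2.2.2.2.1).1 h'
  · exact (F.mate_outer w hw hl hc).1 h'

/-- If the climb reaches two different roots, the matching is not maximum. -/
theorem exists_deficiency_lt (F : Forest H N M lab cls par rank)
    (C : Climb H N M lab cls rank mk x y) (hxy : cls x ≠ cls y) (hx : rank (cls x) = 0)
    (hy : rank (cls y) = 0) : ∃ f, IsMatch H N f ∧ deficiency N f < deficiency N M := by
  have hmx := mk_cls_x F C
  have hmy := mk_cls_x F C.symm
  have hbx := F.cls_lt x C.x_lt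
  have hby := F.cls_lt y C.y_lt
  have hlx := F.lab_cls x C.x_lt C.lab_x
  have hly := F.lab_cls y C.y_lt C.lab_y
  have hcx := F.cls_cls x C.x_lt
  have hcy := F.cls_cls y C.y_lt
  have hMx := F.root _ hbx hlx hcx hx
  have hMy := F.root _ hby hly hcy hy
  have hpm := C.pm_ends hxy
  set S : Finset ℕ := {w ∈ range N | mk (cls w) ≠ 0} with hS
  -- The trail together with both root blossoms. It has a perfect matching, since each root blossom
  -- is factor-critical and can be matched up without the end used by the trail.
  set T : Finset ℕ := {w ∈ range N | mk (cls w) ≠ 0 ∨ cls w = cls x ∨ cls w = cls y} with hT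
  have xS : x ∉ S := by simp [hS, hmx]
  have yS : y ∉ S := by simp [hS, hmy]
  have mS : ∀ w, w ∈ S ↔ w < N ∧ mk (cls w) ≠ 0 := by simp [hS]
  have mT : ∀ w, w ∈ T ↔ w < N ∧ (mk (cls w) ≠ 0 ∨ cls w = cls x ∨ cls w = cls y) := by
    simp [hT]
  have h1 : PM H (insert y ({w ∈ range N | mk (cls w) ≠ 0 ∨ cls w = cls x})) := by
    refine PM.union hpm (F.fc _ hbx hlx hcx x (by simp [C.x_lt])) (fun w => ?_) (fun w hw => ?_)
    · simp only [mem_insert, mem_filter, mem_range, mem_erase, mS]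
      by_cases hwx : w = x
      · subst hwx; simp [C.x_lt]
      · tauto
    · simp only [mem_insert, mS, mem_filter, mem_range, mem_erase] at hw ⊢
      rintro ⟨h1, h2, h3⟩
      rcases hw with rfl | rfl | hw
      · exact h1 rfl
      · exact hxy h3.symm
      · rw [h3] at hw; exact hw.2 hmx
  have h2 : PM H T := by
    refine PM.union h1 (F.fc _ hby hly hcy y (by simp [C.y_lt])) (fun w => ?_) (fun w hw => ?_)
    · simp only [mem_insert, mem_filter, mem_range, mem_erase, mT]
      by_cases hwx : w = y
      · subst hwx; simp [C.y_lt]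
      · tauto
    · simp only [mem_insert, mem_filter, mem_range, mem_erase] at hw ⊢
      rintro ⟨h1, h2, h3⟩
      rcases hw with rfl | ⟨-, hw | hw⟩
      · exact h1 rfl
      · rw [h3] at hw; exact hw hmy
      · exact hxy (hw.symm.trans h3)
  -- As `T` is closed under `M`, the matching can be replaced on `T` alone; the two roots stop being
  -- exposed and no new vertex is exposed.
  have hMT : ∀ w ∈ T, M w ∈ T := by
    intro w hw
    rw [mT] at hw ⊢
    obtain ⟨hwN, hw⟩ := hw
    refine ⟨F.isMatch.lt w hwN, ?_⟩
    rcases hw with hw | hw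
    · exact Or.inl (C.mk_mate F hwN hw)
    have hl : lab w = 2 := by
      by_contra hl
      rw [F.cls_self w hwN hl] at hw
      rcases hw with rfl | rfl
      · exact hl hlx
      · exact hl hly
    by_cases hc : cls w = w
    · rw [hc] at hw
      rcases hw with hw | hw
      · rw [hw, hMx, hcx]; exact Or.inr (Or.inl rfl)
      · rw [hw, hMy, hcy]; exact Or.inr (Or.inr rfl)
    · rw [(F.mate_outer w hwN hl hc).2.2]
      exact Or.inr hw
  have hMT' : ∀ w < N, w ∉ T → M w ∉ T := fun w hw h h' => by
    have := hMT _ h'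
    rw [F.isMatch.inv w hw] at this
    exact h this
  obtain ⟨g, hg⟩ := h2.exists_involution
  refine ⟨fun w => if w ∈ T then g w else M w, ⟨fun w hw => ?_, fun w hw => ?_, fun w hw => ?_⟩, ?_⟩
  · by_cases h : w ∈ T
    · simpa [h] using ((mT _).mp (hg w h).1).1
    · simpa [h] using F.isMatch.lt w hw
  · by_cases h : w ∈ T
    · simp [h, hg w h]
    · simp [h, hMT' w hw h, F.isMatch.inv w hw]
  · by_cases h : w ∈ T
    · simp only [h, if_true]; exact fun _ => (hg w h).2.2
    · simpa [h] using F.isMatch.adj w hw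
  · refine card_lt_card (Finset.ssubset_iff_subset_ne.mpr ⟨fun w hw => ?_, fun h => ?_⟩)
    · simp only [mem_filter, mem_range] at hw ⊢
      by_cases hwT : w ∈ T
      · simp only [hwT, if_true] at hw
        have := (hg w hwT).2.2.ne
        exact absurd hw.2.symm this
      · simpa [hwT] using hw
    · have h3 : cls x ∈ ({w ∈ range N | M w = w} : Finset ℕ) := by simp [hbx, hMx]
      rw [← h] at h3
      have h4 : cls x ∈ T := by rw [mT]; exact ⟨hbx, by simp [hcx]⟩
      simp only [mem_filter, h4, if_true] at h3
      exact (hg _ h4).2.2.ne h3.2.symm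

/-- Shrinking the blossom found by the climb. -/
theorem merge (F : Forest H N M lab cls par rank) (C : Climb H N M lab cls rank mk x y)
    (hxy : cls x = cls y) {lab' cls' : ℕ → ℕ}
    (hcls : ∀ w < N, cls' w = if mk (cls w) ≠ 0 then cls x else cls w)
    (hlab : ∀ w < N, lab' w = if mk (cls w) ≠ 0 then 2 else lab w) :
    Forest H N M lab' cls' par rank ∧
      (({w ∈ range N | mk (cls w) ≠ 0} : Finset ℕ).Nonempty →
        #{w ∈ range N | lab w = 2} < #{w ∈ range N | lab' w = 2}) := by
  have hmx := mk_cls_x F C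
  have hzN := F.cls_lt x C.x_lt
  have hlz := F.lab_cls x C.x_lt C.lab_x
  have hcz := F.cls_cls x C.x_lt
  have hpm := C.pm
  have her := C.pm_erase
  have hou := C.mk_outer
  rw [← hxy] at hou
  set z := cls x with hz
  have hclsz : cls' z = z := by rw [hcls z hzN, hcz, if_neg (by simpa using hmx)]
  have lab_2 : ∀ w < N, lab w = 2 → lab' w = 2 := fun w hw h => by
    rw [hlab w hw, h]; simp
  have cls_of : ∀ w < N, mk (cls w) = 0 → cls' w = cls w ∧ lab' w = lab w := fun w hw h => by
    simp [hcls w hw, hlab w hw, h]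
  have cls_mk : ∀ w < N, mk (cls w) ≠ 0 → cls' w = z ∧ lab' w = 2 := fun w hw h => by
    simp [hcls w hw, hlab w hw, h]
  -- Shrinking creates no new base: the common base `z` is itself unmarked, and every marked vertex
  -- now has the class `z`.
  have base : ∀ b < N, lab' b = 2 → cls' b = b → mk (cls b) = 0 ∧ lab b = 2 ∧ cls b = b := by
    intro b hb hl hc
    by_cases h : mk (cls b) = 0
    · obtain ⟨h1, h2⟩ := cls_of b hb h
      exact ⟨h, h2 ▸ hl, h1 ▸ hc⟩
    · have := (cls_mk b hb h).1
      rw [hc] at this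
      rw [this, hcz] at h
      exact absurd hmx h
  have mate_mk : ∀ w < N, mk (cls w) = 0 → mk (cls (M w)) = 0 := fun w hw h => by
    by_contra h'
    exact (C.mk_mate_iff F hw).mp h' h
  refine ⟨⟨F.isMatch, ?_, ?_, ?_, ?_, ?_, ?_, ?_, ?_, ?_, ?_, ?_⟩, ?_⟩
  · intro w hw
    rw [hlab w hw]
    split
    · rfl
    · exact F.lab_le w hw
  · intro w hw
    rw [hcls w hw]
    split
    · exact hzN
    · exact F.cls_lt w hw
  · intro w hw h
    by_cases hm : mk (cls w) = 0
    · obtain ⟨h1, h2⟩ := cls_of w hw hm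
      rw [h1]
      exact F.cls_self w hw (h2 ▸ h)
    · exact absurd (cls_mk w hw hm).2 h
  · intro w hw h
    by_cases hm : mk (cls w) = 0
    · obtain ⟨h1, h2⟩ := cls_of w hw hm
      rw [h1]
      exact lab_2 _ (F.cls_lt w hw) (F.lab_cls w hw (h2 ▸ h))
    · rw [(cls_mk w hw hm).1]
      exact lab_2 _ hzN hlz
  · intro w hw
    by_cases hm : mk (cls w) = 0
    · rw [(cls_of w hw hm).1, (cls_of (cls w) (F.cls_lt w hw) (by rwa [F.cls_cls w hw])).1,
        F.cls_cls w hw]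
    · rw [(cls_mk w hw hm).1, hclsz]
  · intro w hw hl hc
    have hMw := F.isMatch.lt w hw
    by_cases hm : mk (cls w) = 0
    · obtain ⟨h1, h2⟩ := cls_of w hw hm
      obtain ⟨h3, h4, h5⟩ := F.mate_outer w hw (h2 ▸ hl) (h1 ▸ hc)
      refine ⟨h3, lab_2 _ hMw h4, ?_⟩
      rw [(cls_of _ hMw (mate_mk w hw hm)).1, h1, h5]
    · obtain ⟨h1, h2⟩ := cls_mk _ hMw (C.mk_mate F hw hm)
      exact ⟨C.mate_ne F hw hm, h2, by rw [h1, (cls_mk w hw hm).1]⟩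
  · intro b hb hl hc hr
    obtain ⟨-, h2, h3⟩ := base b hb hl hc
    exact F.root b hb h2 h3 hr
  · intro b hb hl hc hr
    obtain ⟨h1, h2, h3⟩ := base b hb hl hc
    obtain ⟨h4, h5⟩ := F.nonroot b hb h2 h3 hr
    exact ⟨h4, by rw [(cls_of _ (F.isMatch.lt b hb) (mate_mk b hb h1)).2, h5]⟩
  · intro a ha hl
    have hMa := F.isMatch.lt a ha
    have hm : mk (cls a) = 0 := by
      by_contra hm
      have := (cls_mk a ha hm).2
      omega
    rw [(cls_of a ha hm).2] at hl
    obtain ⟨h1, h2, h3, h4, h5, h6⟩ := F.inner a ha hl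
    refine ⟨h1, lab_2 _ hMa h2, by rw [(cls_of _ hMa (mate_mk a ha hm)).1, h3], lab_2 _ h1 h4, h5,
      ?_⟩
    by_cases hmp : mk (cls (par a)) = 0
    · rwa [(cls_of _ h1 hmp).1]
    · rw [(cls_mk _ h1 hmp).1]
      -- If the parent was absorbed, the rank of its blossom has dropped to that of `z` or stayed
      -- equal, so the inequality along the forest survives without any change of ranks.
      exact (hou _ (F.cls_lt _ h1) hmp (F.lab_cls _ h1 h4)).2.2.2.1.trans_lt h6
  · intro b hb hl hc
    obtain ⟨h1, h2, h3⟩ := base b hb hl hc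
    have hfc := F.fc b hb h2 h3
    by_cases hbz : b = z
    · subst hbz
      refine FC.merge (fun w => ?_) (fun w hw hw' => ?_) (x := x) (y := y) (by simp [C.x_lt, z])
        (by simp [C.y_lt, hxy]) hfc hpm fun t ht => ?_
      · simp only [mem_filter, mem_range, ← and_or_left]
        refine and_congr_right fun hw => ?_
        by_cases hm : mk (cls w) = 0
        · simp [(cls_of w hw hm).1, hm]
        · simp [(cls_mk w hw hm).1, hm]
      · simp only [mem_filter, mem_range] at hw hw'
        rw [hw'.2] at hw
        exact hw.2 hmx
      · simp only [mem_filter, mem_range] at ht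
        exact her t ht.1 ht.2
    · have : ({w ∈ range N | cls' w = b} : Finset ℕ) = {w ∈ range N | cls w = b} := by
        refine filter_congr fun w hw => ?_
        rw [mem_range] at hw
        by_cases hm : mk (cls w) = 0
        · rw [(cls_of w hw hm).1]
        · rw [(cls_mk w hw hm).1]
          refine iff_of_false (Ne.symm hbz) fun h => hm ?_
          rw [h, ← h3, h1]
      rwa [this]
  · intro w hw h
    exact lab_2 w hw (F.exposed w hw h)
  · rintro ⟨w, hw⟩
    simp only [mem_filter, mem_range] at hw
    obtain ⟨hw, hm⟩ := hw
    -- A nonempty trail contains an inner vertex: below a marked base lies its mate. Such a vertex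
    -- becomes outer, which gives the strict increase.
    obtain ⟨a, ha, hma, hla⟩ : ∃ a < N, mk (cls a) ≠ 0 ∧ lab a = 1 := by
      by_cases hl : lab w = 2
      · have hcN := F.cls_lt w hw
        have hlc := F.lab_cls w hw hl
        have h := C.mk_outer _ hcN hm hlc
        exact ⟨M (cls w), F.isMatch.lt _ hcN, C.mk_mate F hcN (by rwa [F.cls_cls w hw]),
          (F.nonroot _ hcN hlc h.1 h.2.2.2.2.2.1).2⟩
      · refine ⟨w, hw, hm, ?_⟩
        rw [F.cls_self w hw hl] at hm
        exact (C.mk_inner w hw hm hl).1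
    refine card_lt_card (Finset.ssubset_iff_subset_ne.mpr ⟨fun w hw => ?_, fun h => ?_⟩)
    · simp only [mem_filter, mem_range] at hw ⊢
      exact ⟨hw.1, lab_2 w hw.1 hw.2⟩
    · have h1 : a ∈ ({w ∈ range N | lab' w = 2} : Finset ℕ) := by
        simp [ha, (cls_mk a ha hma).2]
      rw [← h] at h1
      simp [hla] at h1

end Climb

end Blossom

/-! ### Rewriting rules for executing programs symbolically. -/

namespace RAM

theorem State.setVar_var (s : State) (x v y : ℕ) :
    (s.setVar x v).var y = if y = x then v else s.var y := by
  simp [State.setVar, Function.update_apply]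

theorem State.setVar_arr (s : State) (x v : ℕ) : (s.setVar x v).arr = s.arr := rfl

theorem State.setArr_var (s : State) (a i v : ℕ) : (s.setArr a i v).var = s.var := rfl

theorem State.setArr_arr (s : State) (a i v b : ℕ) :
    (s.setArr a i v).arr b = if b = a then Function.update (s.arr a) i v else s.arr b := by
  by_cases h : b = a
  · subst h; simp [State.setArr]
  · simp [State.setArr, h]

namespace LoopProg

theorem run_skip (s : State) : skip.run s = s := rfl
theorem run_assign (x : ℕ) (e : Expr) (s : State) :
    (assign x e).run s = s.setVar x (e.eval s) := rfl
theorem run_write (a : ℕ) (i e : Expr) (s : State) :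
    (write a i e).run s = s.setArr a (i.eval s) (e.eval s) := rfl
theorem run_seq (c d : LoopProg) (s : State) : (seq c d).run s = d.run (c.run s) := rfl
theorem run_cond (e : Expr) (c d : LoopProg) (s : State) :
    (cond e c d).run s = if e.eval s ≠ 0 then c.run s else d.run s := rfl

end LoopProg

/-- An expression whose value is nonzero if and only if the two values differ. -/
def Expr.differ (e₁ e₂ : Expr) : Expr := .add (.sub e₁ e₂) (.sub e₂ e₁)

theorem Expr.eval_differ_ne_zero (e₁ e₂ : Expr) (s : State) :
    (Expr.differ e₁ e₂).eval s ≠ 0 ↔ e₁.eval s ≠ e₂.eval s := by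
  simp only [Expr.differ, Expr.eval]
  omega

end RAM

/-! ### The programs of the search, and correctness of the climb. -/

namespace Blossom

open Finset RAM RAM.Expr RAM.LoopProg

local infixr:60 " ;; " => LoopProg.seq

/-- One step of the climb from the ends in the variables `10` and `11` towards the roots. The arrays
`4`, …, `9` hold the mates, labels, blossoms, parents, ranks and marks; variable `2` is set when
different roots are reached. -/
def climbStep : LoopProg :=
  .cond (sub (read 8 (read 6 (var 11))) (read 8 (read 6 (var 10))))
    (.assign 14 (var 10) ;; .assign 10 (var 11) ;; .assign 11 (var 14)) .skip ;;
  .assign 12 (read 6 (var 10)) ;;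
  .cond (read 8 (var 12))
    (.assign 13 (read 4 (var 12)) ;; .write 9 (var 12) (const 1) ;; .write 9 (var 13) (const 1) ;;
      .assign 10 (read 7 (var 13)))
    (.assign 2 (const 1))

/-- The climb. -/
def climb : LoopProg :=
  .rep 15 (.cond (var 2) .skip
    (.cond (differ (read 6 (var 10)) (read 6 (var 11))) climbStep .skip))

/-- Shrinking of the blossom found by the climb. -/
def shrink : LoopProg :=
  .assign 17 (read 6 (var 10)) ;;
  .rep 16 (.cond (read 9 (read 6 (var 16)))
    (.write 6 (var 16) (var 17) ;; .write 5 (var 16) (const 2)) .skip)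

/-- Treatment of an edge between two blossoms. -/
def handleOuter : LoopProg :=
  .rep 16 (.write 9 (var 16) (const 0)) ;; climb ;; .cond (var 2) .skip shrink

/-- Growth of the forest along an edge from an outer to a free vertex. -/
def growStep : LoopProg :=
  .assign 12 (read 6 (var 10)) ;; .assign 13 (read 4 (var 11)) ;;
  .write 5 (var 11) (const 1) ;; .write 5 (var 13) (const 2) ;; .write 7 (var 11) (var 10) ;;
  .write 8 (var 13) (add (read 8 (var 12)) (const 1))

/-- Treatment of the edge from the variable `10` to the variable `11`. -/
def handleEdge : LoopProg :=
  .cond (var 2) .skip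
    (.cond (sub (read 5 (var 10)) (const 1))
      (.cond (read 5 (var 11))
        (.cond (sub (read 5 (var 11)) (const 1))
          (.cond (differ (read 6 (var 10)) (read 6 (var 11))) handleOuter .skip) .skip)
        growStep) .skip)

/-- There is a matching larger than the one in memory. -/
def Better (H : SimpleGraph ℕ) (s : State) : Prop :=
  ∃ f, IsMatch H (s.var 1) f ∧ deficiency (s.var 1) f < deficiency (s.var 1) (s.arr 4)

/-- The arrays of the memory form a forest. -/
abbrev IsForest (H : SimpleGraph ℕ) (s : State) : Prop :=
  Forest H (s.var 1) (s.arr 4) (s.arr 5) (s.arr 6) (s.arr 7) (s.arr 8)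

/-- The memory is in a state of the climb. -/
abbrev IsClimb (H : SimpleGraph ℕ) (s : State) : Prop :=
  Climb H (s.var 1) (s.arr 4) (s.arr 5) (s.arr 6) (s.arr 8) (s.arr 9) (s.var 10) (s.var 11)

/-- The number of vertices marked in the climb. -/
def marked (s : State) : ℕ := #{w ∈ range (s.var 1) | s.arr 9 (s.arr 6 w) ≠ 0}

/-- The number of outer vertices. -/
def outer (s : State) : ℕ := #{w ∈ range (s.var 1) | s.arr 5 w = 2}

variable {H : SimpleGraph ℕ} {s : State}

theorem climbStep_spec (F : IsForest H s) (C : IsClimb H s)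
    (hxy : s.arr 6 (s.var 10) ≠ s.arr 6 (s.var 11)) :
    ((climbStep.run s).var 2 ≠ 0 ∧ Better H s) ∨
      ((climbStep.run s).var 2 = s.var 2 ∧ IsClimb H (climbStep.run s) ∧
        marked s < marked (climbStep.run s)) := by
  -- The part of the step after the possible exchange of the two ends; `s₁` is the memory at that
  -- point. If even the larger rank is `0`, both ends are in root blossoms.
  have key : ∀ s₁ : State, s₁.arr = s.arr → s₁.var 1 = s.var 1 → s₁.var 2 = s.var 2 →
      IsClimb H s₁ → s.arr 6 (s₁.var 10) ≠ s.arr 6 (s₁.var 11) →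
      s.arr 8 (s.arr 6 (s₁.var 11)) ≤ s.arr 8 (s.arr 6 (s₁.var 10)) →
      ∀ s₂, s₂ = (assign 12 (read 6 (var 10)) ;; .cond (read 8 (var 12))
        (.assign 13 (read 4 (var 12)) ;; .write 9 (var 12) (const 1) ;;
          .write 9 (var 13) (const 1) ;; .assign 10 (read 7 (var 13)))
        (.assign 2 (const 1))).run s₁ →
      (s₂.var 2 ≠ 0 ∧ Better H s) ∨
        (s₂.var 2 = s.var 2 ∧ IsClimb H s₂ ∧ marked s < marked s₂) := by
    intro s₁ ha h1 h2 C₁ hne hr s₂ hs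
    unfold IsClimb at C₁
    rw [h1, ha] at C₁
    by_cases h0 : s.arr 8 (s.arr 6 (s₁.var 10)) = 0
    · left
      refine ⟨?_, C₁.exists_deficiency_lt F hne h0 (by omega)⟩
      rw [hs]
      simp [run_seq, run_assign, run_cond, Expr.eval, State.setVar_var, State.setVar_arr, ha, h0]
    · right
      have := C₁.step F hne hr h0
      have e : s₂ = _ := hs
      simp only [run_seq, run_assign, run_cond, run_write, Expr.eval, State.setVar_var,
        State.setVar_arr, ha, State.setArr_var, State.setArr_arr] at e
      simp at e
      rw [if_neg h0] at e
      subst e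
      simpa [IsClimb, marked, State.setVar_var, State.setVar_arr, State.setArr_var,
        State.setArr_arr, h1, h2, ha] using this
  unfold climbStep
  rw [run_seq]
  by_cases hr : s.arr 8 (s.arr 6 (s.var 11)) ≤ s.arr 8 (s.arr 6 (s.var 10))
  · rw [run_cond, if_neg (by simp only [Expr.eval]; omega)]
    exact key s rfl rfl rfl C hxy hr _ rfl
  · rw [run_cond, if_pos (by simp only [Expr.eval]; omega)]
    refine key _ ?_ ?_ ?_ ?_ ?_ ?_ _ rfl
    · rfl
    · rfl
    · rfl
    · exact C.symm
    · exact hxy.symm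
    · exact (not_le.mp hr).le

/-- Each unfinished round marks a further vertex, while the current end is never marked. Hence fewer
than `s.var 1` vertices are marked, and the loop bound suffices for the climb to finish. -/
theorem climb_spec (F : IsForest H s) (C : IsClimb H s) (h2 : s.var 2 = 0)
    (hxy : s.arr 6 (s.var 10) ≠ s.arr 6 (s.var 11)) :
    ((climb.run s).var 2 ≠ 0 ∧ Better H s) ∨
      ((climb.run s).var 2 = 0 ∧ IsClimb H (climb.run s) ∧ 0 < marked (climb.run s) ∧
        s.arr 6 ((climb.run s).var 10) = s.arr 6 ((climb.run s).var 11)) := by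
  have key := rep_induction (i := 15) (c := .cond (var 2) .skip
    (.cond (differ (read 6 (var 10)) (read 6 (var 11))) climbStep .skip)) (by decide) s
    (fun k s' => (s'.arr 4 = s.arr 4 ∧ s'.arr 5 = s.arr 5 ∧ s'.arr 6 = s.arr 6 ∧
      s'.arr 7 = s.arr 7 ∧ s'.arr 8 = s.arr 8) ∧
      ((s'.var 2 ≠ 0 ∧ Better H s) ∨ (s'.var 2 = 0 ∧ IsClimb H s' ∧
        ((s'.arr 6 (s'.var 10) ≠ s'.arr 6 (s'.var 11) ∧ k ≤ marked s') ∨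
          (s'.arr 6 (s'.var 10) = s'.arr 6 (s'.var 11) ∧ 0 < marked s')))))
    ⟨⟨rfl, rfl, rfl, rfl, rfl⟩, Or.inr ⟨h2, C, Or.inl ⟨hxy, Nat.zero_le _⟩⟩⟩ ?_
  · obtain ⟨⟨-, -, h6, -, -⟩, h | ⟨h, C', h' | h'⟩⟩ := key
    · exact Or.inl h
    · have h1 : (climb.run s).var 1 = s.var 1 := run_var (by decide) s
      have C'' : IsClimb H (climb.run s) := C'
      have h8 : s.var 1 ≤ marked (climb.run s) := h'.2
      exfalso
      have hx : (climb.run s).var 10 ∉ ({w ∈ range ((climb.run s).var 1) |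
          (climb.run s).arr 9 ((climb.run s).arr 6 w) ≠ 0} : Finset ℕ) := by
        have e4 : (climb.run s).arr 4 = s.arr 4 := run_arr (by decide) s
        have e5 : (climb.run s).arr 5 = s.arr 5 := run_arr (by decide) s
        have e6 : (climb.run s).arr 6 = s.arr 6 := run_arr (by decide) s
        have e7 : (climb.run s).arr 8 = s.arr 8 := run_arr (by decide) s
        rw [IsClimb, h1, e4, e5, e6, e7] at C''
        have := C''.mk_cls_x F
        simp [e6, this]
      have := card_lt_card (s := ({w ∈ range ((climb.run s).var 1) |
          (climb.run s).arr 9 ((climb.run s).arr 6 w) ≠ 0} : Finset ℕ))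
        (t := range ((climb.run s).var 1)) (Finset.ssubset_iff_subset_ne.mpr
          ⟨filter_subset _ _, fun h => hx (by rw [h]; exact mem_range.mpr C''.x_lt)⟩)
      rw [card_range, h1] at this
      rw [marked, h1] at h8
      omega
    · exact Or.inr ⟨h, C', h'.2, h6 ▸ h'.1⟩
  · rintro k - s' h1 - ⟨⟨a4, a5, a6, a7, a8⟩, h⟩
    have F' : IsForest H s' := by rw [IsForest, h1, a4, a5, a6, a7, a8]; exact F
    have fr : ∀ a, (a = 4 ∨ a = 5 ∨ a = 6 ∨ a = 7 ∨ a = 8) →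
        (((LoopProg.cond (var 2) .skip (.cond (differ (read 6 (var 10)) (read 6 (var 11))) climbStep
          .skip)).run s').setVar 15 (k + 1)).arr a = s'.arr a := by
      intro a ha
      rw [State.setVar_arr]
      rcases ha with rfl | rfl | rfl | rfl | rfl <;> exact run_arr (by decide) _
    refine ⟨⟨by rw [fr 4 (by simp), a4], by rw [fr 5 (by simp), a5], by rw [fr 6 (by simp), a6],
      by rw [fr 7 (by simp), a7], by rw [fr 8 (by simp), a8]⟩, ?_⟩
    rw [run_cond]
    rcases h with ⟨h, hb⟩ | ⟨h, C', h' | h'⟩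
    · left
      rw [if_pos (by simpa [Expr.eval] using h)]
      exact ⟨h, hb⟩
    · rw [if_neg (by simpa [Expr.eval] using h), run_cond,
        if_pos (by rw [eval_differ_ne_zero]; exact h'.1)]
      have b' : Better H s' → Better H s := by
        rintro ⟨f, hf⟩
        refine ⟨f, ?_⟩
        rwa [h1, a4] at hf
      rcases climbStep_spec F' C' h'.1 with ⟨h3, h4⟩ | ⟨h3, h4, h5⟩
      · exact Or.inl ⟨h3, b' h4⟩
      · refine Or.inr ⟨h3.trans h, h4, ?_⟩
        have h6 : k + 1 ≤ marked (climbStep.run s') := by omega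
        by_cases hc : (climbStep.run s').arr 6 ((climbStep.run s').var 10) =
            (climbStep.run s').arr 6 ((climbStep.run s').var 11)
        · exact Or.inr ⟨hc, Nat.lt_of_lt_of_le (Nat.succ_pos k) h6⟩
        · exact Or.inl ⟨hc, h6⟩
    · rw [if_neg (by simpa [Expr.eval] using h), run_cond,
        if_neg (by rw [eval_differ_ne_zero]; exact not_not.mpr h'.1)]
      exact Or.inr ⟨h, C', Or.inr h'⟩

end Blossom

/-! ### Correctness of shrinking, growing and the treatment of one edge. -/

namespace Blossom

open Finset RAM RAM.Expr RAM.LoopProg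

local infixr:60 " ;; " => LoopProg.seq

variable {H : SimpleGraph ℕ} {s : State}

/-- The loop overwrites the classes that it also reads. This is harmless: round `k` reads only the
class of `k`, which no earlier round has changed, and the new base was saved in variable `17`. -/
theorem shrink_spec (F : IsForest H s) (C : IsClimb H s)
    (hxy : s.arr 6 (s.var 10) = s.arr 6 (s.var 11)) (hm : 0 < marked s) :
    IsForest H (shrink.run s) ∧ outer s < outer (shrink.run s) := by
  set z := s.arr 6 (s.var 10) with hz
  have key := rep_induction (i := 16) (c := .cond (read 9 (read 6 (var 16)))
    (.write 6 (var 16) (var 17) ;; .write 5 (var 16) (const 2)) .skip) (by decide) (s.setVar 17 z)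
    (fun k s' => s'.arr 9 = s.arr 9 ∧ s'.var 17 = z ∧
      (∀ w, s'.arr 6 w = if w < k ∧ s.arr 9 (s.arr 6 w) ≠ 0 then z else s.arr 6 w) ∧
      (∀ w, s'.arr 5 w = if w < k ∧ s.arr 9 (s.arr 6 w) ≠ 0 then 2 else s.arr 5 w))
    ⟨rfl, by simp [State.setVar_var], by simp [State.setVar_arr], by simp [State.setVar_arr]⟩ ?_
  · have e : shrink.run s = (rep 16 (.cond (read 9 (read 6 (var 16)))
      (.write 6 (var 16) (var 17) ;; .write 5 (var 16) (const 2)) .skip)).run (s.setVar 17 z) := rfl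
    rw [← e] at key
    have h1 : (shrink.run s).var 1 = s.var 1 := run_var (by decide) s
    have e4 : (shrink.run s).arr 4 = s.arr 4 := run_arr (by decide) s
    have e7 : (shrink.run s).arr 7 = s.arr 7 := run_arr (by decide) s
    have e8 : (shrink.run s).arr 8 = s.arr 8 := run_arr (by decide) s
    have h17 : (s.setVar 17 z).var 1 = s.var 1 := by simp [State.setVar_var]
    obtain ⟨-, -, h6, h5⟩ := key
    rw [h17] at h6 h5
    have := C.merge F hxy (cls' := (shrink.run s).arr 6) (lab' := (shrink.run s).arr 5)
      (fun w hw => by rw [h6 w]; simp [hw, hz]) (fun w hw => by rw [h5 w]; simp [hw])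
    refine ⟨by rw [IsForest, h1, e4, e7, e8]; exact this.1, ?_⟩
    have h := this.2 (card_pos.mp hm)
    rwa [outer, outer, h1]
  · rintro k - s' - hk ⟨h9, h17, h6, h5⟩
    by_cases h : s.arr 9 (s.arr 6 k) = 0
    · rw [run_cond, if_neg (by simp [Expr.eval, hk, h6, h9, h])]
      refine ⟨h9, by simpa [State.setVar_var, run_skip] using h17, fun w => ?_, fun w => ?_⟩
      · have : w < k + 1 ∧ s.arr 9 (s.arr 6 w) ≠ 0 ↔ w < k ∧ s.arr 9 (s.arr 6 w) ≠ 0 := by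
          constructor
          · rintro ⟨h1, h2⟩
            refine ⟨lt_of_le_of_ne (by omega) ?_, h2⟩
            rintro rfl; exact h2 h
          · rintro ⟨h1, h2⟩; exact ⟨by omega, h2⟩
        simp only [this]
        exact h6 w
      · have : w < k + 1 ∧ s.arr 9 (s.arr 6 w) ≠ 0 ↔ w < k ∧ s.arr 9 (s.arr 6 w) ≠ 0 := by
          constructor
          · rintro ⟨h1, h2⟩
            refine ⟨lt_of_le_of_ne (by omega) ?_, h2⟩
            rintro rfl; exact h2 h
          · rintro ⟨h1, h2⟩; exact ⟨by omega, h2⟩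
        simp only [this]
        exact h5 w
    · rw [run_cond, if_pos (by simp [Expr.eval, hk, h6, h9, h])]
      simp only [run_seq, run_write, Expr.eval, State.setVar_var, State.setVar_arr,
        State.setArr_var, State.setArr_arr, hk, h17, h9]
      refine ⟨by simp, by simp, fun w => ?_, fun w => ?_⟩
      · by_cases hw : w = k
        · subst hw; simp [h]
        · have : w < k + 1 ↔ w < k := by omega
          simp [hw, this, h6]
      · by_cases hw : w = k
        · subst hw; simp [h]
        · have : w < k + 1 ↔ w < k := by omega
          simp [hw, this, h5]

/-- A loop that overwrites an initial segment of an array with a value that does not depend on the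
contents of that array. -/
theorem rep_write_spec {i a : ℕ} {e : Expr} (hi : i ≠ 1) (s : State) (g : ℕ → ℕ)
    (hg : ∀ k s', s'.arr = Function.update s.arr a (s'.arr a) → (∀ x ≠ i, s'.var x = s.var x) →
      s'.var i = k → (∀ w ≥ k, s'.arr a w = s.arr a w) → e.eval s' = g k) :
    ∀ w, ((rep i (.write a (var i) e)).run s).arr a w =
      if w < s.var 1 then g w else s.arr a w := by
  have key := rep_induction (i := i) (c := .write a (var i) e) (by simp [wf, keepsVar, hi]) s
    (fun k s' => s'.arr = Function.update s.arr a (s'.arr a) ∧ (∀ x ≠ i, s'.var x = s.var x) ∧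
      ∀ w, s'.arr a w = if w < k then g w else s.arr a w)
    ⟨by simp [State.setVar_arr], fun x hx => by simp [State.setVar_var, hx],
      by simp [State.setVar_arr]⟩ ?_
  · exact key.2.2
  · rintro k - s' - hk ⟨h1, h2, h3⟩
    have he := hg k s' h1 h2 hk fun w hw => by rw [h3 w, if_neg (by omega)]
    refine ⟨?_, fun x hx => by simp [State.setVar_var, hx, run_write, State.setArr_var, h2 x hx],
      fun w => ?_⟩
    · funext b
      by_cases hb : b = a
      · subst hb; simp
      · simp only [run_write, State.setVar_arr, State.setArr_arr, hb, if_false, ne_eq,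
          not_false_eq_true, Function.update_of_ne]
        rw [h1]; simp [hb]
    · simp only [run_write, State.setVar_arr, State.setArr_arr, if_true, Expr.eval, hk]
      by_cases hw : w = k
      · subst hw; simp [he]
      · have : w < k + 1 ↔ w < k := by omega
        simp [hw, this, h3]

theorem handleOuter_spec (F : IsForest H s) (h2 : s.var 2 = 0) (hx : s.var 10 < s.var 1)
    (hy : s.var 11 < s.var 1) (hlx : s.arr 5 (s.var 10) = 2) (hly : s.arr 5 (s.var 11) = 2)
    (hadj : H.Adj (s.var 10) (s.var 11)) (hxy : s.arr 6 (s.var 10) ≠ s.arr 6 (s.var 11)) :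
    IsForest H (handleOuter.run s) ∧ (((handleOuter.run s).var 2 ≠ 0 ∧ Better H s) ∨
      ((handleOuter.run s).var 2 = 0 ∧ outer s < outer (handleOuter.run s))) := by
  have h9 := rep_write_spec (i := 16) (a := 9) (e := const 0) (by decide) s (fun _ => 0)
    (fun _ _ _ _ _ _ => rfl)
  have e : handleOuter.run s = (LoopProg.cond (var 2) .skip shrink).run (climb.run
    ((rep 16 (.write 9 (var 16) (const 0))).run s)) := rfl
  rw [e]
  set s₁ := (rep 16 (.write 9 (var 16) (const 0))).run s with hs₁
  have v1 : s₁.var 1 = s.var 1 := run_var (by decide) s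
  have v2 : s₁.var 2 = s.var 2 := run_var (by decide) s
  have vx : s₁.var 10 = s.var 10 := run_var (by decide) s
  have vy : s₁.var 11 = s.var 11 := run_var (by decide) s
  have a4 : s₁.arr 4 = s.arr 4 := run_arr (by decide) s
  have a5 : s₁.arr 5 = s.arr 5 := run_arr (by decide) s
  have a6 : s₁.arr 6 = s.arr 6 := run_arr (by decide) s
  have a7 : s₁.arr 7 = s.arr 7 := run_arr (by decide) s
  have a8 : s₁.arr 8 = s.arr 8 := run_arr (by decide) s
  have F₁ : IsForest H s₁ := by rw [IsForest, v1, a4, a5, a6, a7, a8]; exact F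
  have C₁ : IsClimb H s₁ := by
    rw [IsClimb, v1, a4, a5, a6, a8, vx, vy]
    exact Climb.init F (fun w hw => by rw [h9 w, if_pos hw]) hx hy hlx hly hadj
  have b : Better H s₁ → Better H s := by
    rw [Better, Better, v1, a4]; exact id
  have o₁ : outer s₁ = outer s := by rw [outer, outer, v1, a5]
  have spec := climb_spec F₁ C₁ (v2.trans h2) (by rwa [a6, vx, vy])
  set s₂ := climb.run s₁ with hs₂
  have v1' : s₂.var 1 = s₁.var 1 := run_var (by decide) s₁
  have a4' : s₂.arr 4 = s₁.arr 4 := run_arr (by decide) s₁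
  have a5' : s₂.arr 5 = s₁.arr 5 := run_arr (by decide) s₁
  have a6' : s₂.arr 6 = s₁.arr 6 := run_arr (by decide) s₁
  have a7' : s₂.arr 7 = s₁.arr 7 := run_arr (by decide) s₁
  have a8' : s₂.arr 8 = s₁.arr 8 := run_arr (by decide) s₁
  have F₂ : IsForest H s₂ := by rw [IsForest, v1', a4', a5', a6', a7', a8']; exact F₁
  have o₂ : outer s₂ = outer s₁ := by rw [outer, outer, v1', a5']
  rw [run_cond]
  rcases spec with ⟨h, hb⟩ | ⟨h, C₂, hm, hc⟩
  · rw [if_pos (by simpa [Expr.eval] using h)]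
    exact ⟨F₂, Or.inl ⟨h, b hb⟩⟩
  · rw [if_neg (by simpa [Expr.eval] using h)]
    have := shrink_spec F₂ C₂ (by rwa [a6']) hm
    have v2' : (shrink.run s₂).var 2 = s₂.var 2 := run_var (by decide) s₂
    exact ⟨this.1, Or.inr ⟨v2'.trans h, by rw [← o₁, ← o₂]; exact this.2⟩⟩

theorem growStep_spec (F : IsForest H s) (hx : s.var 10 < s.var 1)
    (hy : s.var 11 < s.var 1) (hlx : s.arr 5 (s.var 10) = 2) (hly : s.arr 5 (s.var 11) = 0)
    (hadj : H.Adj (s.var 10) (s.var 11)) :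
    IsForest H (growStep.run s) ∧ outer s < outer (growStep.run s) := by
  have h := F.grow hx hy hadj hlx hly
  have hmf := F.mate_free hy hly
  have a5 : (growStep.run s).arr 5 = Function.update (Function.update (s.arr 5) (s.var 11) 1)
      (s.arr 4 (s.var 11)) 2 := by
    simp [growStep, run_seq, run_assign, run_write, Expr.eval, State.setVar_var, State.setVar_arr,
      State.setArr_var, State.setArr_arr]
  have a7 : (growStep.run s).arr 7 = Function.update (s.arr 7) (s.var 11) (s.var 10) := by
    simp [growStep, run_seq, run_assign, run_write, Expr.eval, State.setVar_var, State.setVar_arr,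
      State.setArr_var, State.setArr_arr]
  have a8 : (growStep.run s).arr 8 = Function.update (s.arr 8) (s.arr 4 (s.var 11))
      (s.arr 8 (s.arr 6 (s.var 10)) + 1) := by
    simp [growStep, run_seq, run_assign, run_write, Expr.eval, State.setVar_var, State.setVar_arr,
      State.setArr_var, State.setArr_arr]
  have v1 : (growStep.run s).var 1 = s.var 1 := run_var (by decide) s
  have a4 : (growStep.run s).arr 4 = s.arr 4 := run_arr (by decide) s
  have a6 : (growStep.run s).arr 6 = s.arr 6 := run_arr (by decide) s
  refine ⟨by rw [IsForest, v1, a4, a5, a6, a7, a8]; exact h, ?_⟩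
  rw [outer, outer, v1, a5]
  refine card_lt_card (Finset.ssubset_iff_subset_ne.mpr ⟨fun w hw => ?_, fun h => ?_⟩)
  · simp only [mem_filter, mem_range] at hw ⊢
    refine ⟨hw.1, ?_⟩
    rw [Function.update_of_ne (by rintro rfl; omega), Function.update_of_ne (by rintro rfl; omega)]
    exact hw.2
  · have : s.arr 4 (s.var 11) ∈ ({w ∈ range (s.var 1) | s.arr 5 w = 2} : Finset ℕ) := by
      rw [h]; simp [F.isMatch.lt _ hy]
    simp only [mem_filter] at this
    omega

/-- The edge from `u` to `v` cannot be used to continue the search. -/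
def EdgeClosed (lab cls : ℕ → ℕ) (u v : ℕ) : Prop :=
  lab u = 2 → lab v = 1 ∨ (lab v = 2 ∧ cls u = cls v)

/-- The alternatives make the number of outer vertices a measure of progress: an edge that can
continue the search raises it or reveals a larger matching, and any other edge leaves the whole
memory as it was. -/
theorem handleEdge_spec (F : IsForest H s) (h2 : s.var 2 = 0) (hx : s.var 10 < s.var 1)
    (hy : s.var 11 < s.var 1) (hadj : H.Adj (s.var 10) (s.var 11)) :
    IsForest H (handleEdge.run s) ∧ (((handleEdge.run s).var 2 ≠ 0 ∧ Better H s) ∨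
      ((handleEdge.run s).var 2 = 0 ∧
        ((¬ EdgeClosed (s.arr 5) (s.arr 6) (s.var 10) (s.var 11) ∧
            outer s < outer (handleEdge.run s)) ∨
          (EdgeClosed (s.arr 5) (s.arr 6) (s.var 10) (s.var 11) ∧ handleEdge.run s = s)))) := by
  have lx := F.lab_le _ hx
  have ly := F.lab_le _ hy
  unfold handleEdge EdgeClosed
  rw [run_cond, if_neg (by simpa [Expr.eval] using h2), run_cond]
  by_cases h : s.arr 5 (s.var 10) = 2
  swap
  · rw [if_neg (by simp only [Expr.eval]; omega)]
    exact ⟨F, Or.inr ⟨h2, Or.inr ⟨fun h' => absurd h' h, rfl⟩⟩⟩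
  rw [if_pos (by simp only [Expr.eval]; omega), run_cond]
  by_cases h0 : s.arr 5 (s.var 11) = 0
  · rw [if_neg (by simpa [Expr.eval] using h0)]
    have := growStep_spec F hx hy h h0 hadj
    have v2 : (growStep.run s).var 2 = s.var 2 := run_var (by decide) s
    refine ⟨this.1, Or.inr ⟨v2.trans h2, Or.inl ⟨fun h' => ?_, this.2⟩⟩⟩
    have := h' h
    omega
  rw [if_pos (by simpa [Expr.eval] using h0), run_cond]
  by_cases h1 : s.arr 5 (s.var 11) = 1
  · rw [if_neg (by simp only [Expr.eval]; omega)]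
    exact ⟨F, Or.inr ⟨h2, Or.inr ⟨fun _ => Or.inl h1, rfl⟩⟩⟩
  have hly : s.arr 5 (s.var 11) = 2 := by omega
  rw [if_pos (by simp only [Expr.eval]; omega), run_cond]
  by_cases hc : s.arr 6 (s.var 10) = s.arr 6 (s.var 11)
  · rw [if_neg (by rw [eval_differ_ne_zero]; exact not_not.mpr hc)]
    exact ⟨F, Or.inr ⟨h2, Or.inr ⟨fun _ => Or.inr ⟨hly, hc⟩, rfl⟩⟩⟩
  · rw [if_pos (by rw [eval_differ_ne_zero]; exact hc)]
    obtain ⟨h3, h4 | h4⟩ := handleOuter_spec F h2 hx hy h hly hadj hc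
    · exact ⟨h3, Or.inl h4⟩
    · refine ⟨h3, Or.inr ⟨h4.1, Or.inl ⟨fun h' => ?_, h4.2⟩⟩⟩
      rcases h' h with h' | h'
      · exact h1 h'
      · exact hc h'.2

theorem handleEdge_found (h2 : s.var 2 ≠ 0) : handleEdge.run s = s := by
  unfold handleEdge
  rw [run_cond, if_pos (by simpa [Expr.eval] using h2)]
  rfl

end Blossom

/-! ### The complete search for a larger matching. -/

namespace Blossom

open Finset RAM RAM.Expr RAM.LoopProg

local infixr:60 " ;; " => LoopProg.seq

variable {H : SimpleGraph ℕ} {s : State}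

/-- Treatment of the edge number `19` in both directions. The ends of the edges are in the arrays
`1` and `2`; array `3` tells which edges are present. -/
def scanEdge : LoopProg :=
  .cond (read 3 (var 19))
    ((.assign 10 (read 1 (var 19)) ;; .assign 11 (read 2 (var 19)) ;; handleEdge) ;;
      (.assign 10 (read 2 (var 19)) ;; .assign 11 (read 1 (var 19)) ;; handleEdge)) .skip

/-- Treatment of all edges. -/
def scanAll : LoopProg := .rep 19 scanEdge

/-- Initialization of the search. -/
def initSearch : LoopProg :=
  .assign 2 (const 0) ;;
  .rep 16 (.write 6 (var 16) (var 16)) ;;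
  .rep 16 (.write 8 (var 16) (const 0)) ;;
  .rep 16 (.write 5 (var 16)
    (sub (const 2) (add (differ (read 4 (var 16)) (var 16)) (differ (read 4 (var 16)) (var 16)))))

/-- The search for a larger matching: variable `2` tells whether there is one. -/
def search : LoopProg := initSearch ;; .rep 18 scanAll ;; scanAll

/-- Neither direction of the edge `j` can be used to continue the search. -/
def ClosedAt (s : State) (j : ℕ) : Prop :=
  s.arr 3 j ≠ 0 → EdgeClosed (s.arr 5) (s.arr 6) (s.arr 1 j) (s.arr 2 j) ∧
    EdgeClosed (s.arr 5) (s.arr 6) (s.arr 2 j) (s.arr 1 j)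

/-- The edges in memory are edges of `H`. -/
def EdgesOf (H : SimpleGraph ℕ) (s : State) : Prop :=
  ∀ j < s.var 1, s.arr 3 j ≠ 0 → s.arr 1 j < s.var 1 ∧ s.arr 2 j < s.var 1 ∧
    H.Adj (s.arr 1 j) (s.arr 2 j)

/-- The two states agree on the graph and the matching. -/
def SameInput (s s' : State) : Prop :=
  s'.var 1 = s.var 1 ∧ s'.arr 1 = s.arr 1 ∧ s'.arr 2 = s.arr 2 ∧ s'.arr 3 = s.arr 3 ∧
    s'.arr 4 = s.arr 4

theorem SameInput.trans {s₁ s₂ s₃ : State} (h : SameInput s₁ s₂) (h' : SameInput s₂ s₃) :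
    SameInput s₁ s₃ :=
  ⟨h'.1.trans h.1, h'.2.1.trans h.2.1, h'.2.2.1.trans h.2.2.1, h'.2.2.2.1.trans h.2.2.2.1,
    h'.2.2.2.2.trans h.2.2.2.2⟩

theorem SameInput.better {s' : State} (h : SameInput s s') : Better H s' ↔ Better H s := by
  rw [Better, Better, h.1, h.2.2.2.2]

theorem SameInput.edgesOf {s' : State} (h : SameInput s s') (hE : EdgesOf H s) : EdgesOf H s' := by
  obtain ⟨h1, h2, h3, h4, -⟩ := h
  rw [EdgesOf, h1, h2, h3, h4]
  exact hE

theorem sameInput_run {c : LoopProg} (h : (c.keepsVar 1 && c.keepsArr 1 && c.keepsArr 2 &&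
    c.keepsArr 3 && c.keepsArr 4) = true) (s : State) : SameInput s (c.run s) := by
  simp only [Bool.and_eq_true] at h
  exact ⟨run_var h.1.1.1.1 s, run_arr h.1.1.1.2 s, run_arr h.1.1.2 s, run_arr h.1.2 s,
    run_arr h.2 s⟩

/-- The program evaluates `e₂` only after variable `10` has been overwritten; `he` says that this
does not matter. -/
theorem handleEdge_at {e₁ e₂ : Expr} (F : IsForest H s) (h2 : s.var 2 = 0)
    (he : e₂.eval (s.setVar 10 (e₁.eval s)) = e₂.eval s) (hx : e₁.eval s < s.var 1)
    (hy : e₂.eval s < s.var 1) (hadj : H.Adj (e₁.eval s) (e₂.eval s)) (s' : State)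
    (hs' : s' = (LoopProg.assign 10 e₁ ;; .assign 11 e₂ ;; handleEdge).run s) :
    IsForest H s' ∧ ((s'.var 2 ≠ 0 ∧ Better H s) ∨ (s'.var 2 = 0 ∧
        ((¬ EdgeClosed (s.arr 5) (s.arr 6) (e₁.eval s) (e₂.eval s) ∧ outer s < outer s') ∨
          (EdgeClosed (s.arr 5) (s.arr 6) (e₁.eval s) (e₂.eval s) ∧ s'.arr = s.arr ∧
            outer s' = outer s)))) := by
  set s₁ := (s.setVar 10 (e₁.eval s)).setVar 11 (e₂.eval s) with hs₁
  have e : s' = handleEdge.run s₁ := by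
    rw [hs', hs₁, ← he]; rfl
  have v10 : s₁.var 10 = e₁.eval s := by simp [hs₁, State.setVar_var]
  have v11 : s₁.var 11 = e₂.eval s := by simp [hs₁, State.setVar_var]
  have v1 : s₁.var 1 = s.var 1 := by simp [hs₁, State.setVar_var]
  have v2 : s₁.var 2 = s.var 2 := by simp [hs₁, State.setVar_var]
  have a : s₁.arr = s.arr := rfl
  have o : outer s₁ = outer s := by rw [outer, outer, v1, a]
  have F₁ : IsForest H s₁ := by rw [IsForest, v1, a]; exact F
  have b : Better H s₁ ↔ Better H s := by rw [Better, Better, v1, a]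
  have := handleEdge_spec F₁ (v2.trans h2) (by rwa [v10, v1]) (by rwa [v11, v1])
    (by rwa [v10, v11])
  rw [← e, v10, v11, a, o, b] at this
  obtain ⟨h3, h4 | ⟨h4, h5 | ⟨h5, h6⟩⟩⟩ := this
  · exact ⟨h3, Or.inl h4⟩
  · exact ⟨h3, Or.inr ⟨h4, Or.inl h5⟩⟩
  · exact ⟨h3, Or.inr ⟨h4, Or.inr ⟨h5, by rw [h6, a], by rw [h6, o]⟩⟩⟩

theorem scanEdge_spec (F : IsForest H s) (hE : EdgesOf H s) (h2 : s.var 2 = 0)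
    (hj : s.var 19 < s.var 1) :
    IsForest H (scanEdge.run s) ∧ (((scanEdge.run s).var 2 ≠ 0 ∧ Better H s) ∨
      ((scanEdge.run s).var 2 = 0 ∧ ((¬ ClosedAt s (s.var 19) ∧ outer s < outer (scanEdge.run s)) ∨
        (ClosedAt s (s.var 19) ∧ (scanEdge.run s).arr = s.arr ∧
          outer (scanEdge.run s) = outer s)))) := by
  unfold ClosedAt scanEdge
  rw [run_cond]
  by_cases h3 : s.arr 3 (s.var 19) = 0
  · rw [if_neg (by simpa [Expr.eval] using h3)]
    exact ⟨F, Or.inr ⟨h2, Or.inr ⟨fun h => absurd h3 h, rfl, rfl⟩⟩⟩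
  rw [if_pos (by simpa [Expr.eval] using h3), run_seq]
  obtain ⟨hx, hy, hadj⟩ := hE _ hj h3
  have S := sameInput_run (c := .assign 10 (read 1 (var 19)) ;; .assign 11 (read 2 (var 19)) ;;
    handleEdge) (by decide) s
  have v19 : ((LoopProg.assign 10 (read 1 (var 19)) ;; .assign 11 (read 2 (var 19)) ;;
    handleEdge).run s).var 19 = s.var 19 := run_var (by decide) s
  have spec := handleEdge_at (e₁ := read 1 (var 19)) (e₂ := read 2 (var 19)) F h2
    (by simp [Expr.eval, State.setVar_var, State.setVar_arr]) hx hy hadj _ rfl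
  set s₁ := (LoopProg.assign 10 (read 1 (var 19)) ;; .assign 11 (read 2 (var 19)) ;;
    handleEdge).run s with hs₁
  simp only [Expr.eval] at spec
  obtain ⟨F₁, ⟨h4, h5⟩ | ⟨h4, h5⟩⟩ := spec
  · set s₂ := (s₁.setVar 10 (s₁.arr 2 (s₁.var 19))).setVar 11 (s₁.arr 1 (s₁.var 19)) with hs₂
    have e : (LoopProg.assign 10 (read 2 (var 19)) ;; .assign 11 (read 1 (var 19)) ;;
      handleEdge).run s₁ = s₂ := by
      have : handleEdge.run s₂ = s₂ := handleEdge_found (by simpa [hs₂, State.setVar_var] using h4)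
      conv_rhs => rw [← this]
      simp [run_seq, run_assign, Expr.eval, State.setVar_var, State.setVar_arr, hs₂]
    rw [e]
    refine ⟨?_, Or.inl ⟨by simpa [hs₂, State.setVar_var] using h4, h5⟩⟩
    have v1 : s₂.var 1 = s₁.var 1 := by simp [hs₂, State.setVar_var]
    rw [IsForest, v1]
    exact F₁
  · have spec := handleEdge_at (e₁ := read 2 (var 19)) (e₂ := read 1 (var 19)) F₁ h4
      (by simp [Expr.eval, State.setVar_var, State.setVar_arr])
      (by simpa [Expr.eval, S.1, S.2.2.1, v19] using hy)
      (by simpa [Expr.eval, S.1, S.2.1, v19] using hx)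
      (by simpa [Expr.eval, S.2.1, S.2.2.1, v19] using hadj.symm) _ rfl
    set s₂ := (LoopProg.assign 10 (read 2 (var 19)) ;; .assign 11 (read 1 (var 19)) ;;
      handleEdge).run s₁ with hs₂
    simp only [Expr.eval, v19, S.2.1, S.2.2.1] at spec
    obtain ⟨F₂, ⟨h6, h7⟩ | ⟨h6, h7⟩⟩ := spec
    · exact ⟨F₂, Or.inl ⟨h6, S.better.mp h7⟩⟩
    · refine ⟨F₂, Or.inr ⟨h6, ?_⟩⟩
      rcases h5 with ⟨h5, h5'⟩ | ⟨h5, h5', h5''⟩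
      · refine Or.inl ⟨fun h => h5 (h h3).1, h5'.trans_le ?_⟩
        rcases h7 with h7 | h7
        · exact h7.2.le
        · exact h7.2.2.ge
      · rw [h5'] at h7
        rcases h7 with ⟨h7, h7'⟩ | ⟨h7, h7', h7''⟩
        · exact Or.inl ⟨fun h => h7 (h h3).2, by rwa [h5''] at h7'⟩
        · exact Or.inr ⟨fun _ => ⟨h5, h7⟩, h7', h7''.trans h5''⟩

theorem scanEdge_found (h2 : s.var 2 ≠ 0) :
    (scanEdge.run s).arr = s.arr ∧ (scanEdge.run s).var 2 = s.var 2 := by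
  unfold scanEdge
  rw [run_cond]
  by_cases h3 : s.arr 3 (s.var 19) = 0
  · rw [if_neg (by simpa [Expr.eval] using h3)]
    exact ⟨rfl, rfl⟩
  rw [if_pos (by simpa [Expr.eval] using h3)]
  have key : ∀ (s' : State) (a b : ℕ), s'.var 2 ≠ 0 →
      handleEdge.run ((s'.setVar 10 a).setVar 11 b) = (s'.setVar 10 a).setVar 11 b :=
    fun s' a b h => handleEdge_found (by simpa [State.setVar_var] using h)
  simp only [run_seq, run_assign]
  rw [key _ _ _ h2, key _ _ _ (by simpa [State.setVar_var] using h2)]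
  simp [State.setVar_var, State.setVar_arr]

/-- The progress made after `k` rounds of the search. -/
def Progress (H : SimpleGraph ℕ) (k : ℕ) (s : State) : Prop :=
  IsForest H s ∧ ((s.var 2 ≠ 0 ∧ Better H s) ∨
    (s.var 2 = 0 ∧ (k ≤ outer s ∨ ∀ j < s.var 1, ClosedAt s j)))

theorem Progress.congr {k : ℕ} {s' : State} (h : Progress H k s) (h1 : s'.var 1 = s.var 1)
    (h2 : s'.var 2 = s.var 2) (ha : s'.arr = s.arr) : Progress H k s' := by
  unfold Progress IsForest Better outer ClosedAt at *
  rwa [h1, h2, ha]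

/-- If some edge makes progress in the pass, the number of outer vertices grows. Otherwise the
relevant arrays never change during the pass, so an edge seen to be closed early is still closed at
the end. -/
theorem scanAll_spec {k : ℕ} (hP : Progress H k s) (hE : EdgesOf H s) :
    Progress H (k + 1) (scanAll.run s) := by
  obtain ⟨F, hP⟩ := hP
  have key := rep_induction (i := 19) (c := scanEdge) (by decide) s
    (fun i s' => SameInput s s' ∧ IsForest H s' ∧ ((s'.var 2 ≠ 0 ∧ Better H s') ∨
      (s'.var 2 = 0 ∧ (k + 1 ≤ outer s' ∨ (∀ j < s.var 1, ClosedAt s' j) ∨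
        (k ≤ outer s' ∧ ∀ j < i, ClosedAt s' j)))))
    ⟨⟨by simp [State.setVar_var], rfl, rfl, rfl, rfl⟩, ?_, ?_⟩ ?_
  · obtain ⟨S, F', h⟩ := key
    refine ⟨F', ?_⟩
    rcases h with h | ⟨h, h' | h' | h'⟩
    · exact Or.inl h
    · exact Or.inr ⟨h, Or.inl h'⟩
    · exact Or.inr ⟨h, Or.inr fun j hj => h' j (S.1 ▸ hj)⟩
    · exact Or.inr ⟨h, Or.inr fun j hj => h'.2 j (S.1 ▸ hj)⟩
  · rw [IsForest]
    simpa [State.setVar_var, State.setVar_arr] using F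
  · rcases hP with ⟨h, hb⟩ | ⟨h, h' | h'⟩
    · refine Or.inl ⟨by simpa [State.setVar_var] using h, ?_⟩
      simpa [Better, State.setVar_var, State.setVar_arr] using hb
    · refine Or.inr ⟨by simpa [State.setVar_var] using h, Or.inr (Or.inr ⟨?_, by simp⟩)⟩
      simpa [outer, State.setVar_var, State.setVar_arr] using h'
    · exact Or.inr ⟨by simpa [State.setVar_var] using h, Or.inr (Or.inl h')⟩
  · rintro i hi s' h1 h19 ⟨S, F', h⟩
    set s₁ := scanEdge.run s' with hs₁
    set s₂ := s₁.setVar 19 (i + 1) with hs₂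
    have S' : SameInput s' s₂ := by
      have := sameInput_run (c := scanEdge) (by decide) s'
      exact ⟨by simpa [hs₂, State.setVar_var] using this.1, this.2⟩
    have v2 : s₂.var 2 = s₁.var 2 := by simp [hs₂, State.setVar_var]
    have v1 : s₂.var 1 = s₁.var 1 := by simp [hs₂, State.setVar_var]
    have a : s₂.arr = s₁.arr := rfl
    have f : IsForest H s₁ → IsForest H s₂ := fun h => by rw [IsForest, v1, a]; exact h
    have o : outer s₂ = outer s₁ := by rw [outer, outer, v1, a]
    refine ⟨S.trans S', ?_⟩
    rw [S'.better, v2, o]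
    rcases h with ⟨h, hb⟩ | ⟨h, h'⟩
    · obtain ⟨h3, h4⟩ := scanEdge_found h
      refine ⟨?_, Or.inl ⟨h4 ▸ h, hb⟩⟩
      rw [IsForest, a, h3, S'.1]
      exact F'
    · obtain ⟨F₁, h3 | ⟨h3, h4⟩⟩ := scanEdge_spec F' (S.edgesOf hE) h (by rw [h1, h19]; exact hi)
      · exact ⟨f F₁, Or.inl h3⟩
      · refine ⟨f F₁, Or.inr ⟨h3, ?_⟩⟩
        rw [h19] at h4
        rcases h4 with ⟨h4, h5⟩ | ⟨h4, h5, h6⟩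
        · left
          change outer s' < outer s₁ at h5
          rcases h' with h' | h' | h'
          · omega
          · exact absurd (h' i hi) h4
          · have := h'.1
            omega
        · rw [h6]
          have c : ∀ j, ClosedAt s' j → ClosedAt s₂ j := fun j h => by
            rw [ClosedAt, a, h5]; exact h
          rcases h' with h' | h' | h'
          · exact Or.inl h'
          · exact Or.inr (Or.inl fun j hj => c j (h' j hj))
          · refine Or.inr (Or.inr ⟨h'.1, fun j hj => c j ?_⟩)
            rcases Nat.lt_succ_iff_lt_or_eq.mp hj with hj | rfl
            · exact h'.2 j hj
            · exact h4

theorem initSearch_spec (hM : IsMatch H (s.var 1) (s.arr 4)) :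
    Progress H 0 (initSearch.run s) := by
  set s₁ := s.setVar 2 0 with hs₁
  set s₂ := (rep 16 (.write 6 (var 16) (var 16))).run s₁ with hs₂
  set s₃ := (rep 16 (.write 8 (var 16) (const 0))).run s₂ with hs₃
  set s₄ := initSearch.run s with hs₄
  have e : s₄ = (rep 16 (.write 5 (var 16) (sub (const 2)
    (add (differ (read 4 (var 16)) (var 16)) (differ (read 4 (var 16)) (var 16)))))).run s₃ := rfl
  have v1 : s₁.var 1 = s.var 1 := by simp [hs₁, State.setVar_var]
  have v2 : s₂.var 1 = s.var 1 := (run_var (by decide) s₁).trans v1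
  have v3 : s₃.var 1 = s.var 1 := (run_var (by decide) s₂).trans v2
  have v4 : s₄.var 1 = s.var 1 := run_var (by decide) s
  have f4 : s₄.var 2 = 0 := by
    rw [e, run_var (by decide), hs₃, run_var (by decide), hs₂, run_var (by decide)]
    simp [hs₁, State.setVar_var]
  have a4 : s₄.arr 4 = s.arr 4 := run_arr (by decide) s
  have h6 := rep_write_spec (i := 16) (a := 6) (e := var 16) (by decide) s₁ (fun k => k)
    (fun _ _ _ _ h _ => h)
  have h8 := rep_write_spec (i := 16) (a := 8) (e := const 0) (by decide) s₂ (fun _ => 0)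
    (fun _ _ _ _ _ _ => rfl)
  have h5 := rep_write_spec (i := 16) (a := 5) (e := sub (const 2)
    (add (differ (read 4 (var 16)) (var 16)) (differ (read 4 (var 16)) (var 16)))) (by decide) s₃
    (fun k => if s.arr 4 k = k then 2 else 0) (fun k s' ha _ hk _ => by
      have h4 : s'.arr 4 = s.arr 4 := by
        rw [ha, Function.update_of_ne (by decide), hs₃, run_arr (by decide), hs₂,
          run_arr (by decide), hs₁, State.setVar_arr]
      -- Twice a nonzero difference is at least `2`, so truncated subtraction from `2` gives `0`.
      simp only [Expr.eval, differ, h4, hk]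
      split <;> omega)
  have a6 : s₄.arr 6 = s₂.arr 6 := by rw [e, run_arr (by decide), hs₃, run_arr (by decide)]
  have a8 : s₄.arr 8 = s₃.arr 8 := by rw [e, run_arr (by decide)]
  rw [← e] at h5
  refine ⟨?_, Or.inr ⟨f4, Or.inl (Nat.zero_le _)⟩⟩
  rw [IsForest, v4, a4]
  refine Forest.init hM (fun w hw => ?_) (fun w hw => ?_) (fun w hw => ?_)
  · rw [h5 w, v3, if_pos hw]
  · rw [a6, h6 w, v1, if_pos hw]
  · rw [a8, h8 w, v2, if_pos hw]

/-- There are `s.var 1 + 1` passes. If none reveals a larger matching, they cannot all have raised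
the number of outer vertices, so every listed edge is closed at the end and `Forest.deficiency_le`
applies. Edges of the matching itself need not be listed. -/
theorem search_spec (hM : IsMatch H (s.var 1) (s.arr 4)) (hE : EdgesOf H s)
    (hH : ∀ u < s.var 1, ∀ v < s.var 1, H.Adj u v → s.arr 4 u ≠ v →
      ∃ j < s.var 1, s.arr 3 j ≠ 0 ∧ ((s.arr 1 j = u ∧ s.arr 2 j = v) ∨
        (s.arr 1 j = v ∧ s.arr 2 j = u))) :
    (search.run s).var 2 ≠ 0 ↔ Better H s := by
  set s₁ := initSearch.run s with hs₁
  set s₂ := (rep 18 scanAll).run s₁ with hs₂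
  set s₃ := search.run s with hs₃
  have e : s₃ = scanAll.run s₂ := rfl
  have S₁ : SameInput s s₁ := sameInput_run (by decide) s
  have S₂ : SameInput s s₂ := S₁.trans (sameInput_run (by decide) s₁)
  have S₃ : SameInput s s₃ := sameInput_run (by decide) s
  have P₂ : Progress H (s₁.var 1) s₂ := by
    refine (rep_induction (i := 18) (c := scanAll) (by decide) s₁
      (fun k s' => SameInput s s' ∧ Progress H k s') ⟨?_, ?_⟩ ?_).2
    · exact ⟨by simpa [State.setVar_var] using S₁.1, S₁.2⟩
    · exact Progress.congr (s := s₁) (initSearch_spec hM) (by simp [State.setVar_var])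
        (by simp [State.setVar_var]) rfl
    · rintro k - s' - - ⟨S', P'⟩
      have S'' := S'.trans (sameInput_run (c := scanAll) (by decide) s')
      refine ⟨⟨by simpa [State.setVar_var] using S''.1, S''.2⟩, ?_⟩
      exact (scanAll_spec P' (S'.edgesOf hE)).congr (by simp [State.setVar_var])
        (by simp [State.setVar_var]) rfl
  have P₃ : Progress H (s₁.var 1 + 1) s₃ := by rw [e]; exact scanAll_spec P₂ (S₂.edgesOf hE)
  obtain ⟨F, ⟨h, hb⟩ | ⟨h, h'⟩⟩ := P₃
  · exact iff_of_true h (S₃.better.mp hb)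
  · refine iff_of_false (by simpa using h) ?_
    rintro ⟨f, hf, hlt⟩
    have hle : outer s₃ ≤ s₃.var 1 := (card_filter_le _ _).trans (by simp)
    rcases h' with h' | h'
    · rw [S₁.1] at h'
      rw [S₃.1] at hle
      omega
    · refine not_le.mpr hlt ?_
      obtain ⟨v1, a1, a2, a3, a4⟩ := S₃
      rw [IsForest, v1, a4] at F
      refine F.deficiency_le (fun u hu v hv huv hne hl => ?_) hf
      obtain ⟨j, hj, h3, hj'⟩ := hH u hu v hv huv hne
      have hc := h' j (by rwa [v1]) (by rwa [a3])
      rw [a1, a2] at hc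
      rcases hj' with ⟨rfl, rfl⟩ | ⟨rfl, rfl⟩
      · exact hc.1 hl
      · exact hc.2 hl

end Blossom

/-! ### From deciding to finding: augmentation by self-reduction, and maximum matchings. -/

namespace Blossom

open Finset RAM RAM.Expr RAM.LoopProg

local infixr:60 " ;; " => LoopProg.seq

/-- The graph on `ℕ` whose edges join `eu j` and `ev j`, for `j < N` with `al j ≠ 0`. -/
def edgeGraph (N : ℕ) (eu ev al : ℕ → ℕ) : SimpleGraph ℕ :=
  SimpleGraph.fromRel fun u v => ∃ j < N, al j ≠ 0 ∧ eu j = u ∧ ev j = v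

/-- The graph `edgeGraph N eu ev al` together with the edges of the matching `M`. -/
def liveGraph (N : ℕ) (eu ev al M : ℕ → ℕ) : SimpleGraph ℕ :=
  edgeGraph N eu ev al ⊔ SimpleGraph.fromRel fun u v => u < N ∧ M u = v

variable {H : SimpleGraph ℕ} {N : ℕ} {eu ev al M f : ℕ → ℕ}

theorem edgeGraph_adj {u v : ℕ} : (edgeGraph N eu ev al).Adj u v ↔ u ≠ v ∧
    ∃ j < N, al j ≠ 0 ∧ ((eu j = u ∧ ev j = v) ∨ (eu j = v ∧ ev j = u)) := by
  simp only [edgeGraph, SimpleGraph.fromRel_adj]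
  refine and_congr_right fun _ => ⟨?_, ?_⟩
  · rintro (⟨j, h1, h2, h3⟩ | ⟨j, h1, h2, h3⟩)
    · exact ⟨j, h1, h2, Or.inl h3⟩
    · exact ⟨j, h1, h2, Or.inr h3⟩
  · rintro ⟨j, h1, h2, h3 | h3⟩
    · exact Or.inl ⟨j, h1, h2, h3⟩
    · exact Or.inr ⟨j, h1, h2, h3⟩

theorem liveGraph_adj {u v : ℕ} (hM : IsMatch H N M) (hu : u < N) (hv : v < N) :
    (liveGraph N eu ev al M).Adj u v ↔ (edgeGraph N eu ev al).Adj u v ∨ (u ≠ v ∧ M u = v) := by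
  simp only [liveGraph, SimpleGraph.sup_adj, SimpleGraph.fromRel_adj]
  refine or_congr_right (and_congr_right fun _ => ⟨?_, fun h => Or.inl ⟨hu, h⟩⟩)
  rintro (⟨-, h⟩ | ⟨-, h⟩)
  · exact h
  · rw [← h, hM.inv v hv]

theorem IsMatch.mono {H' : SimpleGraph ℕ} (hf : IsMatch H N f)
    (h : ∀ u < N, ∀ v < N, v = f u → H.Adj u v → H'.Adj u v) : IsMatch H' N f :=
  ⟨hf.lt, hf.inv, fun w hw hne => h w hw _ (hf.lt w hw) rfl (hf.adj w hw hne)⟩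

/-- There is a matching larger than `M` in the graph with the edges present in `al`. -/
def Augmentable (N : ℕ) (eu ev al M : ℕ → ℕ) : Prop :=
  ∃ f, IsMatch (liveGraph N eu ev al M) N f ∧ deficiency N f < deficiency N M

theorem Augmentable.mono {al' : ℕ → ℕ} (hM : IsMatch H N M) (h : ∀ j < N, al j ≠ 0 → al' j ≠ 0)
    (ha : Augmentable N eu ev al M) : Augmentable N eu ev al' M := by
  obtain ⟨f, hf, hd⟩ := ha
  refine ⟨f, hf.mono fun u hu v hv _ huv => ?_, hd⟩
  rw [liveGraph_adj hM hu hv] at huv ⊢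
  refine huv.imp_left fun huv => ?_
  rw [edgeGraph_adj] at huv ⊢
  obtain ⟨hne, j, h1, h2, h3⟩ := huv
  exact ⟨hne, j, h1, h j h1 h2, h3⟩

/-- If every present edge is needed for the existence of a larger matching, then the present edges
and the edges of `M` disjoint from them form a larger matching. -/
theorem exists_larger_of_critical {ok : ℕ → ℕ} (hM : IsMatch (edgeGraph N eu ev ok) N M)
    (hok : ∀ j < N, al j ≠ 0 → ok j ≠ 0)
    (hE : ∀ j < N, al j ≠ 0 → eu j < N ∧ ev j < N ∧ eu j ≠ ev j)
    (ha : Augmentable N eu ev al M)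
    (hcrit : ∀ j < N, al j ≠ 0 → ¬ Augmentable N eu ev (Function.update al j 0) M) :
    ∃ f : ℕ → ℕ, (∀ j < N, al j ≠ 0 → f (eu j) = ev j ∧ f (ev j) = eu j) ∧
      ∀ t : ℕ → ℕ, (∀ u < N, ((∃ j < N, al j ≠ 0 ∧ (eu j = u ∨ ev j = u)) ∧ t u = f u) ∨
        ((¬ ∃ j < N, al j ≠ 0 ∧ (eu j = u ∨ ev j = u)) ∧ t u = u)) →
      ∀ g : ℕ → ℕ, (∀ u < N, g u = if t u ≠ u then t u else if t (M u) ≠ M u then u else M u) →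
        IsMatch (edgeGraph N eu ev ok) N g ∧ deficiency N g < deficiency N M := by
  obtain ⟨f, hf, hd⟩ := ha
  -- A larger matching that avoids the edge `j` would survive its deletion.
  have key : ∀ j < N, al j ≠ 0 → f (eu j) = ev j := by
    intro j hj hal
    by_contra hne
    refine hcrit j hj hal ⟨f, hf.mono fun u hu v hv hfu huv => ?_, hd⟩
    rw [liveGraph_adj hM hu hv] at huv ⊢
    refine huv.imp_left fun huv => ?_
    rw [edgeGraph_adj] at huv ⊢
    obtain ⟨huv, i, h1, h2, h3⟩ := huv
    refine ⟨huv, i, h1, ?_, h3⟩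
    have : i ≠ j := by
      rintro rfl
      rcases h3 with ⟨h3, h4⟩ | ⟨h3, h4⟩
      · exact hne (by rw [h3, h4, hfu])
      · exact hne (by rw [h3, h4, hfu, hf.inv u hu])
    rwa [Function.update_of_ne this]
  have key' : ∀ j < N, al j ≠ 0 → f (ev j) = eu j := fun j hj hal => by
    rw [← key j hj hal, hf.inv _ (hE j hj hal).1]
  -- `t` and `g` stand for the arrays produced by `storeEdges` and `storeMates`, whose contents are
  -- known only below `N`.
  refine ⟨f, fun j hj hal => ⟨key j hj hal, key' j hj hal⟩, fun t ht g hg => ?_⟩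
  set T : ℕ → Prop := fun u => ∃ j < N, al j ≠ 0 ∧ (eu j = u ∨ ev j = u) with hT
  have ht' : ∀ u < N, (T u ∧ t u = f u) ∨ (¬ T u ∧ t u = u) := ht
  have hTf : ∀ u, T u → f u ≠ u ∧ T (f u) ∧ (edgeGraph N eu ev ok).Adj u (f u) := by
    rintro u ⟨j, hj, hal, rfl | rfl⟩
    · have := hE j hj hal
      rw [key j hj hal]
      exact ⟨this.2.2.symm, ⟨j, hj, hal, Or.inr rfl⟩,
        edgeGraph_adj.mpr ⟨this.2.2, j, hj, hok j hj hal, Or.inl ⟨rfl, rfl⟩⟩⟩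
    · have := hE j hj hal
      rw [key' j hj hal]
      exact ⟨this.2.2, ⟨j, hj, hal, Or.inl rfl⟩,
        edgeGraph_adj.mpr ⟨this.2.2.symm, j, hj, hok j hj hal, Or.inr ⟨rfl, rfl⟩⟩⟩
  have g1 : ∀ u < N, T u → g u = f u := fun u hu h => by
    rcases ht' u hu with ⟨-, h'⟩ | ⟨h', -⟩
    · rw [hg u hu, if_pos (by rw [h']; exact (hTf u h).1), h']
    · exact absurd h h'
  have t2 : ∀ u < N, ¬ T u → t u = u := fun u hu h => by
    rcases ht' u hu with ⟨h', -⟩ | ⟨-, h'⟩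
    · exact absurd h' h
    · exact h'
  have t1 : ∀ u < N, T u → t u ≠ u := fun u hu h => by
    rcases ht' u hu with ⟨-, h'⟩ | ⟨h', -⟩
    · rw [h']; exact (hTf u h).1
    · exact absurd h h'
  have g2 : ∀ u < N, ¬ T u → T (M u) → g u = u := fun u hu h h' => by
    rw [hg u hu, if_neg (by simp [t2 u hu h]), if_pos (t1 _ (hM.lt u hu) h')]
  have g3 : ∀ u < N, ¬ T u → ¬ T (M u) → g u = M u := fun u hu h h' => by
    rw [hg u hu, if_neg (by simp [t2 u hu h]), if_neg (by simp [t2 _ (hM.lt u hu) h'])]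
  refine ⟨⟨fun u hu => ?_, fun u hu => ?_, fun u hu => ?_⟩, ?_⟩
  · by_cases h : T u
    · rw [g1 u hu h]; exact hf.lt u hu
    by_cases h' : T (M u)
    · rwa [g2 u hu h h']
    · rw [g3 u hu h h']; exact hM.lt u hu
  · by_cases h : T u
    · rw [g1 u hu h, g1 _ (hf.lt u hu) (hTf u h).2.1, hf.inv u hu]
    by_cases h' : T (M u)
    · rw [g2 u hu h h', g2 u hu h h']
    · rw [g3 u hu h h', g3 _ (hM.lt u hu) h' (by rwa [hM.inv u hu]), hM.inv u hu]
  · by_cases h : T u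
    · rw [g1 u hu h]; exact fun _ => (hTf u h).2.2
    by_cases h' : T (M u)
    · rw [g2 u hu h h']; exact fun h => absurd rfl h
    · rw [g3 u hu h h']; exact hM.adj u hu
  -- Every vertex exposed by `g` is exposed by `f`: away from the present edges `f` can use only
  -- edges of `M`, and `g` keeps each such edge of `M` that meets no present edge.
  · refine lt_of_le_of_lt (card_le_card fun u hu => ?_) hd
    simp only [mem_filter, mem_range] at hu ⊢
    obtain ⟨hu, hgu⟩ := hu
    refine ⟨hu, ?_⟩
    by_contra hne
    have hfM : ¬ T u → f u = M u := fun h => by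
      rcases (liveGraph_adj hM hu (hf.lt u hu)).mp (hf.adj u hu hne) with h1 | h1
      · rw [edgeGraph_adj] at h1
        obtain ⟨-, j, h2, h3, h4 | h4⟩ := h1
        · exact absurd ⟨j, h2, h3, Or.inl h4.1⟩ h
        · exact absurd ⟨j, h2, h3, Or.inr h4.2⟩ h
      · exact h1.2.symm
    by_cases h : T u
    · exact hne ((g1 u hu h).symm.trans hgu)
    by_cases h' : T (M u)
    · have := (hTf _ h').2.1
      rw [← hfM h, hf.inv u hu] at this
      exact h this
    · exact hne ((hfM h).trans ((g3 u hu h h').symm.trans hgu))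

variable {s : State}

/-- Deletion of all edges that are not needed for the existence of a larger matching. -/
def reduce : LoopProg :=
  .rep 20 (.cond (read 3 (var 20))
    (.write 3 (var 20) (const 0) ;; search ;; .cond (var 2) .skip (.write 3 (var 20) (const 1)))
    .skip)

/-- The matching formed by the present edges, in array `10`. -/
def storeEdges : LoopProg :=
  .rep 21 (.write 10 (var 21) (var 21)) ;;
  .rep 21 (.cond (read 3 (var 21)) (.write 10 (read 1 (var 21)) (read 2 (var 21)) ;;
    .write 10 (read 2 (var 21)) (read 1 (var 21))) .skip)

/-- The new matching. -/
def storeMates : LoopProg :=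
  .rep 21 (.cond (differ (read 10 (var 21)) (var 21))
    (.write 4 (var 21) (read 10 (var 21)))
    (.cond (differ (read 10 (read 4 (var 21))) (read 4 (var 21)))
      (.write 4 (var 21) (var 21)) .skip))

/-- Replacement of the matching in array `4` by a larger one, if there is one in the graph whose
edges are in the arrays `1`, `2` and `11`. -/
def augment : LoopProg :=
  .rep 21 (.write 3 (var 21) (read 11 (var 21))) ;; search ;;
  .cond (var 2) (reduce ;; storeEdges ;; storeMates) .skip

/-- Computation of a maximum matching. -/
def maxMatching : LoopProg :=
  .rep 22 (.write 4 (var 22) (var 22)) ;; .rep 22 augment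

/-- `search` finds out whether there is a larger matching. -/
theorem search_spec_of_isMatch (hM : IsMatch H (s.var 1) (s.arr 4))
    (hE : ∀ j < s.var 1, s.arr 3 j ≠ 0 →
      s.arr 1 j < s.var 1 ∧ s.arr 2 j < s.var 1 ∧ s.arr 1 j ≠ s.arr 2 j) :
    (search.run s).var 2 ≠ 0 ↔
      Augmentable (s.var 1) (s.arr 1) (s.arr 2) (s.arr 3) (s.arr 4) := by
  refine search_spec (H := liveGraph (s.var 1) (s.arr 1) (s.arr 2) (s.arr 3) (s.arr 4))
    ⟨hM.lt, hM.inv, fun w hw h => ?_⟩ (fun j hj h3 => ?_) (fun u hu v hv huv hne => ?_)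
  · rw [liveGraph_adj hM hw (hM.lt w hw)]
    exact Or.inr ⟨h.symm, rfl⟩
  · obtain ⟨h1, h2, h4⟩ := hE j hj h3
    refine ⟨h1, h2, ?_⟩
    rw [liveGraph_adj hM h1 h2, edgeGraph_adj]
    exact Or.inl ⟨h4, j, hj, h3, Or.inl ⟨rfl, rfl⟩⟩
  · rw [liveGraph_adj hM hu hv, edgeGraph_adj] at huv
    rcases huv with ⟨-, j, hj, h3, h⟩ | h
    · exact ⟨j, hj, h3, h⟩
    · exact absurd h.2 hne

/-- An edge is kept only if its deletion destroys every larger matching. It remains indispensable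
when further edges go, by `Augmentable.mono`, so one pass suffices. -/
theorem reduce_spec (hM : IsMatch H (s.var 1) (s.arr 4))
    (hE : ∀ j < s.var 1, s.arr 3 j ≠ 0 →
      s.arr 1 j < s.var 1 ∧ s.arr 2 j < s.var 1 ∧ s.arr 1 j ≠ s.arr 2 j)
    (ha : Augmentable (s.var 1) (s.arr 1) (s.arr 2) (s.arr 3) (s.arr 4)) :
    (∀ j, (reduce.run s).arr 3 j ≠ 0 → s.arr 3 j ≠ 0) ∧
    Augmentable (s.var 1) (s.arr 1) (s.arr 2) ((reduce.run s).arr 3) (s.arr 4) ∧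
    ∀ j < s.var 1, (reduce.run s).arr 3 j ≠ 0 → ¬ Augmentable (s.var 1) (s.arr 1) (s.arr 2)
      (Function.update ((reduce.run s).arr 3) j 0) (s.arr 4) := by
  refine (rep_induction (i := 20) (c := .cond (read 3 (var 20))
    (.write 3 (var 20) (const 0) ;; search ;; .cond (var 2) .skip (.write 3 (var 20) (const 1)))
    .skip) (by decide) s (fun k s' => (s'.arr 1 = s.arr 1 ∧ s'.arr 2 = s.arr 2 ∧
      s'.arr 4 = s.arr 4) ∧ (∀ j, s'.arr 3 j ≠ 0 → s.arr 3 j ≠ 0) ∧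
      Augmentable (s.var 1) (s.arr 1) (s.arr 2) (s'.arr 3) (s.arr 4) ∧
      ∀ j < k, s'.arr 3 j ≠ 0 → ¬ Augmentable (s.var 1) (s.arr 1) (s.arr 2)
        (Function.update (s'.arr 3) j 0) (s.arr 4)) ?_ ?_).2
  · exact ⟨⟨rfl, rfl, rfl⟩, fun j h => h, ha, by simp⟩
  · rintro k hk s' h1 h20 ⟨⟨a1, a2, a4⟩, hle, hau, hcrit⟩
    refine ⟨⟨?_, ?_, ?_⟩, ?_⟩
    · rw [State.setVar_arr, run_arr (by decide), a1]
    · rw [State.setVar_arr, run_arr (by decide), a2]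
    · rw [State.setVar_arr, run_arr (by decide), a4]
    rw [State.setVar_arr, run_cond]
    by_cases h3 : s'.arr 3 k = 0
    · rw [if_neg (by simpa [Expr.eval, h20] using h3), run_skip]
      refine ⟨hle, hau, fun j hj h => ?_⟩
      rcases Nat.lt_succ_iff_lt_or_eq.mp hj with hj | rfl
      · exact hcrit j hj h
      · exact absurd h3 h
    rw [if_pos (by simpa [Expr.eval, h20] using h3), run_seq, run_seq, run_write]
    simp only [Expr.eval, h20]
    set s₁ := s'.setArr 3 k 0 with hs₁
    have v1 : s₁.var = s'.var := rfl
    have b1 : s₁.arr 1 = s.arr 1 := by simp [hs₁, State.setArr_arr, a1]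
    have b2 : s₁.arr 2 = s.arr 2 := by simp [hs₁, State.setArr_arr, a2]
    have b3 : s₁.arr 3 = Function.update (s'.arr 3) k 0 := by simp [hs₁, State.setArr_arr]
    have b4 : s₁.arr 4 = s.arr 4 := by simp [hs₁, State.setArr_arr, a4]
    have le3 : ∀ j, s₁.arr 3 j ≠ 0 → s'.arr 3 j ≠ 0 := fun j h => by
      rw [b3] at h
      by_cases hj : j = k
      · subst hj; exact h3
      · rwa [Function.update_of_ne hj] at h
    have spec := search_spec_of_isMatch (H := H) (s := s₁) (by rwa [v1, b4, h1]) (fun j hj h => by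
      rw [v1, h1] at hj ⊢
      rw [b1, b2]
      exact hE j hj (hle j (le3 j h)))
    rw [v1, h1, b1, b2, b4] at spec
    set s₂ := search.run s₁ with hs₂
    have c3 : s₂.arr 3 = s₁.arr 3 := run_arr (by decide) s₁
    have v2 : s₂.var 20 = k := (run_var (by decide) s₁).trans h20
    rw [run_cond]
    by_cases hf : s₂.var 2 = 0
    · rw [if_neg (by simpa [Expr.eval] using hf), run_write]
      simp only [Expr.eval, v2, State.setArr_arr, if_true]
      have hno := fun h => spec.mpr h hf
      -- A restored edge gets the value `1` instead of its old value; only being nonzero matters.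
      have e : ∀ j, Function.update (s₂.arr 3) k 1 j ≠ 0 ↔ s'.arr 3 j ≠ 0 := fun j => by
        by_cases hj : j = k
        · subst hj; simpa using h3
        · simp [hj, c3, b3]
      refine ⟨fun j h => hle j ((e j).mp h), hau.mono hM fun j _ h => (e j).mpr h,
        fun j hj h => ?_⟩
      rcases Nat.lt_succ_iff_lt_or_eq.mp hj with hj | rfl
      · refine fun h' => hcrit j hj ((e j).mp h) (h'.mono hM fun i _ hi => ?_)
        by_cases hij : i = j
        · subst hij; simp at hi
        · rw [Function.update_of_ne hij] at hi ⊢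
          exact (e i).mp hi
      · rw [Function.update_idem, c3, b3, Function.update_idem]
        rwa [b3] at hno
    · rw [if_pos (by simpa [Expr.eval] using hf), run_skip, c3]
      refine ⟨fun j h => hle j (le3 j h), spec.mp hf, fun j hj h => ?_⟩
      rcases Nat.lt_succ_iff_lt_or_eq.mp hj with hj | rfl
      · refine fun h' => hcrit j hj (le3 j h) (h'.mono hM fun i _ hi => ?_)
        by_cases hij : i = j
        · subst hij; simp at hi
        · rw [Function.update_of_ne hij] at hi ⊢
          exact le3 i hi
      · rw [b3] at h; simp at h

/-- Several present edges may write to one cell, for instance parallel ones; since `f` prescribes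
the value, they all write the same. -/
theorem storeEdges_spec {f : ℕ → ℕ}
    (hf : ∀ j < s.var 1, s.arr 3 j ≠ 0 → f (s.arr 1 j) = s.arr 2 j ∧ f (s.arr 2 j) = s.arr 1 j) :
    ∀ u < s.var 1,
      ((∃ j < s.var 1, s.arr 3 j ≠ 0 ∧ (s.arr 1 j = u ∨ s.arr 2 j = u)) ∧
        (storeEdges.run s).arr 10 u = f u) ∨
      ((¬ ∃ j < s.var 1, s.arr 3 j ≠ 0 ∧ (s.arr 1 j = u ∨ s.arr 2 j = u)) ∧
        (storeEdges.run s).arr 10 u = u) := by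
  set s₁ := (rep 21 (.write 10 (var 21) (var 21))).run s with hs₁
  have v1 : s₁.var 1 = s.var 1 := run_var (by decide) s
  have a1 : s₁.arr 1 = s.arr 1 := run_arr (by decide) s
  have a2 : s₁.arr 2 = s.arr 2 := run_arr (by decide) s
  have a3 : s₁.arr 3 = s.arr 3 := run_arr (by decide) s
  have h10 := rep_write_spec (i := 21) (a := 10) (e := var 21) (by decide) s (fun k => k)
    (fun _ _ _ _ h _ => h)
  have key := rep_induction (i := 21) (c := .cond (read 3 (var 21))
    (.write 10 (read 1 (var 21)) (read 2 (var 21)) ;;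
    .write 10 (read 2 (var 21)) (read 1 (var 21))) .skip) (by decide) s₁
    (fun k s' => (s'.arr 1 = s.arr 1 ∧ s'.arr 2 = s.arr 2 ∧ s'.arr 3 = s.arr 3) ∧ ∀ u < s.var 1,
      ((∃ j < k, s.arr 3 j ≠ 0 ∧ (s.arr 1 j = u ∨ s.arr 2 j = u)) ∧ s'.arr 10 u = f u) ∨
      ((¬ ∃ j < k, s.arr 3 j ≠ 0 ∧ (s.arr 1 j = u ∨ s.arr 2 j = u)) ∧ s'.arr 10 u = u)) ?_ ?_
  · rw [v1] at key
    exact key.2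
  · refine ⟨⟨a1, a2, a3⟩, fun u hu => Or.inr ⟨by simp, ?_⟩⟩
    rw [State.setVar_arr, h10, if_pos hu]
  · rintro k hk s' - h21 ⟨⟨c1, c2, c3⟩, h⟩
    rw [v1] at hk
    rw [State.setVar_arr, run_cond]
    by_cases h3 : s.arr 3 k = 0
    · rw [if_neg (by simpa [Expr.eval, h21, c3] using h3), run_skip]
      refine ⟨⟨c1, c2, c3⟩, fun u hu => ?_⟩
      have : ∀ u, (∃ j < k + 1, s.arr 3 j ≠ 0 ∧ (s.arr 1 j = u ∨ s.arr 2 j = u)) ↔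
          ∃ j < k, s.arr 3 j ≠ 0 ∧ (s.arr 1 j = u ∨ s.arr 2 j = u) := fun u => by
        constructor
        · rintro ⟨j, h1, h2, h4⟩
          refine ⟨j, lt_of_le_of_ne (by omega) ?_, h2, h4⟩
          rintro rfl; exact h2 h3
        · rintro ⟨j, h1, h2⟩; exact ⟨j, by omega, h2⟩
      rw [this]
      exact h u hu
    · rw [if_pos (by simpa [Expr.eval, h21, c3] using h3)]
      simp only [run_seq, run_write, Expr.eval, State.setArr_var, State.setArr_arr, h21, c1, c2, c3]
      refine ⟨by simp, fun u hu => ?_⟩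
      obtain ⟨f1, f2⟩ := hf k hk h3
      simp only [if_true]
      by_cases hu2 : u = s.arr 2 k
      · subst hu2
        exact Or.inl ⟨⟨k, by omega, h3, Or.inr rfl⟩, by simp [f2]⟩
      by_cases hu1 : u = s.arr 1 k
      · subst hu1
        exact Or.inl ⟨⟨k, by omega, h3, Or.inl rfl⟩, by simp [f1, hu2]⟩
      have : (∃ j < k + 1, s.arr 3 j ≠ 0 ∧ (s.arr 1 j = u ∨ s.arr 2 j = u)) ↔
          ∃ j < k, s.arr 3 j ≠ 0 ∧ (s.arr 1 j = u ∨ s.arr 2 j = u) := by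
        constructor
        · rintro ⟨j, h1, h2, h4⟩
          refine ⟨j, lt_of_le_of_ne (by omega) ?_, h2, h4⟩
          rintro rfl
          rcases h4 with h4 | h4
          · exact hu1 h4.symm
          · exact hu2 h4.symm
        · rintro ⟨j, h1, h2⟩; exact ⟨j, by omega, h2⟩
      rw [this]
      simpa [hu1, hu2, c1, c2] using h u hu

/-- The update in place is safe, because round `u` reads from array `4` only the cell `u`, not yet
changed. -/
theorem storeMates_spec : ∀ u < s.var 1, (storeMates.run s).arr 4 u =
    if s.arr 10 u ≠ u then s.arr 10 u else
      if s.arr 10 (s.arr 4 u) ≠ s.arr 4 u then u else s.arr 4 u := by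
  have key := rep_induction (i := 21) (c := .cond (differ (read 10 (var 21)) (var 21))
    (.write 4 (var 21) (read 10 (var 21)))
    (.cond (differ (read 10 (read 4 (var 21))) (read 4 (var 21)))
      (.write 4 (var 21) (var 21)) .skip)) (by decide) s
    (fun k s' => s'.arr 10 = s.arr 10 ∧ ∀ u, s'.arr 4 u = if u < k then
      (if s.arr 10 u ≠ u then s.arr 10 u else
        if s.arr 10 (s.arr 4 u) ≠ s.arr 4 u then u else s.arr 4 u) else s.arr 4 u) ?_ ?_
  · intro u hu
    have := key.2 u
    rwa [if_pos hu] at this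
  · exact ⟨rfl, by simp [State.setVar_arr]⟩
  · rintro k - s' - h21 ⟨h10, h4⟩
    refine ⟨by rw [State.setVar_arr, run_arr (by decide), h10], fun u => ?_⟩
    have h4k : s'.arr 4 k = s.arr 4 k := by rw [h4, if_neg (lt_irrefl k)]
    have hlt : u ≠ k → (u < k + 1 ↔ u < k) := by omega
    rw [State.setVar_arr, run_cond]
    by_cases h1 : s.arr 10 k = k
    · rw [if_neg (by rw [eval_differ_ne_zero]; simpa [Expr.eval, h21, h10] using h1), run_cond]
      by_cases h2 : s.arr 10 (s.arr 4 k) = s.arr 4 k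
      · rw [if_neg (by rw [eval_differ_ne_zero]; simpa [Expr.eval, h21, h10, h4k] using h2),
          run_skip]
        by_cases hu : u = k
        · subst hu; simp [h4k, h1, h2]
        · simp only [hlt hu]; exact h4 u
      · rw [if_pos (by rw [eval_differ_ne_zero]; simpa [Expr.eval, h21, h10, h4k] using h2),
          run_write]
        simp only [Expr.eval, State.setArr_arr, h21, if_true]
        by_cases hu : u = k
        · subst hu; simp [h1, h2]
        · simp only [hlt hu, Function.update_of_ne hu]; exact h4 u
    · rw [if_pos (by rw [eval_differ_ne_zero]; simpa [Expr.eval, h21, h10] using h1), run_write]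
      simp only [Expr.eval, State.setArr_arr, h21, if_true]
      by_cases hu : u = k
      · subst hu; simp [h1, h10]
      · simp only [hlt hu, Function.update_of_ne hu]; exact h4 u

/-- The edges in the arrays `1`, `2` and `11` are edges of a loopless graph. -/
def ValidEdges (s : State) : Prop :=
  ∀ j < s.var 1, s.arr 11 j ≠ 0 →
    s.arr 1 j < s.var 1 ∧ s.arr 2 j < s.var 1 ∧ s.arr 1 j ≠ s.arr 2 j

/-- The graph whose edges are in the arrays `1`, `2` and `11`. -/
abbrev inputGraph (s : State) : SimpleGraph ℕ :=
  edgeGraph (s.var 1) (s.arr 1) (s.arr 2) (s.arr 11)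

/-- If the search fails, the matching is maximum, because the live graph contains the input graph.
If it succeeds, the reduced edge set satisfies the hypotheses of `exists_larger_of_critical`. -/
theorem augment_spec (hE : ValidEdges s) (hM : IsMatch (inputGraph s) (s.var 1) (s.arr 4)) :
    IsMatch (inputGraph s) (s.var 1) ((augment.run s).arr 4) ∧
      (deficiency (s.var 1) ((augment.run s).arr 4) < deficiency (s.var 1) (s.arr 4) ∨
        ∀ f, IsMatch (inputGraph s) (s.var 1) f →
          deficiency (s.var 1) ((augment.run s).arr 4) ≤ deficiency (s.var 1) f) := by
  set s₁ := (rep 21 (.write 3 (var 21) (read 11 (var 21)))).run s with hs₁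
  have v1 : s₁.var 1 = s.var 1 := run_var (by decide) s
  have a1 : s₁.arr 1 = s.arr 1 := run_arr (by decide) s
  have a2 : s₁.arr 2 = s.arr 2 := run_arr (by decide) s
  have a4 : s₁.arr 4 = s.arr 4 := run_arr (by decide) s
  have h3 := rep_write_spec (i := 21) (a := 3) (e := read 11 (var 21)) (by decide) s (s.arr 11)
    (fun k s' ha _ hk _ => by
      simp only [Expr.eval, hk]
      rw [ha, Function.update_of_ne (by decide)])
  have h3' : ∀ j < s.var 1, s₁.arr 3 j = s.arr 11 j := fun j hj => by rw [h3 j, if_pos hj]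
  have hE₁ : ∀ j < s₁.var 1, s₁.arr 3 j ≠ 0 →
      s₁.arr 1 j < s₁.var 1 ∧ s₁.arr 2 j < s₁.var 1 ∧ s₁.arr 1 j ≠ s₁.arr 2 j := by
    intro j hj h
    rw [v1] at hj ⊢
    rw [h3' j hj] at h
    rw [a1, a2]
    exact hE j hj h
  have spec := search_spec_of_isMatch (H := inputGraph s) (s := s₁) (by rwa [v1, a4]) hE₁
  set s₂ := search.run s₁ with hs₂
  have v1' : s₂.var 1 = s₁.var 1 := run_var (by decide) s₁
  have b1 : s₂.arr 1 = s₁.arr 1 := run_arr (by decide) s₁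
  have b2 : s₂.arr 2 = s₁.arr 2 := run_arr (by decide) s₁
  have b3 : s₂.arr 3 = s₁.arr 3 := run_arr (by decide) s₁
  have b4 : s₂.arr 4 = s₁.arr 4 := run_arr (by decide) s₁
  have e : augment.run s =
    (LoopProg.cond (var 2) (reduce ;; storeEdges ;; storeMates) .skip).run s₂ := rfl
  rw [e, run_cond]
  by_cases hf : s₂.var 2 = 0
  · rw [if_neg (by simpa [Expr.eval] using hf), run_skip, b4, a4]
    refine ⟨hM, Or.inr fun f hfM => ?_⟩
    by_contra hlt
    refine absurd hf (spec.mpr ?_)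
    rw [v1, a1, a2, a4]
    refine ⟨f, hfM.mono fun u hu v hv _ huv => ?_, not_le.mp hlt⟩
    rw [liveGraph_adj hM hu hv]
    rw [edgeGraph_adj] at huv ⊢
    obtain ⟨hne, j, hj, h, h'⟩ := huv
    exact Or.inl ⟨hne, j, hj, by rwa [h3' j hj], h'⟩
  · rw [if_pos (by simpa [Expr.eval] using hf)]
    have hau := spec.mp hf
    rw [← b4] at hau
    rw [← v1', ← b1, ← b2, ← b3] at hE₁ hau
    have hM₂ : IsMatch (inputGraph s) (s₂.var 1) (s₂.arr 4) := by rwa [v1', v1, b4, a4]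
    obtain ⟨hle, hau', hcrit⟩ := reduce_spec hM₂ hE₁ hau
    simp only [run_seq]
    set s₃ := reduce.run s₂ with hs₃
    have w1 : s₃.var 1 = s.var 1 := ((run_var (by decide) s₂).trans v1').trans v1
    have c1 : s₃.arr 1 = s.arr 1 := ((run_arr (by decide) s₂).trans b1).trans a1
    have c2 : s₃.arr 2 = s.arr 2 := ((run_arr (by decide) s₂).trans b2).trans a2
    have c4 : s₃.arr 4 = s.arr 4 := ((run_arr (by decide) s₂).trans b4).trans a4
    rw [v1', v1, b1, a1, b2, a2, b4, a4] at hau' hcrit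
    have hle' : ∀ j < s.var 1, s₃.arr 3 j ≠ 0 → s.arr 11 j ≠ 0 := fun j hj h => by
      have := hle j h
      rwa [b3, h3' j hj] at this
    obtain ⟨f, hf, hnew⟩ := exists_larger_of_critical hM hle'
      (fun j hj h => hE j hj (hle' j hj h)) hau' hcrit
    have st := storeEdges_spec (s := s₃) (f := f) (by rw [w1, c1, c2]; exact hf)
    set s₄ := storeEdges.run s₃ with hs₄
    have x1 : s₄.var 1 = s.var 1 := (run_var (by decide) s₃).trans w1
    have d4 : s₄.arr 4 = s.arr 4 := (run_arr (by decide) s₃).trans c4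
    rw [w1, c1, c2] at st
    have sm := storeMates_spec (s := s₄)
    rw [x1, d4] at sm
    have := hnew _ st _ sm
    exact ⟨this.1, Or.inl this.2⟩

/-- The deficiency is at most `s.var 1` at first and drops in each round until the matching is
maximum; after `s.var 1` drops it would be `0`. -/
theorem maxMatching_spec (hE : ValidEdges s) :
    IsMatch (inputGraph s) (s.var 1) ((maxMatching.run s).arr 4) ∧
      ∀ f, IsMatch (inputGraph s) (s.var 1) f →
        deficiency (s.var 1) ((maxMatching.run s).arr 4) ≤ deficiency (s.var 1) f := by
  set s₁ := (rep 22 (.write 4 (var 22) (var 22))).run s with hs₁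
  have v1 : s₁.var 1 = s.var 1 := run_var (by decide) s
  have a1 : s₁.arr 1 = s.arr 1 := run_arr (by decide) s
  have a2 : s₁.arr 2 = s.arr 2 := run_arr (by decide) s
  have a11 : s₁.arr 11 = s.arr 11 := run_arr (by decide) s
  have h4 := rep_write_spec (i := 22) (a := 4) (e := var 22) (by decide) s (fun k => k)
    (fun _ _ _ _ h _ => h)
  have h4' : ∀ w < s.var 1, s₁.arr 4 w = w := fun w hw => by rw [h4 w, if_pos hw]
  have key := rep_induction (i := 22) (c := augment) (by decide) s₁
    (fun k s' => (s'.arr 1 = s.arr 1 ∧ s'.arr 2 = s.arr 2 ∧ s'.arr 11 = s.arr 11) ∧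
      IsMatch (inputGraph s) (s.var 1) (s'.arr 4) ∧
      (deficiency (s.var 1) (s'.arr 4) + k ≤ s.var 1 ∨ ∀ f, IsMatch (inputGraph s) (s.var 1) f →
        deficiency (s.var 1) (s'.arr 4) ≤ deficiency (s.var 1) f)) ?_ ?_
  · obtain ⟨-, hm, h⟩ := key
    refine ⟨hm, ?_⟩
    rcases h with h | h
    · intro f _
      have h' : deficiency (s.var 1) ((maxMatching.run s).arr 4) + s₁.var 1 ≤ s.var 1 := h
      omega
    · exact h
  · refine ⟨⟨a1, a2, a11⟩, ⟨fun w hw => ?_, fun w hw => ?_, fun w hw h => ?_⟩, Or.inl ?_⟩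
    · rw [State.setVar_arr, h4' w hw]; exact hw
    · rw [State.setVar_arr, h4' w hw, h4' w hw]
    · exact absurd (h4' w hw) h
    · rw [Nat.add_zero]
      exact (card_filter_le _ _).trans (card_range _).le
  · rintro k - s' w1 - ⟨⟨c1, c2, c11⟩, hm, h⟩
    refine ⟨⟨?_, ?_, ?_⟩, ?_⟩
    · rw [State.setVar_arr, run_arr (by decide), c1]
    · rw [State.setVar_arr, run_arr (by decide), c2]
    · rw [State.setVar_arr, run_arr (by decide), c11]
    rw [State.setVar_arr]
    have g : inputGraph s' = inputGraph s := by
      rw [inputGraph, inputGraph, w1, v1, c1, c2, c11]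
    have spec := augment_spec (s := s') (by
      rw [ValidEdges, w1, v1, c1, c2, c11]; exact hE) (by rwa [g, w1, v1])
    rw [g, w1, v1] at spec
    refine ⟨spec.1, ?_⟩
    rcases spec.2 with h' | h'
    · rcases h with h | h
      · exact Or.inl (by omega)
      · exact absurd (h _ spec.1) (not_le.mpr h')
    · exact Or.inr h'

end Blossom

/-! ### Matchings as subgraphs and as involutions. -/

open Finset in
/-- Matchings with `c` edges exist if and only if there is an involution along edges that moves at
least `2 * c` vertices. -/
theorem SimpleGraph.exists_isMatching_iff_involution {W : Type*} [Fintype W] [DecidableEq W]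
    (Γ : SimpleGraph W) (c : ℕ) :
    (∃ M : Γ.Subgraph, M.IsMatching ∧ M.edgeSet.ncard = c) ↔
      ∃ f : W → W, (∀ w, f (f w) = w) ∧ (∀ w, f w ≠ w → Γ.Adj w (f w)) ∧
        2 * c ≤ #{w | f w ≠ w} := by
  classical
  constructor
  · rintro ⟨M, hM, rfl⟩
    have h : ∀ w, ∃ w', (w ∈ M.verts ∧ M.Adj w w') ∨ (w ∉ M.verts ∧ w' = w) := fun w => by
      by_cases hw : w ∈ M.verts
      · obtain ⟨w', h, -⟩ := hM hw
        exact ⟨w', Or.inl ⟨hw, h⟩⟩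
      · exact ⟨w, Or.inr ⟨hw, rfl⟩⟩
    choose f hf using h
    have adj : ∀ w w', M.Adj w w' → f w = w' := fun w w' h => by
      rcases hf w with ⟨hw, h'⟩ | ⟨hw, -⟩
      · exact (hM hw).unique h' h
      · exact absurd (M.edge_vert h) hw
    refine ⟨f, fun w => ?_, fun w hne => ?_, ?_⟩
    · rcases hf w with ⟨hw, h⟩ | ⟨hw, h⟩
      · exact adj _ _ h.symm
      · rw [h, h]
    · rcases hf w with ⟨hw, h⟩ | ⟨hw, h⟩
      · exact M.adj_sub h
      · exact absurd h hne
    · rw [Set.ncard_eq_toFinset_card']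
      have key : ∀ a b, M.Adj a b → f a = b ∧ f b = a ∧ a ≠ b := fun a b h =>
        ⟨adj _ _ h, adj _ _ h.symm, (M.adj_sub h).ne⟩
      calc 2 * #M.edgeSet.toFinset
          ≤ 2 * #(image (fun w => s(w, f w)) ({w | f w ≠ w} : Finset W)) := by
            refine Nat.mul_le_mul_left 2 (card_le_card fun e he => ?_)
            rw [Set.mem_toFinset] at he
            induction e with
            | h a b =>
              obtain ⟨h1, h2, h3⟩ := key a b he
              exact mem_image.mpr ⟨a, by simp [h1, h3.symm], by rw [h1]⟩
        _ ≤ _ := by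
            refine mul_card_image_le_card _ 2 fun e he => ?_
            obtain ⟨w, hw, rfl⟩ := mem_image.mp he
            have hw : f w ≠ w := by simpa using hw
            have hM' : M.Adj w (f w) := by
              rcases hf w with ⟨-, h⟩ | ⟨-, h⟩
              · exact h
              · exact absurd h hw
            obtain ⟨-, h2, -⟩ := key _ _ hM'
            rw [← card_pair hw]
            refine card_le_card fun x hx => ?_
            rcases mem_insert.mp hx with rfl | hx
            · simp [h2, hw.symm]
            · rw [mem_singleton.mp hx]; simp [hw]
  · rintro ⟨f, hinv, hadj, hc⟩
    set S : Finset W := {w | f w ≠ w} with hS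
    have h1 : #S ≤ 2 * #(image (fun w => s(w, f w)) S) := by
      refine card_le_mul_card_image _ 2 fun e he => ?_
      obtain ⟨w, hw, rfl⟩ := mem_image.mp he
      refine (card_le_card (t := {w, f w}) fun x hx => ?_).trans card_le_two
      have hx := (mem_filter.mp hx).2
      have : x ∈ s(w, f w) := hx ▸ Sym2.mem_mk_left x (f x)
      simpa using this
    -- The involution may have more than `c` edges; any `c` of them are chosen.
    obtain ⟨T, hT, hTc⟩ := exists_subset_card_eq (s := image (fun w => s(w, f w)) S) (n := c)
      (by omega)
    have hsym : ∀ w, s(f w, f (f w)) = s(w, f w) := fun w => by rw [hinv, Sym2.eq_swap]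
    refine ⟨⟨{w | f w ≠ w ∧ s(w, f w) ∈ T}, fun a b => f a = b ∧ a ≠ b ∧ s(a, b) ∈ T,
      ?_, ?_, ⟨?_⟩⟩, ?_, ?_⟩
    · rintro a b ⟨rfl, h, -⟩
      exact hadj a h.symm
    · rintro a b ⟨rfl, h, h'⟩
      exact ⟨h.symm, h'⟩
    · rintro a b ⟨rfl, h, h'⟩
      exact ⟨hinv a, h.symm, by rwa [Sym2.eq_swap]⟩
    · rintro a ⟨h, h'⟩
      exact ⟨f a, ⟨rfl, h.symm, h'⟩, fun b hb => hb.1.symm⟩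
    · rw [← hTc, ← Set.ncard_coe_finset]
      congr 1
      ext e
      induction e with
      | h a b =>
        rw [SimpleGraph.Subgraph.mem_edgeSet]
        refine ⟨fun h => h.2.2, fun h => ?_⟩
        obtain ⟨w, hw, hwe⟩ := mem_image.mp (hT h)
        have hw : f w ≠ w := by simpa [hS] using hw
        rcases Sym2.eq_iff.mp hwe with ⟨rfl, rfl⟩ | ⟨rfl, rfl⟩
        · exact ⟨rfl, hw.symm, h⟩
        · exact ⟨hinv w, hw, h⟩

/-! ### The auxiliary graph, and segments of nontrivial paths. -/

namespace MultiDigraph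

open Finset

variable {V : Type*} [DecidableEq V] {G : MultiDigraph V} {X Y : Finset V}

/-- The end in the auxiliary graph of the arcs into `v`. -/
def headEnd (X Y : Finset V) (v : V) : V ⊕ {v : V // v ∉ X ∪ Y} :=
  if h : v ∈ X ∪ Y then Sum.inl v else Sum.inr ⟨v, h⟩

/-- The edges of the auxiliary graph, directed from the tail to the head of the arc. -/
def AuxArc (G : MultiDigraph V) (X Y : Finset V) (a b : V ⊕ {v : V // v ∉ X ∪ Y}) : Prop :=
  ∃ u v, a = Sum.inl u ∧ b = headEnd X Y v ∧ (G.KeptArc X Y u v ∨ (u = v ∧ v ∉ X ∪ Y))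

theorem headEnd_of_mem {v : V} (h : v ∈ X ∪ Y) : headEnd X Y v = Sum.inl v := by
  rw [headEnd, dif_pos h]

theorem headEnd_of_notMem {v : V} (h : v ∉ X ∪ Y) : headEnd X Y v = Sum.inr ⟨v, h⟩ := by
  rw [headEnd, dif_neg h]

theorem headEnd_injective : Function.Injective (headEnd X Y) := by
  intro u v h
  by_cases hu : u ∈ X ∪ Y <;> by_cases hv : v ∈ X ∪ Y <;>
    simp_all [headEnd]

theorem headEnd_eq_inl {u v : V} (h : headEnd X Y v = Sum.inl u) : u = v ∧ v ∈ X ∪ Y := by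
  by_cases hv : v ∈ X ∪ Y
  · rw [headEnd_of_mem hv] at h
    exact ⟨(Sum.inl_injective h).symm, hv⟩
  · rw [headEnd_of_notMem hv] at h; cases h

theorem headEnd_eq_inr {v : V} {u : {v : V // v ∉ X ∪ Y}} (h : headEnd X Y v = Sum.inr u) :
    u.1 = v := by
  by_cases hv : v ∈ X ∪ Y
  · rw [headEnd_of_mem hv] at h; cases h
  · rw [headEnd_of_notMem hv] at h
    rw [← Sum.inr_injective h]

theorem KeptArc.ne {u v : V} (h : G.KeptArc X Y u v) : u ≠ v := G.ne_of_mem _ h.1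

/-- With `headEnd`, the three kinds of edges become one: {v, v'} is treated as an arc from v to v
itself, allowed only outside X ∪ Y. Looplessness of the digraph makes the two ends distinct. -/
theorem auxGraph_adj {a b : V ⊕ {v : V // v ∉ X ∪ Y}} :
    (G.auxGraph X Y).Adj a b ↔ AuxArc G X Y a b ∨ AuxArc G X Y b a := by
  have key : ∀ a b : V ⊕ {v : V // v ∉ X ∪ Y},
      ((∃ v : {v : V // v ∉ X ∪ Y}, a = Sum.inl v.1 ∧ b = Sum.inr v) ∨
      (∃ u v : V, G.KeptArc X Y u v ∧ v ∈ X ∪ Y ∧ a = Sum.inl u ∧ b = Sum.inl v) ∨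
      (∃ (u : V) (v : {v : V // v ∉ X ∪ Y}), G.KeptArc X Y u v.1 ∧ a = Sum.inl u ∧
        b = Sum.inr v)) ↔ AuxArc G X Y a b := by
    intro a b
    constructor
    · rintro (⟨v, rfl, rfl⟩ | ⟨u, v, h, hv, rfl, rfl⟩ | ⟨u, v, h, rfl, rfl⟩)
      · exact ⟨v, v, rfl, (headEnd_of_notMem v.2).symm, Or.inr ⟨rfl, v.2⟩⟩
      · exact ⟨u, v, rfl, (headEnd_of_mem hv).symm, Or.inl h⟩
      · exact ⟨u, v, rfl, (headEnd_of_notMem v.2).symm, Or.inl h⟩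
    · rintro ⟨u, v, rfl, rfl, h⟩
      by_cases hv : v ∈ X ∪ Y
      · rw [headEnd_of_mem hv]
        rcases h with h | h
        · exact Or.inr (Or.inl ⟨u, v, h, hv, rfl, rfl⟩)
        · exact absurd hv h.2
      · rw [headEnd_of_notMem hv]
        rcases h with h | ⟨rfl, h⟩
        · exact Or.inr (Or.inr ⟨u, ⟨v, hv⟩, h, rfl, rfl⟩)
        · exact Or.inl ⟨⟨u, hv⟩, rfl, rfl⟩
  have hne : ∀ a b, AuxArc G X Y a b → a ≠ b := by
    rintro _ _ ⟨u, v, rfl, rfl, h⟩ h'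
    obtain ⟨rfl, hv⟩ := headEnd_eq_inl h'.symm
    rcases h with h | h
    · exact h.ne rfl
    · exact h.2 hv
  rw [auxGraph, SimpleGraph.fromRel_adj, key, key]
  refine ⟨fun h => h.2, fun h => ⟨?_, h⟩⟩
  rcases h with h | h
  · exact hne _ _ h
  · exact (hne _ _ h).symm

/-- Disjoint paths of kept arcs whose ends are in `X ∪ Y` and whose internal vertices are not:
the path number `t` is `q t 0, …, q t (d t)`. -/
structure Segments (G : MultiDigraph V) (X Y : Finset V) {k : ℕ} (d : Fin k → ℕ)
    (q : Fin k → ℕ → V) : Prop where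
  pos : ∀ t, 0 < d t
  first : ∀ t, q t 0 ∈ X ∪ Y
  last : ∀ t, q t (d t) ∈ X ∪ Y
  internal : ∀ t l, 0 < l → l < d t → q t l ∉ X ∪ Y
  kept : ∀ t l, l < d t → G.KeptArc X Y (q t l) (q t (l + 1))
  inj : ∀ t l t' l', l ≤ d t → l' ≤ d t' → q t l = q t' l' → t = t' ∧ l = l'

/-- A nontrivial path contains a path of kept arcs with internal vertices outside `X ∪ Y`. -/
theorem IsNontrivialPath.exists_segment {p : List V} (hp : G.IsNontrivialPath X Y p) :
    ∃ i d : ℕ, 0 < d ∧ ∃ h : i + d < p.length, p[i] ∈ X ∪ Y ∧ p[i + d] ∈ X ∪ Y ∧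
      (∀ l, 0 < l → ∀ _ : l < d, p[i + l] ∉ X ∪ Y) ∧
      ∀ l, ∀ _ : l < d, G.KeptArc X Y p[i + l] p[i + l + 1] := by
  classical
  obtain ⟨hnd, hch, x, hx, y, hy, hhead, hlast, hne⟩ := hp
  rw [List.isChain_iff_getElem] at hch
  have hlen : 0 < p.length := by
    rw [List.length_pos_iff]; rintro rfl; simp at hhead
  have h0 : p[0] = x := by
    rw [List.head?_eq_getElem?, List.getElem?_eq_getElem hlen] at hhead
    exact Option.some.inj hhead
  have hl : p[p.length - 1] = y := by
    rw [List.getLast?_eq_getElem?, List.getElem?_eq_getElem (by omega)] at hlast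
    exact Option.some.inj hlast
  have hlen2 : 1 < p.length := by
    by_contra h
    have : p.length - 1 = 0 := by omega
    simp only [this] at hl
    exact hne (h0.symm.trans hl)
  -- The last visit to X before the final vertex. The final vertex is left out because it may lie in
  -- X too.
  have hex : ∃ i, ∃ h : i + 1 < p.length, p[i] ∈ X ∧ ∀ j, i < j → ∀ _ : j + 1 < p.length,
      p[j] ∉ X := by
    set S : Finset ℕ := {i ∈ range (p.length - 1) | ∃ h : i < p.length, p[i] ∈ X} with hS
    have hne : S.Nonempty := ⟨0, by simp [hS, h0, hx, hlen, hlen2]⟩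
    obtain ⟨m, hm, hmax⟩ : ∃ m, m ∈ S ∧ ∀ j ∈ S, j ≤ m := ⟨_, S.max'_mem hne, S.le_max'⟩
    simp only [hS, mem_filter, mem_range] at hm
    obtain ⟨h1, h2, h3⟩ := hm
    refine ⟨m, by omega, h3, fun j hj hj' hX => ?_⟩
    have := hmax j (by simp only [hS, mem_filter, mem_range]; exact ⟨by omega, by omega, hX⟩)
    omega
  obtain ⟨i, hi, hiX, hmax⟩ := hex
  -- The first visit to Y after position `i`. Strictly in between, the path avoids both X and Y.
  have hexj : ∃ d, 0 < d ∧ ∃ h : i + d < p.length, p[i + d] ∈ Y := by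
    refine ⟨p.length - 1 - i, by omega, by omega, ?_⟩
    have : i + (p.length - 1 - i) = p.length - 1 := by omega
    simp only [this, hl, hy]
  obtain ⟨hd, hdl, hdY⟩ := Nat.find_spec hexj
  have hmin := fun m (h : m < Nat.find hexj) => Nat.find_min hexj h
  set d := Nat.find hexj
  refine ⟨i, d, hd, hdl, mem_union_left _ hiX, mem_union_right _ hdY, fun l h0 hl => ?_,
    fun l hl => ⟨hch (i + l) (by omega), ?_, ?_⟩⟩
  · rw [mem_union, not_or]
    exact ⟨hmax _ (by omega) (by omega), fun h => hmin l hl ⟨h0, by omega, h⟩⟩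
  · rw [mem_sdiff, not_and_not_right]
    intro h
    by_cases he : i + l + 1 + 1 < p.length
    · exact absurd h (hmax _ (by omega) he)
    · have : l + 1 = d := by omega
      simp only [add_assoc, this]
      exact hdY
  · rw [mem_sdiff, not_and_not_right]
    intro h
    by_cases h0 : l = 0
    · subst h0; exact hiX
    · exact absurd ⟨by omega, by omega, h⟩ (hmin l hl)

theorem HasDisjointPaths.exists_segments {k : ℕ} (h : G.HasDisjointPaths X Y k) :
    ∃ (d : Fin k → ℕ) (q : Fin k → ℕ → V), Segments G X Y d q := by
  obtain ⟨P, hP, hdis⟩ := h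
  choose i d hd hlt h1 h2 h3 h4 using fun t => (hP t).exists_segment
  -- The segments are made total functions of the position; the default, the first vertex, is used
  -- only beyond the end of the path.
  have hget : ∀ t l (h : l ≤ d t), ((P t)[i t + l]?).getD ((P t)[i t]'(by have := hlt t; omega)) =
      (P t)[i t + l]'(by have := hlt t; omega) := fun t l h => by
    rw [List.getElem?_eq_getElem (by have := hlt t; omega)]; rfl
  refine ⟨d, fun t l => ((P t)[i t + l]?).getD ((P t)[i t]'(by have := hlt t; omega)),
    hd, fun t => ?_, fun t => ?_, fun t l h h' => ?_, fun t l h => ?_, ?_⟩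
  · rw [hget t 0 (Nat.zero_le _)]; exact h1 t
  · rw [hget t _ le_rfl]; exact h2 t
  · rw [hget t l h'.le]; exact h3 t l h h'
  · rw [hget t l h.le, hget t (l + 1) h]; exact h4 t l h
  · intro t l t' l' hl hl' h
    rw [hget t l hl, hget t' l' hl'] at h
    have htt : t = t' := by
      by_contra hne
      have hm : (P t')[i t' + l']'(by have := hlt t'; omega) ∈ P t' := List.getElem_mem _
      rw [← h] at hm
      exact hdis t t' hne (List.getElem_mem _) hm
    subst htt
    have := (hP t).1.getElem_inj_iff.mp h
    exact ⟨rfl, by omega⟩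

end MultiDigraph

/-! ### From disjoint paths to a matching. -/

namespace MultiDigraph

open Finset

variable {V : Type*} [DecidableEq V] {G : MultiDigraph V} {X Y : Finset V}

/-- Disjoint segments give a large matching of the auxiliary graph. -/
theorem Segments.exists_involution [Fintype V] {k : ℕ} {d : Fin k → ℕ} {q : Fin k → ℕ → V}
    (S : Segments G X Y d q) : ∃ f : V ⊕ {v : V // v ∉ X ∪ Y} → V ⊕ {v : V // v ∉ X ∪ Y},
      (∀ w, f (f w) = w) ∧ (∀ w, f w ≠ w → (G.auxGraph X Y).Adj w (f w)) ∧
        2 * (k + ((X ∪ Y)ᶜ).card) ≤ #{w | f w ≠ w} := by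
  classical
  -- `E` holds the edges coming from arcs of segments, from tail to head; `D` exchanges v and v' and
  -- fixes X ∪ Y. The involution follows `E` where possible and `D` elsewhere.
  set E : V ⊕ {v : V // v ∉ X ∪ Y} → V ⊕ {v : V // v ∉ X ∪ Y} → Prop := fun a b =>
    ∃ t l, l < d t ∧ a = Sum.inl (q t l) ∧ b = headEnd X Y (q t (l + 1)) with hE
  set D : V ⊕ {v : V // v ∉ X ∪ Y} → V ⊕ {v : V // v ∉ X ∪ Y} :=
    Sum.elim (headEnd X Y) (fun v => Sum.inl v.1) with hD
  have src : ∀ a b b', E a b → E a b' → b = b' := by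
    rintro _ _ _ ⟨t, l, hl, rfl, rfl⟩ ⟨t', l', hl', h, rfl⟩
    obtain ⟨rfl, rfl⟩ := S.inj t l t' l' hl.le hl'.le (Sum.inl_injective h)
    rfl
  have tgt : ∀ a a' b, E a b → E a' b → a = a' := by
    rintro _ _ _ ⟨t, l, hl, rfl, rfl⟩ ⟨t', l', hl', rfl, h⟩
    obtain ⟨rfl, h2⟩ := S.inj t _ t' _ hl hl' (headEnd_injective h)
    obtain rfl : l = l' := by omega
    rfl
  have srctgt : ∀ a b c, E a b → ¬ E b c := by
    rintro _ _ _ ⟨t, l, hl, rfl, rfl⟩ ⟨t', l', hl', h, rfl⟩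
    obtain ⟨h1, h2⟩ := headEnd_eq_inl h
    obtain ⟨rfl, rfl⟩ := S.inj t' l' t (l + 1) hl'.le hl h1
    exact S.internal t' (l + 1) (Nat.succ_pos l) hl' h2
  -- A vertex outside X ∪ Y is internal in its segment, so it is entered exactly if it is left.
  -- Hence v and v' are both used by `E` or both available to `D`.
  have inr_tgt : ∀ v : {v : V // v ∉ X ∪ Y}, (∃ a, E a (Sum.inr v)) ↔ ∃ b, E (Sum.inl v.1) b := by
    intro v
    constructor
    · rintro ⟨_, t, l, hl, rfl, h⟩
      have h := headEnd_eq_inr h.symm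
      have hne : l + 1 ≠ d t := fun h' => v.2 (by rw [h, h']; exact S.last t)
      exact ⟨_, t, l + 1, by omega, by rw [h], rfl⟩
    · rintro ⟨_, t, l, hl, h, rfl⟩
      have h := Sum.inl_injective h
      have h0 : l ≠ 0 := fun h' => v.2 (by rw [h, h']; exact S.first t)
      obtain ⟨m, rfl⟩ := Nat.exists_eq_succ_of_ne_zero h0
      exact ⟨_, t, m, by omega, rfl, by
        rw [← Nat.succ_eq_add_one, ← h, headEnd_of_notMem v.2]⟩
  have inr_src : ∀ (v : {v : V // v ∉ X ∪ Y}) b, ¬ E (Sum.inr v) b := by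
    rintro v _ ⟨t, l, hl, h, rfl⟩
    cases h
  have inl_tgt : ∀ v, v ∉ X ∪ Y → ∀ a, ¬ E a (Sum.inl v) := by
    rintro v hv _ ⟨t, l, hl, rfl, h⟩
    obtain ⟨h1, h2⟩ := headEnd_eq_inl h.symm
    exact hv (h1 ▸ h2)
  set U : V ⊕ {v : V // v ∉ X ∪ Y} → Prop := fun w => (∀ b, ¬ E w b) ∧ ∀ a, ¬ E a w with hU
  have UD : ∀ w, U w → U (D w) ∧ D (D w) = w := by
    rintro (v | v) ⟨h1, h2⟩
    · by_cases hv : v ∈ X ∪ Y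
      · have : D (Sum.inl v) = Sum.inl v := headEnd_of_mem hv
        rw [this, this]
        exact ⟨⟨h1, h2⟩, rfl⟩
      · have : D (Sum.inl v) = Sum.inr ⟨v, hv⟩ := headEnd_of_notMem hv
        rw [this]
        refine ⟨⟨inr_src _, fun a ha => ?_⟩, rfl⟩
        obtain ⟨b, hb⟩ := (inr_tgt ⟨v, hv⟩).mp ⟨a, ha⟩
        exact h1 b hb
    · have : D (Sum.inr v) = Sum.inl v.1 := rfl
      rw [this]
      refine ⟨⟨fun b hb => ?_, inl_tgt _ v.2⟩, headEnd_of_notMem v.2⟩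
      obtain ⟨a, ha⟩ := (inr_tgt v).mpr ⟨b, hb⟩
      exact h2 a ha
  set R : V ⊕ {v : V // v ∉ X ∪ Y} → V ⊕ {v : V // v ∉ X ∪ Y} → Prop := fun w w' =>
    E w w' ∨ E w' w ∨ (U w ∧ w' = D w) with hR
  have Rsymm : ∀ w w', R w w' → R w' w := by
    rintro w w' (h | h | ⟨h, rfl⟩)
    · exact Or.inr (Or.inl h)
    · exact Or.inl h
    · exact Or.inr (Or.inr ⟨(UD w h).1, (UD w h).2.symm⟩)
  have Runique : ∀ w a b, R w a → R w b → a = b := by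
    rintro w a b (h | h | ⟨h, rfl⟩) (h' | h' | ⟨h', rfl⟩)
    · exact src _ _ _ h h'
    · exact absurd h (srctgt _ _ _ h')
    · exact absurd h (h'.1 a)
    · exact absurd h' (srctgt _ _ _ h)
    · exact tgt _ _ _ h h'
    · exact absurd h (h'.2 a)
    · exact absurd h' (h.1 b)
    · exact absurd h' (h.2 b)
    · rfl
  have hex : ∀ w, ∃ w', R w w' := by
    intro w
    by_cases h1 : ∃ b, E w b
    · exact ⟨_, Or.inl h1.choose_spec⟩
    by_cases h2 : ∃ a, E a w
    · exact ⟨_, Or.inr (Or.inl h2.choose_spec)⟩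
    · exact ⟨_, Or.inr (Or.inr ⟨⟨not_exists.mp h1, not_exists.mp h2⟩, rfl⟩)⟩
  choose f hf using hex
  have Eadj : ∀ a b, E a b → (G.auxGraph X Y).Adj a b := by
    rintro _ _ ⟨t, l, hl, rfl, rfl⟩
    exact auxGraph_adj.mpr (Or.inl ⟨_, _, rfl, rfl, Or.inl (S.kept t l hl)⟩)
  have Radj : ∀ w w', R w w' → w' ≠ w → (G.auxGraph X Y).Adj w w' := by
    rintro w w' (h | h | ⟨h, rfl⟩) hne
    · exact Eadj _ _ h
    · exact (Eadj _ _ h).symm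
    · rcases w with v | v
      · by_cases hv : v ∈ X ∪ Y
        · exact absurd (headEnd_of_mem hv) hne
        · exact auxGraph_adj.mpr (Or.inl ⟨v, v, rfl, rfl, Or.inr ⟨rfl, hv⟩⟩)
      · exact auxGraph_adj.mpr (Or.inr ⟨v.1, v.1, rfl, (headEnd_of_notMem v.2).symm,
          Or.inr ⟨rfl, v.2⟩⟩)
  refine ⟨f, fun w => Runique _ _ _ (hf (f w)) (Rsymm _ _ (hf w)), fun w => Radj _ _ (hf w), ?_⟩
  have hne : ∀ w, (¬ U w ∨ D w ≠ w) → f w ≠ w := by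
    intro w hw h
    have h' := hf w
    rw [h] at h'
    rcases h' with h' | h' | ⟨h', h''⟩
    · exact (Eadj _ _ h').ne rfl
    · exact (Eadj _ _ h').ne rfl
    · rcases hw with hw | hw
      · exact hw h'
      · exact hw h''.symm
  -- Moved vertices: those outside X ∪ Y, their copies, and the first and last vertices of the
  -- segments.
  let e : ({v : V // v ∉ X ∪ Y} ⊕ {v : V // v ∉ X ∪ Y}) ⊕ (Fin k ⊕ Fin k) →
      {w // f w ≠ w} := Sum.elim
    (Sum.elim (fun v => ⟨Sum.inl v.1, hne _ (Or.inr (by simp [hD, headEnd_of_notMem v.2]))⟩)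
      (fun v => ⟨Sum.inr v, hne _ (Or.inr (by simp [hD]))⟩))
    (Sum.elim (fun t => ⟨Sum.inl (q t 0), hne _ (Or.inl fun h => h.1 _ ⟨t, 0, S.pos t, rfl, rfl⟩)⟩)
      (fun t => ⟨Sum.inl (q t (d t)), hne _ (Or.inl fun h => h.2 _ ⟨t, d t - 1, by
        have := S.pos t; omega, rfl, by
          rw [Nat.sub_add_cancel (S.pos t), headEnd_of_mem (S.last t)]⟩)⟩))
  have he : Function.Injective e := by
    have n1 : ∀ (v : {v : V // v ∉ X ∪ Y}) t, v.1 ≠ q t 0 := fun v t h => v.2 (h ▸ S.first t)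
    have n2 : ∀ (v : {v : V // v ∉ X ∪ Y}) t, v.1 ≠ q t (d t) := fun v t h => v.2 (h ▸ S.last t)
    have n3 : ∀ t t', q t 0 ≠ q t' (d t') := fun t t' h => by
      have := S.inj t 0 t' (d t') (Nat.zero_le _) le_rfl h
      have := S.pos t'
      omega
    rintro ((v | v) | (t | t)) ((v' | v') | (t' | t')) h <;>
      simp only [e, Sum.elim_inl, Sum.elim_inr, Subtype.mk.injEq, Sum.inl.injEq, Sum.inr.injEq,
        reduceCtorEq] at h
    · rw [Subtype.ext h]
    · exact absurd h (n1 _ _)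
    · exact absurd h (n2 _ _)
    · rw [h]
    · exact absurd h.symm (n1 _ _)
    · rw [(S.inj t 0 t' 0 (Nat.zero_le _) (Nat.zero_le _) h).1]
    · exact absurd h (n3 _ _)
    · exact absurd h.symm (n2 _ _)
    · exact absurd h.symm (n3 _ _)
    · rw [(S.inj t _ t' _ le_rfl le_rfl h).1]
  have hcard := Fintype.card_le_of_injective e he
  have hc : Fintype.card {v : V // v ∉ X ∪ Y} = ((X ∪ Y)ᶜ).card := by
    rw [Fintype.card_subtype]
    congr 1
    ext v
    simp
  rw [Fintype.card_sum, Fintype.card_sum, Fintype.card_sum, Fintype.card_fin, hc,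
    Fintype.card_subtype] at hcard
  omega

end MultiDigraph

/-! ### From a matching to disjoint paths. -/

namespace MultiDigraph

open Finset

variable {V : Type*} [DecidableEq V] {G : MultiDigraph V} {X Y : Finset V}

theorem AuxArc.fst {a b : V ⊕ {v : V // v ∉ X ∪ Y}} (h : AuxArc G X Y a b) :
    ∃ u, a = Sum.inl u := by
  obtain ⟨u, v, rfl, -⟩ := h
  exact ⟨u, rfl⟩

/-- A large matching of the auxiliary graph may be chosen so that it covers all copies `v'`. -/
theorem exists_involution_covering [Fintype V] {c : ℕ}
    (h : ∃ f : V ⊕ {v : V // v ∉ X ∪ Y} → V ⊕ {v : V // v ∉ X ∪ Y},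
      (∀ w, f (f w) = w) ∧ (∀ w, f w ≠ w → (G.auxGraph X Y).Adj w (f w)) ∧ c ≤ #{w | f w ≠ w}) :
    ∃ f : V ⊕ {v : V // v ∉ X ∪ Y} → V ⊕ {v : V // v ∉ X ∪ Y},
      (∀ w, f (f w) = w) ∧ (∀ w, f w ≠ w → (G.auxGraph X Y).Adj w (f w)) ∧ c ≤ #{w | f w ≠ w} ∧
        ∀ v, f (Sum.inr v) ≠ Sum.inr v := by
  classical
  set A : Finset (V ⊕ {v : V // v ∉ X ∪ Y} → V ⊕ {v : V // v ∉ X ∪ Y}) :=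
    {f | (∀ w, f (f w) = w) ∧ (∀ w, f w ≠ w → (G.auxGraph X Y).Adj w (f w)) ∧ c ≤ #{w | f w ≠ w}}
    with hA
  obtain ⟨f₀, h₀⟩ := h
  -- Among the large matchings, take one with the most edges {v, v'}. If a copy v' were exposed,
  -- replacing the edge at v, if any, by {v, v'} would give one more.
  obtain ⟨f, hf, hmax⟩ := A.exists_max_image
    (fun f => #{v : {v : V // v ∉ X ∪ Y} | f (Sum.inr v) = Sum.inl v.1})
    ⟨f₀, by simpa [hA] using h₀⟩
  have hf' := (mem_filter.mp hf).2
  obtain ⟨hinv, hadj, hc⟩ := hf'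
  refine ⟨f, hinv, hadj, hc, fun v hv => ?_⟩
  set b := f (Sum.inl v.1) with hb
  have hfb : f b = Sum.inl v.1 := hinv _
  have hbv : b ≠ Sum.inr v := fun h => by rw [h, hv] at hfb; cases hfb
  set g : V ⊕ {v : V // v ∉ X ∪ Y} → V ⊕ {v : V // v ∉ X ∪ Y} := fun w =>
    if w = Sum.inl v.1 then Sum.inr v else if w = Sum.inr v then Sum.inl v.1 else
      if w = b then w else f w with hg
  have g1 : g (Sum.inl v.1) = Sum.inr v := by simp [hg]
  have g2 : g (Sum.inr v) = Sum.inl v.1 := by simp [hg]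
  have g3 : ∀ w, w ≠ Sum.inl v.1 → w ≠ Sum.inr v → w ≠ b → g w = f w := fun w h1 h2 h3 => by
    simp only [hg, if_neg h1, if_neg h2, if_neg h3]
  have g4 : b ≠ Sum.inl v.1 → g b = b := fun h => by simp only [hg, if_neg h, if_neg hbv, if_true]
  have cases : ∀ w, w = Sum.inl v.1 ∨ w = Sum.inr v ∨ (w = b ∧ b ≠ Sum.inl v.1) ∨
      (w ≠ Sum.inl v.1 ∧ w ≠ Sum.inr v ∧ w ≠ b) := fun w => by
    by_cases h1 : w = Sum.inl v.1
    · exact Or.inl h1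
    by_cases h2 : w = Sum.inr v
    · exact Or.inr (Or.inl h2)
    by_cases h3 : w = b
    · exact Or.inr (Or.inr (Or.inl ⟨h3, h3 ▸ h1⟩))
    · exact Or.inr (Or.inr (Or.inr ⟨h1, h2, h3⟩))
  have hginv : ∀ w, g (g w) = w := by
    intro w
    rcases cases w with rfl | rfl | ⟨rfl, h⟩ | ⟨h1, h2, h3⟩
    · rw [g1, g2]
    · rw [g2, g1]
    · rw [g4 h, g4 h]
    · rw [g3 w h1 h2 h3, g3 (f w), hinv]
      · intro h; exact h3 (by rw [hb, ← h, hinv])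
      · intro h; exact h2 (by rw [← hinv w, h, hv])
      · intro h; rw [hb] at h; exact h1 (by rw [← hinv w, h, hinv])
  have hgadj : ∀ w, g w ≠ w → (G.auxGraph X Y).Adj w (g w) := by
    intro w
    have e : (G.auxGraph X Y).Adj (Sum.inl v.1) (Sum.inr v) :=
      auxGraph_adj.mpr (Or.inl ⟨v.1, v.1, rfl, (headEnd_of_notMem v.2).symm, Or.inr ⟨rfl, v.2⟩⟩)
    rcases cases w with rfl | rfl | ⟨rfl, h⟩ | ⟨h1, h2, h3⟩
    · rw [g1]; exact fun _ => e
    · rw [g2]; exact fun _ => e.symm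
    · rw [g4 h]; exact fun h => absurd rfl h
    · rw [g3 w h1 h2 h3]; exact hadj w
  -- Only the old partner `b` of v can become exposed; it is charged to v', which `f` leaves
  -- exposed.
  have hgc : c ≤ #{w | g w ≠ w} := by
    refine hc.trans (card_le_card_of_injOn (fun w => if w = b then Sum.inr v else w) ?_ ?_)
    · intro w hw
      have hw : f w ≠ w := by simpa using hw
      by_cases h : w = b
      · simp only [h, if_true]
        simp [g2]
      · simp only [h, if_false, coe_filter, mem_univ, true_and, Set.mem_ofPred_eq]
        rcases cases w with rfl | rfl | ⟨rfl, h⟩ | ⟨h1, h2, h3⟩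
        · rw [g1]; simp
        · rw [g2]; simp
        · exact absurd rfl h
        · rwa [g3 w h1 h2 h3]
    · intro w hw w' hw' h
      have hw : f w ≠ w := by simpa using hw
      have hw' : f w' ≠ w' := by simpa using hw'
      have n : ∀ w, f w ≠ w → Sum.inr v ≠ w := fun w hw h => hw (h ▸ hv)
      by_cases h1 : w = b <;> by_cases h2 : w' = b
      · rw [h1, h2]
      · simp only [h1, h2, if_true, if_false] at h; exact absurd h (n w' hw')
      · simp only [h1, h2, if_true, if_false] at h; exact absurd h.symm (n w hw)
      · simpa only [h1, h2, if_false] using h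
  have hgA : g ∈ A := by
    rw [hA, mem_filter]
    exact ⟨mem_univ _, hginv, hgadj, hgc⟩
  refine not_lt.mpr (hmax g hgA) (card_lt_card (Finset.ssubset_iff_subset_ne.mpr ⟨fun u hu => ?_,
    fun h => ?_⟩))
  · simp only [mem_filter, mem_univ, true_and] at hu ⊢
    by_cases huv : u = v
    · rw [huv, g2]
    · have h1 : (Sum.inr u : V ⊕ {v : V // v ∉ X ∪ Y}) ≠ b := fun h => by
        rw [h, hfb] at hu
        exact huv (Subtype.ext (Sum.inl_injective hu).symm)
      rw [g3 _ (by simp) (by simpa using huv) h1, hu]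
  · have : v ∈ ({v : {v : V // v ∉ X ∪ Y} | f (Sum.inr v) = Sum.inl v.1} : Finset _) := by
      rw [h]; simp [g2]
    simp only [mem_filter, hv] at this
    cases this.2

/-- Following the arcs of a matching of the auxiliary graph back from the head of an arc. -/
theorem exists_backward_path [Finite V] {g : V → V} {Good : V → Prop}
    (hinj : ∀ u v, Good u → Good v → g u = g v → u = v)
    (hstep : ∀ v, Good v → g v ∉ X ∪ Y → Good (g v)) {b : V} (hb : Good b) (hbXY : b ∈ X ∪ Y) :
    ∃ L, 0 < L ∧ g^[L] b ∈ X ∪ Y ∧ (∀ i, 0 < i → i < L → g^[i] b ∉ X ∪ Y) ∧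
      ∀ i < L, Good (g^[i] b) := by
  classical
  have hgd : ∀ L, (∀ i, 0 < i → i < L → g^[i] b ∉ X ∪ Y) → ∀ i < L, Good (g^[i] b) := by
    intro L hL i
    induction i with
    | zero => exact fun _ => hb
    | succ i ih =>
      intro hi
      have := hL (i + 1) (Nat.succ_pos i) hi
      rw [Function.iterate_succ_apply'] at this ⊢
      exact hstep _ (ih (by omega)) this
  have hex : ∃ L, 0 < L ∧ g^[L] b ∈ X ∪ Y := by
    by_contra hno
    push Not at hno
    have hall : ∀ i, Good (g^[i] b) := fun i => hgd (i + 1) (fun j hj _ => hno j hj) i (by omega)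
    obtain ⟨i, j, hij, h⟩ := Finite.exists_ne_map_eq_of_infinite (fun i : ℕ => g^[i] b)
    -- A repetition can be cancelled, by injectivity on good vertices, down to a return to `b`. But
    -- `b` is in X ∪ Y, so the walk would have stopped.
    have key : ∀ i d, g^[i] b = g^[i + d] b → b = g^[d] b := by
      intro i d
      induction i with
      | zero => intro h; simpa using h
      | succ i ih =>
        intro h
        refine ih (hinj _ _ (hall _) (hall _) ?_)
        rw [← Function.iterate_succ_apply' g, ← Function.iterate_succ_apply' g, h]
        congr 1; omega
    have key' : ∀ i j, i < j → g^[i] b = g^[j] b → False := fun i j hij h => by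
      have := key i (j - i) (by rw [h]; congr 1; omega)
      exact hno (j - i) (by omega) (this ▸ hbXY)
    rcases lt_or_gt_of_ne hij with h' | h'
    · exact key' i j h' h
    · exact key' j i h' h.symm
  obtain ⟨h1, h2⟩ := Nat.find_spec hex
  have hmin : ∀ i, 0 < i → i < Nat.find hex → g^[i] b ∉ X ∪ Y := fun i h h' h'' =>
    Nat.find_min hex h' ⟨h, h''⟩
  exact ⟨Nat.find hex, h1, h2, hmin, hgd _ hmin⟩

/-- A large matching of the auxiliary graph gives disjoint paths. -/
theorem hasDisjointPaths_of_involution [Fintype V] {k : ℕ}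
    {f : V ⊕ {v : V // v ∉ X ∪ Y} → V ⊕ {v : V // v ∉ X ∪ Y}} (hinv : ∀ w, f (f w) = w)
    (hadj : ∀ w, f w ≠ w → (G.auxGraph X Y).Adj w (f w))
    (hc : 2 * (k + ((X ∪ Y)ᶜ).card) ≤ #{w | f w ≠ w})
    (hcov : ∀ v, f (Sum.inr v) ≠ Sum.inr v) : G.HasDisjointPaths X Y k := by
  classical
  -- A matching edge may come from two opposite arcs. The enumeration breaks the tie, so that each
  -- matching edge has exactly one head.
  let e := Fintype.equivFin (V ⊕ {v : V // v ∉ X ∪ Y})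
  set Head : V ⊕ {v : V // v ∉ X ∪ Y} → Prop := fun w =>
    f w ≠ w ∧ AuxArc G X Y (f w) w ∧ (¬ AuxArc G X Y w (f w) ∨ e (f w) < e w) with hHead
  have head_or : ∀ w, f w ≠ w → Head w ∨ Head (f w) := by
    intro w hw
    have hw' : f (f w) ≠ f w := fun h => hw (by rw [hinv] at h; exact h.symm)
    simp only [hHead, hinv]
    rcases auxGraph_adj.mp (hadj w hw) with h | h <;>
      rcases lt_or_gt_of_ne (fun h => hw (e.injective h) : e (f w) ≠ e w) with h' | h' <;> tauto
  have head_not : ∀ w, Head w → ¬ Head (f w) := by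
    rintro w ⟨h1, h2, h3⟩ ⟨h4, h5, h6⟩
    rw [hinv] at h5 h6
    rcases h3 with h3 | h3
    · exact h3 h5
    · rcases h6 with h6 | h6
      · exact h6 h2
      · exact lt_asymm h3 h6
  have hcard : k + ((X ∪ Y)ᶜ).card ≤ #{w | Head w} := by
    have h1 : ({w | f w ≠ w} : Finset (V ⊕ {v : V // v ∉ X ∪ Y})) ⊆
        ({w | Head w} : Finset _) ∪ ({w | Head w} : Finset _).image f := by
      intro w hw
      have hw : f w ≠ w := by simpa using hw
      rcases head_or w hw with h | h
      · exact mem_union_left _ (by simpa using h)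
      · exact mem_union_right _ (mem_image.mpr ⟨f w, by simpa using h, hinv w⟩)
    have h2 := card_le_card h1
    have h3 := card_union_le ({w | Head w} : Finset (V ⊕ {v : V // v ∉ X ∪ Y}))
      (({w | Head w} : Finset _).image f)
    have h4 := card_image_le (s := ({w | Head w} : Finset (V ⊕ {v : V // v ∉ X ∪ Y}))) (f := f)
    omega
  set B : Finset V := {b | Head (Sum.inl b)} with hB
  have hBk : k ≤ #B := by
    have h1 : ({w | Head w} : Finset (V ⊕ {v : V // v ∉ X ∪ Y})) ⊆
        B.image Sum.inl ∪ (univ : Finset {v : V // v ∉ X ∪ Y}).image Sum.inr := by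
      rintro (w | w) hw
      · exact mem_union_left _ (mem_image.mpr ⟨w, by simpa [hB] using hw, rfl⟩)
      · exact mem_union_right _ (mem_image.mpr ⟨w, mem_univ _, rfl⟩)
    have h2 := card_le_card h1
    have h3 := card_union_le (B.image (Sum.inl : V → V ⊕ {v : V // v ∉ X ∪ Y}))
      ((univ : Finset {v : V // v ∉ X ∪ Y}).image Sum.inr)
    have h4 := card_image_le (s := B) (f := (Sum.inl : V → V ⊕ {v : V // v ∉ X ∪ Y}))
    have h5 := card_image_le (s := (univ : Finset {v : V // v ∉ X ∪ Y}))
      (f := (Sum.inr : _ → V ⊕ {v : V // v ∉ X ∪ Y}))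
    have h6 : #(univ : Finset {v : V // v ∉ X ∪ Y}) = ((X ∪ Y)ᶜ).card := by
      rw [card_univ, Fintype.card_subtype]
      congr 1
      ext v
      simp
    omega
  set g : V → V := fun v => Sum.elim id Subtype.val (f (headEnd X Y v)) with hg
  -- Vertices from which a backward step is possible: the matching edge at the head end of `v` comes
  -- from a kept arc into `v`, and, if `v` is in X ∪ Y, it was directed towards `v`.
  set Good : V → Prop := fun v =>
    f (headEnd X Y v) = Sum.inl (g v) ∧ G.KeptArc X Y (g v) v ∧ (v ∈ X ∪ Y → v ∈ B) with hGood
  have hBXY : ∀ b ∈ B, b ∈ X ∪ Y := by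
    intro b hb
    obtain ⟨-, ⟨u, v, h1, h2, h3⟩, -⟩ := (mem_filter.mp hb).2
    obtain ⟨rfl, h⟩ := headEnd_eq_inl h2.symm
    exact h
  have hBgood : ∀ b ∈ B, Good b := by
    intro b hb
    obtain ⟨-, ⟨u, v, h1, h2, h3⟩, -⟩ := (mem_filter.mp hb).2
    obtain ⟨rfl, h⟩ := headEnd_eq_inl h2.symm
    have hgb : g b = u := by simp only [hg, headEnd_of_mem h, h1]; rfl
    refine ⟨by rw [headEnd_of_mem h, h1, hgb], ?_, fun _ => hb⟩
    rw [hgb]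
    rcases h3 with h3 | h3
    · exact h3
    · exact absurd h h3.2
  have hinj : ∀ u v, Good u → Good v → g u = g v → u = v := by
    rintro u v ⟨h1, -⟩ ⟨h2, -⟩ h
    rw [h, ← h2] at h1
    have := congrArg f h1
    rw [hinv, hinv] at this
    exact headEnd_injective this
  have hstep : ∀ v, Good v → g v ∉ X ∪ Y → Good (g v) := by
    rintro v ⟨h1, h2, -⟩ hv
    have h := hadj _ (hcov ⟨g v, hv⟩)
    rw [auxGraph_adj] at h
    rcases h with h | ⟨u, z, h3, h4, h5⟩
    · obtain ⟨u, hu⟩ := h.fst; cases hu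
    · obtain rfl := headEnd_eq_inr h4.symm
      have hw : headEnd X Y (g v) = Sum.inr ⟨g v, hv⟩ := headEnd_of_notMem hv
      have hgu : g (g v) = u := by
        change Sum.elim id Subtype.val (f (headEnd X Y (g v))) = u
        rw [hw, h3]; rfl
      refine ⟨by rw [hw, hgu]; exact h3, ?_, fun h => absurd h hv⟩
      rw [hgu]
      rcases h5 with h5 | ⟨rfl, -⟩
      · exact h5
      -- The copy of `g v` is not matched with `g v`, which is already matched with the head end of
      -- `v`; otherwise `g v = v`.
      · exfalso
        have h6 : f (Sum.inl (g v)) = headEnd X Y v := by rw [← h1, hinv]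
        rw [← h3, hinv] at h6
        exact h2.ne (headEnd_eq_inr h6.symm)
  -- The tail of a matching edge is not its head. This keeps a walk from reaching the starting point
  -- of any walk.
  have hend : ∀ v, Good v → g v ∉ B := by
    rintro v ⟨h1, h2, h3⟩ h
    have hh : Head (Sum.inl (g v)) := (mem_filter.mp h).2
    have h6 : f (Sum.inl (g v)) = headEnd X Y v := by rw [← h1, hinv]
    by_cases hv : v ∈ X ∪ Y
    · have hvB := (mem_filter.mp (h3 hv)).2
      refine head_not _ hvB ?_
      rw [← headEnd_of_mem (X := X) (Y := Y) hv, h1]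
      exact hh
    · obtain ⟨u, hu⟩ := hh.2.1.fst
      rw [h6, headEnd_of_notMem hv] at hu
      cases hu
  choose! L hL0 hLXY hLint hLgood using fun b (hb : b ∈ B) =>
    exists_backward_path hinj hstep (hBgood b hb) (hBXY b hb)
  -- If two walks meet, injectivity takes the meeting back to the start of one of them; by `hend`
  -- the other must be at its start as well.
  have cancel : ∀ b ∈ B, ∀ b' ∈ B, ∀ i d, i ≤ L b → i + d ≤ L b' →
      g^[i] b = g^[i + d] b' → b = g^[d] b' := by
    intro b hb b' hb' i d
    induction i with
    | zero => intro _ _ h; simpa using h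
    | succ i ih =>
      intro h1 h2 h
      refine ih (by omega) (by omega) (hinj _ _ (hLgood b hb _ (by omega))
        (hLgood b' hb' _ (by omega)) ?_)
      rw [← Function.iterate_succ_apply' g, ← Function.iterate_succ_apply' g, h]
      congr 1; omega
  have disj' : ∀ b ∈ B, ∀ b' ∈ B, ∀ i d, i ≤ L b → i + d ≤ L b' →
      g^[i] b = g^[i + d] b' → b = b' ∧ d = 0 := by
    intro b hb b' hb' i d h1 h2 h
    have h3 := cancel b hb b' hb' i d h1 h2 h
    rcases Nat.eq_zero_or_pos d with rfl | hd
    · exact ⟨h3, rfl⟩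
    · exfalso
      obtain ⟨m, rfl⟩ := Nat.exists_eq_succ_of_ne_zero hd.ne'
      have := hend _ (hLgood b' hb' m (by omega))
      rw [← Function.iterate_succ_apply' g, ← h3] at this
      exact this hb
  have disj : ∀ b ∈ B, ∀ b' ∈ B, ∀ i j, i ≤ L b → j ≤ L b' →
      g^[i] b = g^[j] b' → b = b' ∧ i = j := by
    intro b hb b' hb' i j h1 h2 h
    rcases le_total i j with hij | hij
    · obtain ⟨d, rfl⟩ := Nat.exists_eq_add_of_le hij
      have := disj' b hb b' hb' i d h1 h2 h
      exact ⟨this.1, by omega⟩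
    · obtain ⟨d, rfl⟩ := Nat.exists_eq_add_of_le hij
      have := disj' b' hb' b hb j d h2 h1 h.symm
      exact ⟨this.1.symm, by omega⟩
  obtain ⟨B', hB', hB'k⟩ := exists_subset_card_eq hBk
  let φ : Fin k ≃ B' := (B'.equivFinOfCardEq hB'k).symm
  have hφ : ∀ t, (φ t : V) ∈ B := fun t => hB' (φ t).2
  have path : ∀ b ∈ B,
      G.IsNontrivialPath X Y (List.ofFn (n := L b + 1) fun i => g^[L b - i] b) := by
    intro b hb
    have kept : ∀ i < L b, G.KeptArc X Y (g^[i + 1] b) (g^[i] b) := fun i hi => by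
      rw [Function.iterate_succ_apply']
      exact (hLgood b hb i hi).2.1
    refine ⟨?_, ?_, g^[L b] b, ?_, b, ?_, ?_, ?_, ?_⟩
    · rw [List.nodup_ofFn]
      intro i j h
      have := (disj b hb b hb _ _ (Nat.sub_le _ _) (Nat.sub_le _ _) h).2
      have h1 := i.2
      have h2 := j.2
      exact Fin.ext (by omega)
    · rw [List.isChain_ofFn]
      intro i hi
      have := kept (L b - (i + 1)) (by omega)
      have e' : L b - (i + 1) + 1 = L b - i := by omega
      rw [e'] at this
      exact this.1
    -- The last vertex reached is in X ∪ Y and is the tail of a kept arc, so it is not in Y \ X and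
    -- lies in X. Dually, `b` lies in Y as the head of a kept arc.
    · have := hLXY b hb
      have h' := (kept (L b - 1) (by have := hL0 b hb; omega)).2.2
      rw [Nat.sub_add_cancel (hL0 b hb)] at h'
      simp only [mem_union, mem_sdiff] at this h'
      tauto
    · have := hBXY b hb
      have h' := (kept 0 (hL0 b hb)).2.1
      simp only [Function.iterate_zero, id_eq, mem_union, mem_sdiff] at this h'
      tauto
    · rw [List.head?_eq_getElem?]
      simp
    · rw [List.getLast?_eq_getElem?]
      simp [-List.ofFn_succ]
    · intro h
      have := (disj b hb b hb _ 0 le_rfl (Nat.zero_le _) h).2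
      have := hL0 b hb
      omega
  refine ⟨fun t => List.ofFn (n := L (φ t) + 1) fun i => g^[L (φ t) - i] (φ t),
    fun t => path _ (hφ t), fun t t' hne => ?_⟩
  · intro v hv hv'
    rw [List.mem_ofFn'] at hv hv'
    obtain ⟨i, rfl⟩ := hv
    obtain ⟨j, h⟩ := hv'
    have := (disj _ (hφ t') _ (hφ t) _ _ (Nat.sub_le _ _) (Nat.sub_le _ _) h).1
    exact hne (φ.injective (Subtype.ext this.symm))

theorem hasDisjointPaths_iff_involution [Fintype V] {k : ℕ} : G.HasDisjointPaths X Y k ↔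
    ∃ f : V ⊕ {v : V // v ∉ X ∪ Y} → V ⊕ {v : V // v ∉ X ∪ Y},
      (∀ w, f (f w) = w) ∧ (∀ w, f w ≠ w → (G.auxGraph X Y).Adj w (f w)) ∧
        2 * (k + ((X ∪ Y)ᶜ).card) ≤ #{w | f w ≠ w} := by
  constructor
  · intro h
    obtain ⟨d, q, S⟩ := h.exists_segments
    exact S.exists_involution
  · intro h
    obtain ⟨f, h1, h2, h3, h4⟩ := exists_involution_covering h
    exact hasDisjointPaths_of_involution h1 h2 h3 h4

theorem hasDisjointPaths_iff_matching [Fintype V] {k : ℕ} : G.HasDisjointPaths X Y k ↔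
    ∃ M : (G.auxGraph X Y).Subgraph,
      M.IsMatching ∧ M.edgeSet.ncard = k + ((X ∪ Y)ᶜ).card := by
  rw [SimpleGraph.exists_isMatching_iff_involution, hasDisjointPaths_iff_involution]

end MultiDigraph

/-! ### Transfer of matchings to numbered vertices, and counting loops. -/

namespace Blossom

open Finset RAM RAM.Expr RAM.LoopProg

section Transfer

variable {W : Type*} [Fintype W] [DecidableEq W] {Γ : SimpleGraph W} {ι : W ↪ ℕ} {N : ℕ}

/-- Numbers outside the range of `ι` are isolated, hence fixed. They spoil the deficiency but not
the number of moved vertices, which is therefore the quantity compared. -/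
theorem IsMatch.exists_involution {g : ℕ → ℕ} (hι : ∀ w, ι w < N) (hg : IsMatch (Γ.map ι) N g) :
    ∃ f : W → W, (∀ w, f (f w) = w) ∧ (∀ w, f w ≠ w → Γ.Adj w (f w)) ∧
      #{w | f w ≠ w} = #{u ∈ range N | g u ≠ u} := by
  have key : ∀ u < N, g u ≠ u → ∃ w w', Γ.Adj w w' ∧ ι w = u ∧ ι w' = g u := fun u hu h => by
    simpa [SimpleGraph.map_adj] using hg.adj u hu h
  have h : ∀ w, ∃ w', ι w' = g (ι w) := fun w => by
    by_cases h : g (ι w) = ι w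
    · exact ⟨w, h.symm⟩
    · obtain ⟨-, w', -, -, h'⟩ := key _ (hι w) h
      exact ⟨w', h'⟩
  choose f hf using h
  have hfix : ∀ w, f w = w ↔ g (ι w) = ι w := fun w => by rw [← hf, ι.injective.eq_iff]
  refine ⟨f, fun w => ι.injective (by rw [hf, hf, hg.inv _ (hι w)]), fun w hw => ?_, ?_⟩
  · obtain ⟨a, b, hab, ha, hb⟩ := key _ (hι w) (fun h => hw ((hfix w).2 h))
    rwa [ι.injective ha, ι.injective (hb.trans (hf w).symm)] at hab
  · rw [← card_map ι]
    congr 1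
    ext u
    simp only [mem_map, mem_filter, mem_univ, true_and, mem_range, ne_eq, hfix]
    constructor
    · rintro ⟨w, hw, rfl⟩
      exact ⟨hι w, hw⟩
    · rintro ⟨hu, hne⟩
      obtain ⟨w, -, -, rfl, -⟩ := key u hu hne
      exact ⟨w, hne, rfl⟩

theorem exists_isMatch_of_involution {f : W → W} (hι : ∀ w, ι w < N) (hinv : ∀ w, f (f w) = w)
    (hadj : ∀ w, f w ≠ w → Γ.Adj w (f w)) :
    ∃ g, IsMatch (Γ.map ι) N g ∧ #{u ∈ range N | g u ≠ u} = #{w | f w ≠ w} := by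
  set g : ℕ → ℕ := Function.extend ι (ι ∘ f) id with hg
  have h1 : ∀ w, g (ι w) = ι (f w) := fun w => ι.injective.extend_apply _ _ w
  have h2 : ∀ u, (¬∃ w, ι w = u) → g u = u := fun u h => Function.extend_apply' _ _ u h
  refine ⟨g, ⟨fun u hu => ?_, fun u _ => ?_, fun u _ hne => ?_⟩, ?_⟩
  · by_cases h : ∃ w, ι w = u
    · obtain ⟨w, rfl⟩ := h
      rw [h1]; exact hι _
    · rwa [h2 u h]
  · by_cases h : ∃ w, ι w = u
    · obtain ⟨w, rfl⟩ := h
      rw [h1, h1, hinv]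
    · rw [h2 u h, h2 u h]
  · by_cases h : ∃ w, ι w = u
    · obtain ⟨w, rfl⟩ := h
      rw [h1] at hne ⊢
      exact SimpleGraph.map_adj_apply.2 (hadj w fun h => hne (by rw [h]))
    · exact absurd (h2 u h) hne
  · rw [← card_map ι]
    congr 1
    ext u
    simp only [mem_map, mem_filter, mem_univ, true_and, mem_range, ne_eq]
    constructor
    · rintro ⟨hu, hne⟩
      by_cases h : ∃ w, ι w = u
      · obtain ⟨w, rfl⟩ := h
        exact ⟨w, fun h => hne (by rw [h1, h]), rfl⟩
      · exact absurd (h2 u h) hne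
    · rintro ⟨w, hw, rfl⟩
      exact ⟨hι w, by rwa [h1, ι.injective.eq_iff]⟩

end Transfer

theorem card_moved_add_deficiency (N : ℕ) (g : ℕ → ℕ) :
    #{u ∈ range N | g u ≠ u} + deficiency N g = N := by
  rw [deficiency, add_comm, card_filter_add_card_filter_not, card_range]

/-- Each edge is counted at its smaller end; `g` itself is the bijection between smaller and larger
ends. -/
theorem IsMatch.card_moved {H : SimpleGraph ℕ} {N : ℕ} {g : ℕ → ℕ} (hg : IsMatch H N g) :
    #{u ∈ range N | g u ≠ u} = 2 * #{u ∈ range N | u < g u} := by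
  have h : #{u ∈ range N | g u < u} = #{u ∈ range N | u < g u} := by
    refine card_bij' (fun u _ => g u) (fun u _ => g u) ?_ ?_ ?_ ?_
    all_goals
      intro u hu
      simp only [mem_filter, mem_range] at hu
      simp [hg.inv u hu.1, hg.lt u hu.1, hu]
  have h' : #{u ∈ range N | g u ≠ u} = #{u ∈ range N | u < g u} + #{u ∈ range N | g u < u} := by
    rw [← card_union_of_disjoint]
    · congr 1
      ext u
      simp only [mem_filter, mem_union, mem_range]
      omega
    · exact disjoint_filter.2 fun u _ h h' => by omega
  omega

/-- A loop that adds up values that do not depend on the counting variable. -/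
theorem rep_sum_spec {i x : ℕ} {e : Expr} (hi : i ≠ 1) (hx : x ≠ 1) (hix : i ≠ x) (s : State)
    (g : ℕ → ℕ) (hg : ∀ k s', s'.arr = s.arr → s'.var i = k → e.eval s' = g k) :
    ((rep i (.assign x (add (var x) e))).run s).var x = s.var x + ∑ k ∈ range (s.var 1), g k := by
  have key := rep_induction (i := i) (c := .assign x (add (var x) e))
    (by simp [wf, keepsVar, hi, hix, hx.symm]) s
    (fun k s' => s'.arr = s.arr ∧ s'.var x = s.var x + ∑ k ∈ range k, g k)
    ⟨rfl, by simp [State.setVar_var, hix.symm]⟩ ?_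
  · exact key.2
  · rintro k - s' - hk ⟨ha, hv⟩
    refine ⟨by simp [run_assign, State.setVar_arr, ha], ?_⟩
    simp [run_assign, State.setVar_var, hix.symm, Expr.eval, hg k s' ha hk, hv, sum_range_succ,
      add_assoc]

end Blossom

/-! ### The encoded input, and arithmetic formulas for the edges of the auxiliary graph. -/

namespace PathsInstance

open Finset

variable (I : PathsInstance)

/-- Positions are written `j + j`, since the machine has no multiplication. -/
theorem getElem?_flatMap_pair {α β : Type*} (f g : α → β) : ∀ (l : List α) (j : ℕ),
    (l.flatMap fun a => [f a, g a])[j + j]? = l[j]?.map f ∧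
      (l.flatMap fun a => [f a, g a])[j + j + 1]? = l[j]?.map g
  | [], j => by simp
  | a :: l, 0 => by simp
  | a :: l, j + 1 => by
    have e : j + 1 + (j + 1) = j + j + 1 + 1 := by omega
    rw [e]
    simpa using getElem?_flatMap_pair f g l j

/-- The contents of a cell of the input array. -/
def cell (i : ℕ) : ℕ := I.encode.getD i 0

theorem length_encode : I.encode.length = 2 + (I.n + I.n) + (I.arcs.length + I.arcs.length) := by
  simp [encode, List.length_flatMap]
  omega

theorem cell_zero : I.cell 0 = I.n := rfl

theorem cell_one : I.cell 1 = I.arcs.length := rfl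

theorem cell_first (v : Fin I.n) : I.cell (2 + v) = if v ∈ I.X then 1 else 0 := by
  rw [cell, List.getD_eq_getElem?_getD, encode, add_comm 2, List.getElem?_cons_succ,
    List.getElem?_cons_succ, List.getElem?_append_left (by simp; omega),
    List.getElem?_append_left (by simp)]
  simp

theorem cell_second (v : Fin I.n) : I.cell (2 + I.n + v) = if v ∈ I.Y then 1 else 0 := by
  have e : 2 + I.n + v = (I.n + v) + 1 + 1 := by omega
  rw [cell, List.getD_eq_getElem?_getD, encode, e, List.getElem?_cons_succ,
    List.getElem?_cons_succ, List.getElem?_append_left (by simp),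
    List.getElem?_append_right (by simp)]
  simp

theorem cell_tail (j : ℕ) : I.cell (2 + (I.n + I.n) + (j + j)) =
    (I.arcs[j]?.map fun a => (a.1 : ℕ)).getD 0 := by
  have e : 2 + (I.n + I.n) + (j + j) = (I.n + I.n + (j + j)) + 1 + 1 := by omega
  rw [cell, List.getD_eq_getElem?_getD, encode, e, List.getElem?_cons_succ,
    List.getElem?_cons_succ, List.getElem?_append_right (by simp),
    ← (getElem?_flatMap_pair _ (fun a : Fin I.n × Fin I.n => (a.2 : ℕ)) I.arcs j).1]
  congr 2
  simp

theorem cell_head (j : ℕ) : I.cell (3 + (I.n + I.n) + (j + j)) =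
    (I.arcs[j]?.map fun a => (a.2 : ℕ)).getD 0 := by
  have e : 3 + (I.n + I.n) + (j + j) = (I.n + I.n + (j + j + 1)) + 1 + 1 := by omega
  rw [cell, List.getD_eq_getElem?_getD, encode, e, List.getElem?_cons_succ,
    List.getElem?_cons_succ, List.getElem?_append_right (by simp),
    ← (getElem?_flatMap_pair (fun a : Fin I.n × Fin I.n => (a.1 : ℕ)) _ I.arcs j).2]
  congr 2
  simp

/-- The vertices of the auxiliary graph as numbers. -/
def code : Fin I.n ⊕ {v : Fin I.n // v ∉ I.X ∪ I.Y} ↪ ℕ where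
  toFun := Sum.elim (fun u => u) fun v => I.n + v.1
  inj' := by
    rintro (u | u) (v | v) h
    · exact congrArg _ (Fin.ext h)
    · have : (u : ℕ) = I.n + v.1 := h
      omega
    · have : I.n + u.1 = (v : ℕ) := h
      omega
    · have : I.n + u.1 = I.n + (v.1 : ℕ) := h
      exact congrArg _ (Subtype.ext (Fin.ext (by omega)))

theorem code_inl (u : Fin I.n) : I.code (Sum.inl u) = u := rfl

theorem code_lt (w) : I.code w < I.encode.length := by
  rw [length_encode]
  rcases w with u | u
  · rw [code_inl]; omega
  · change I.n + (u.1 : ℕ) < _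
    omega

theorem code_headEnd (v : Fin I.n) : I.code (MultiDigraph.headEnd I.X I.Y v) =
    v + if v ∈ I.X ∪ I.Y then 0 else I.n := by
  by_cases h : v ∈ I.X ∪ I.Y
  · rw [MultiDigraph.headEnd_of_mem h, if_pos h]; rfl
  · rw [MultiDigraph.headEnd_of_notMem h, if_neg h, add_comm]; rfl

/-- One end of edge number `j` of the auxiliary graph; the edges in front come from the arcs, and
those after them join vertices to their copies. -/
def endOne (j : ℕ) : ℕ :=
  I.cell (2 + (I.n + I.n) + (j + j)) + (j - I.arcs.length)

/-- The other end of edge number `j`. -/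
def endTwo (j : ℕ) : ℕ :=
  let v := I.cell (3 + (I.n + I.n) + (j + j))
  let past := j + 1 - I.arcs.length
  v + (j - I.arcs.length) +
    if 1 - (I.cell (2 + v) + I.cell (2 + I.n + v) - (past + past)) = 1 then I.n else 0

/-- Edge number `j` is present if and only if this is nonzero. -/
def present (j : ℕ) : ℕ :=
  let u := I.cell (2 + (I.n + I.n) + (j + j))
  let v := I.cell (3 + (I.n + I.n) + (j + j))
  let m := I.arcs.length
  (1 - (j + 1 - m) - ((I.cell (2 + v) - I.cell (2 + I.n + v)) +
      (I.cell (2 + I.n + u) - I.cell (2 + u)))) +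
    (1 - (m - j) - (I.cell (2 + (j - m)) + I.cell (2 + I.n + (j - m))) - (j + 1 - m - I.n))

/-- For these `j` all excesses over the number of arcs vanish and the second summand of `present` is
`0`; the first one tests the two conditions of deletion. -/
theorem edge_of_lt {j : ℕ} (hj : j < I.arcs.length) :
    I.endOne j = (I.arcs[j].1 : ℕ) ∧
      I.endTwo j = I.code (MultiDigraph.headEnd I.X I.Y I.arcs[j].2) ∧
      (I.present j ≠ 0 ↔ I.arcs[j].2 ∉ I.X \ I.Y ∧ I.arcs[j].1 ∉ I.Y \ I.X) := by
  have h1 := I.cell_tail j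
  have h2 := I.cell_head j
  rw [List.getElem?_eq_getElem hj] at h1 h2
  simp only [Option.map_some, Option.getD_some] at h1 h2
  have p : j + 1 - I.arcs.length = 0 := by omega
  have p' : j - I.arcs.length = 0 := by omega
  have p'' : 1 - (I.arcs.length - j) = 0 := by omega
  refine ⟨by rw [endOne, h1, p', add_zero], ?_, ?_⟩
  · rw [endTwo, code_headEnd]
    simp only [h2, p, p', cell_first, cell_second, mem_union]
    by_cases hx : I.arcs[j].2 ∈ I.X <;> by_cases hy : I.arcs[j].2 ∈ I.Y <;> simp [hx, hy]
  · rw [present]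
    simp only [h1, h2, p, p'', cell_first, cell_second, mem_sdiff]
    by_cases hx : I.arcs[j].2 ∈ I.X <;> by_cases hy : I.arcs[j].2 ∈ I.Y <;>
      by_cases hx' : I.arcs[j].1 ∈ I.X <;> by_cases hy' : I.arcs[j].1 ∈ I.Y <;>
      simp [hx, hy, hx', hy']

/-- The arc cells now lie beyond the end of the input and read `0`, so only the offset from the
number of arcs remains, and only the second summand of `present` counts. -/
theorem edge_of_ge (v : Fin I.n) :
    I.endOne (I.arcs.length + v) = v ∧ I.endTwo (I.arcs.length + v) = v + I.n ∧
      (I.present (I.arcs.length + v) ≠ 0 ↔ v ∉ I.X ∪ I.Y) := by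
  have h1 := I.cell_tail (I.arcs.length + v)
  have h2 := I.cell_head (I.arcs.length + v)
  rw [List.getElem?_eq_none (by omega)] at h1 h2
  simp only [Option.map_none, Option.getD_none] at h1 h2
  have p : I.arcs.length + v - I.arcs.length = v := by omega
  have p' : I.arcs.length + v + 1 - I.arcs.length = v + 1 := by omega
  have p'' : 1 - (I.arcs.length - (I.arcs.length + v)) = 1 := by omega
  have p3 : (v : ℕ) + 1 - I.n = 0 := by omega
  refine ⟨by rw [endOne, h1, p, zero_add], ?_, ?_⟩
  -- `endTwo` reads the indicators of vertex `0` here. Their sum is at most `2`, and twice the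
  -- excess is at least `2`, so they are cancelled.
  · have c1 := I.cell_first ⟨0, by omega⟩
    have c2 := I.cell_second ⟨0, by omega⟩
    have c1' : I.cell (2 + 0) ≤ 1 := by rw [c1]; split <;> omega
    have c2' : I.cell (2 + I.n + 0) ≤ 1 := by rw [c2]; split <;> omega
    rw [endTwo]
    simp only [h2, p, p']
    rw [if_pos (by omega), zero_add]
  · rw [present]
    simp only [p, p', p'', p3, cell_first, cell_second, mem_union]
    by_cases hx : v ∈ I.X <;> by_cases hy : v ∈ I.Y <;> simp [hx, hy]

theorem present_eq_zero {j : ℕ} (hj : I.arcs.length + I.n ≤ j) : I.present j = 0 := by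
  simp only [present]
  omega

theorem auxArc_of_present {j : ℕ} (h : I.present j ≠ 0) :
    ∃ p q, I.graph.AuxArc I.X I.Y p q ∧ I.endOne j = I.code p ∧ I.endTwo j = I.code q := by
  rcases lt_or_ge j I.arcs.length with hj | hj
  · obtain ⟨h1, h2, h3⟩ := I.edge_of_lt hj
    exact ⟨_, _, ⟨_, _, rfl, rfl, Or.inl ⟨List.getElem_mem hj, h3.1 h⟩⟩, h1, h2⟩
  · have hv : j - I.arcs.length < I.n := by
      by_contra hv
      exact h (I.present_eq_zero (by omega))
    obtain ⟨h1, h2, h3⟩ := I.edge_of_ge ⟨_, hv⟩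
    simp only [Nat.add_sub_cancel' hj] at h1 h2 h3
    have h3 := h3.1 h
    refine ⟨_, _, ⟨_, _, rfl, rfl, Or.inr ⟨rfl, h3⟩⟩, h1, ?_⟩
    rw [code_headEnd, if_neg h3, h2]

theorem exists_present {p q} (h : I.graph.AuxArc I.X I.Y p q) :
    ∃ j < I.encode.length, I.present j ≠ 0 ∧ I.endOne j = I.code p ∧ I.endTwo j = I.code q := by
  rw [length_encode]
  obtain ⟨u, v, rfl, rfl, h | ⟨rfl, h⟩⟩ := h
  · obtain ⟨j, hj, e⟩ := List.getElem_of_mem (show (u, v) ∈ I.arcs from h.1)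
    have h3 := I.edge_of_lt hj
    rw [e] at h3
    exact ⟨j, by omega, h3.2.2.2 h.2, h3.1, h3.2.1⟩
  · obtain ⟨h1, h2, h3⟩ := I.edge_of_ge u
    refine ⟨I.arcs.length + u, by omega, h3.2 h, h1, ?_⟩
    rw [code_headEnd, if_neg h, h2]

theorem edgeGraph_eq : Blossom.edgeGraph I.encode.length I.endOne I.endTwo I.present =
    (I.graph.auxGraph I.X I.Y).map I.code := by
  ext a b
  rw [Blossom.edgeGraph_adj, SimpleGraph.map_adj]
  constructor
  · rintro ⟨-, j, -, h, he⟩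
    obtain ⟨p, q, hpq, h1, h2⟩ := I.auxArc_of_present h
    rw [h1, h2] at he
    rcases he with ⟨rfl, rfl⟩ | ⟨rfl, rfl⟩
    · exact ⟨p, q, MultiDigraph.auxGraph_adj.2 (Or.inl hpq), rfl, rfl⟩
    · exact ⟨q, p, MultiDigraph.auxGraph_adj.2 (Or.inr hpq), rfl, rfl⟩
  · rintro ⟨p, q, hpq, rfl, rfl⟩
    refine ⟨fun h => hpq.ne (I.code.injective h), ?_⟩
    rcases MultiDigraph.auxGraph_adj.1 hpq with h | h
    · obtain ⟨j, hj, h1, h2⟩ := I.exists_present h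
      exact ⟨j, hj, h1, Or.inl h2⟩
    · obtain ⟨j, hj, h1, h2⟩ := I.exists_present h
      exact ⟨j, hj, h1, Or.inr h2⟩

end PathsInstance

/-! ### The complete program and its correctness. -/

namespace PathsInstance

open Finset RAM RAM.Expr RAM.LoopProg

local infixr:60 " ;; " => LoopProg.seq

/-- The number of vertices. -/
def orderExpr : Expr := read 0 (const 0)

/-- The number of arcs. -/
def sizeExpr : Expr := read 0 (const 1)

/-- The indicator of the first set. -/
def firstExpr (v : Expr) : Expr := read 0 (add (const 2) v)

/-- The indicator of the second set. -/
def secondExpr (v : Expr) : Expr := read 0 (add (add (const 2) orderExpr) v)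

/-- The tail of the arc number `v₂₂`. -/
def tailExpr : Expr :=
  read 0 (add (add (const 2) (add orderExpr orderExpr)) (add (var 22) (var 22)))

/-- The head of the arc number `v₂₂`. -/
def headExpr : Expr :=
  read 0 (add (add (const 3) (add orderExpr orderExpr)) (add (var 22) (var 22)))

/-- The excess of `v₂₂ + 1` over the number of arcs. -/
def pastExpr : Expr := sub (add (var 22) (const 1)) sizeExpr

/-- The excess of `v₂₂` over the number of arcs. -/
def indexExpr : Expr := sub (var 22) sizeExpr

/-- The computation of `endTwo`, where array `3` holds `0` and then the number of vertices. -/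
def endTwoExpr : Expr :=
  add (add headExpr indexExpr) (read 3 (sub (const 1)
    (sub (add (firstExpr headExpr) (secondExpr headExpr)) (add pastExpr pastExpr))))

/-- The computation of `present`. -/
def presentExpr : Expr :=
  add (sub (sub (const 1) pastExpr)
      (add (sub (firstExpr headExpr) (secondExpr headExpr))
        (sub (secondExpr tailExpr) (firstExpr tailExpr))))
    (sub (sub (sub (const 1) (sub sizeExpr (var 22)))
      (add (firstExpr indexExpr) (secondExpr indexExpr))) (sub pastExpr orderExpr))

/-- The construction of the auxiliary graph. -/
def buildAux : LoopProg :=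
  .write 3 (const 1) orderExpr ;;
  .rep 22 (.write 1 (var 22) (add tailExpr indexExpr)) ;;
  .rep 22 (.write 2 (var 22) endTwoExpr) ;;
  .rep 22 (.write 11 (var 22) presentExpr)

/-- The number of edges of the matching in array `4`, less the number of vertices outside both
sets. -/
def evaluate : LoopProg :=
  .rep 22 (.assign 0 (add (var 0)
    (sub (const 1) (sub (const 1) (sub (read 4 (var 22)) (var 22)))))) ;;
  .rep 22 (.assign 3 (add (var 3) (sub (sub (const 1)
    (add (firstExpr (var 22)) (secondExpr (var 22))))
      (sub (add (var 22) (const 1)) orderExpr)))) ;;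
  .assign 0 (sub (var 0) (var 3))

/-- The maximum number of disjoint paths. -/
def maxPaths : LoopProg := buildAux ;; Blossom.maxMatching ;; evaluate

/-- The length of the input. -/
def lengthExpr : Expr :=
  add (add (const 2) (add orderExpr orderExpr)) (add sizeExpr sizeExpr)

variable (I : PathsInstance)

/-- The initial memory, with the length of the input in variable `1`. -/
def initial : State := (start I.encode).setVar 1 (lengthExpr.eval (start I.encode))

theorem initial_one : I.initial.var 1 = I.encode.length := by
  rw [initial, State.setVar_var, if_pos rfl, length_encode]
  rfl

theorem initial_var {x : ℕ} (hx : x ≠ 1) : I.initial.var x = 0 := by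
  rw [initial, State.setVar_var, if_neg hx]
  rfl

theorem initial_zero (i : ℕ) : I.initial.arr 0 i = I.cell i := rfl

theorem buildAux_spec : (buildAux.run I.initial).var 1 = I.encode.length ∧
    ∀ j < I.encode.length, (buildAux.run I.initial).arr 1 j = I.endOne j ∧
      (buildAux.run I.initial).arr 2 j = I.endTwo j ∧
      (buildAux.run I.initial).arr 11 j = I.present j := by
  set s₁ := (write 3 (const 1) orderExpr).run I.initial with hs₁
  have v₁ : s₁.var 1 = I.encode.length := I.initial_one
  have a₁ : ∀ i, s₁.arr 0 i = I.cell i := fun i => rfl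
  have t₁ : ∀ i, s₁.arr 3 i = if i = 1 then I.n else 0 := fun i => by
    rw [hs₁, run_write, State.setArr_arr, if_pos rfl, Function.update_apply]
    rfl
  set s₂ := (rep 22 (.write 1 (var 22) (add tailExpr indexExpr))).run s₁ with hs₂
  have v₂ : s₂.var 1 = I.encode.length := (run_var (by decide) s₁).trans v₁
  have a₂ : ∀ i, s₂.arr 0 i = I.cell i := fun i => by rw [hs₂, run_arr (by decide), a₁]
  have t₂ : ∀ i, s₂.arr 3 i = if i = 1 then I.n else 0 := fun i => by
    rw [hs₂, run_arr (by decide), t₁]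
  have e₂ := Blossom.rep_write_spec (i := 22) (a := 1) (e := add tailExpr indexExpr) (by decide) s₁
    I.endOne fun k s' ha _ hk _ => by
      have h0 : s'.arr 0 = I.cell := by rw [ha]; exact funext a₁
      simp [tailExpr, indexExpr, sizeExpr, orderExpr, Expr.eval, h0, hk, cell_zero, cell_one,
        endOne]
  set s₃ := (rep 22 (.write 2 (var 22) endTwoExpr)).run s₂ with hs₃
  have v₃ : s₃.var 1 = I.encode.length := (run_var (by decide) s₂).trans v₂
  have a₃ : ∀ i, s₃.arr 0 i = I.cell i := fun i => by rw [hs₃, run_arr (by decide), a₂]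
  have e₃ := Blossom.rep_write_spec (i := 22) (a := 2) (e := endTwoExpr) (by decide) s₂
    I.endTwo fun k s' ha _ hk _ => by
      have h0 : s'.arr 0 = I.cell := by rw [ha]; exact funext a₂
      have h3 : s'.arr 3 = fun i => if i = 1 then I.n else 0 := by rw [ha]; exact funext t₂
      simp [endTwoExpr, headExpr, indexExpr, sizeExpr, orderExpr, pastExpr, firstExpr, secondExpr,
        Expr.eval, h0, h3, hk, cell_zero, cell_one, endTwo]
  set s₄ := (rep 22 (.write 11 (var 22) presentExpr)).run s₃ with hs₄
  have v₄ : s₄.var 1 = I.encode.length := (run_var (by decide) s₃).trans v₃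
  have e₄ := Blossom.rep_write_spec (i := 22) (a := 11) (e := presentExpr) (by decide) s₃
    I.present fun k s' ha _ hk _ => by
      have h0 : s'.arr 0 = I.cell := by rw [ha]; exact funext a₃
      simp [presentExpr, headExpr, tailExpr, indexExpr, sizeExpr, orderExpr, pastExpr, firstExpr,
        secondExpr, Expr.eval, h0, hk, cell_zero, cell_one, present]
  have e : buildAux.run I.initial = s₄ := rfl
  rw [e]
  refine ⟨v₄, fun j hj => ⟨?_, ?_, ?_⟩⟩
  · rw [hs₄, run_arr (by decide), hs₃, run_arr (by decide), e₂, if_pos (v₁ ▸ hj)]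
  · rw [hs₄, run_arr (by decide), e₃, if_pos (v₂ ▸ hj)]
  · rw [e₄, if_pos (v₃ ▸ hj)]

theorem evaluate_spec (s : State) (h0 : ∀ i, s.arr 0 i = I.cell i)
    (h1 : s.var 1 = I.encode.length) (hv : s.var 0 = 0) (h3 : s.var 3 = 0) :
    (evaluate.run s).var 0 = #{u ∈ range I.encode.length | u < s.arr 4 u} -
      ((I.X ∪ I.Y)ᶜ).card := by
  set s₁ := (rep 22 (.assign 0 (add (var 0)
    (sub (const 1) (sub (const 1) (sub (read 4 (var 22)) (var 22))))))).run s with hs₁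
  have e₁ := Blossom.rep_sum_spec (i := 22) (x := 0)
    (e := sub (const 1) (sub (const 1) (sub (read 4 (var 22)) (var 22)))) (by decide) (by decide)
    (by decide) s (fun u => if u < s.arr 4 u then 1 else 0) fun k s' ha hk => by
      -- With truncated subtraction, `1 - (1 - x)` is the indicator of `x ≠ 0`.
      simp only [Expr.eval, ha, hk]
      split <;> omega
  rw [← hs₁, hv, h1, zero_add, ← card_filter] at e₁
  have v₁ : s₁.var 1 = I.encode.length := (run_var (by decide) s).trans h1
  have w₁ : s₁.var 3 = 0 := (run_var (by decide) s).trans h3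
  have a₁ : s₁.arr 0 = I.cell := (run_arr (by decide) s).trans (funext h0)
  set e : Expr := sub (sub (const 1) (add (firstExpr (var 22)) (secondExpr (var 22))))
      (sub (add (var 22) (const 1)) orderExpr) with he
  set s₂ := (rep 22 (.assign 3 (add (var 3) e))).run s₁ with hs₂
  have e₂ := Blossom.rep_sum_spec (i := 22) (x := 3) (e := e) (by decide) (by decide)
    (by decide) s₁ (fun v => 1 - (I.cell (2 + v) + I.cell (2 + I.n + v)) - (v + 1 - I.n))
    fun k s' ha hk => by
      simp [he, firstExpr, secondExpr, orderExpr, Expr.eval, ha, hk, a₁, cell_zero]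
  rw [← hs₂, w₁, v₁, zero_add] at e₂
  -- The loop runs past the vertices; the term `v + 1 - I.n` suppresses the surplus indices.
  have hsum : ∑ v ∈ range I.encode.length,
      (1 - (I.cell (2 + v) + I.cell (2 + I.n + v)) - (v + 1 - I.n)) = ((I.X ∪ I.Y)ᶜ).card := by
    rw [← sum_subset (s₁ := range I.n), ← Fin.sum_univ_eq_sum_range, compl_eq_univ_sdiff,
      ← filter_notMem_eq_sdiff, card_filter]
    · refine sum_congr rfl fun v _ => ?_
      rw [cell_first, cell_second]
      have : (v : ℕ) + 1 - I.n = 0 := by omega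
      by_cases hx : v ∈ I.X <;> by_cases hy : v ∈ I.Y <;> simp [hx, hy, this]
    · intro v
      rw [mem_range, mem_range, length_encode]
      omega
    · intro v _ hv
      rw [mem_range] at hv
      omega
  have v₂ : s₂.var 0 = s₁.var 0 := run_var (by decide) s₁
  have : (evaluate.run s).var 0 = s₂.var 0 - s₂.var 3 := rfl
  rw [this, v₂, e₁, e₂, hsum]

/-- By part (2) in its form with involutions, `k` paths exist exactly if `k` plus the number of
outside vertices is at most the maximum size of a matching. -/
theorem maxPaths_spec : IsGreatest {k : ℕ | I.graph.HasDisjointPaths I.X I.Y k}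
    ((maxPaths.run I.initial).var 0) := by
  obtain ⟨hv, hj⟩ := I.buildAux_spec
  set s := buildAux.run I.initial with hs
  have hgraph : Blossom.inputGraph s = (I.graph.auxGraph I.X I.Y).map I.code := by
    rw [← edgeGraph_eq, Blossom.inputGraph, hv]
    ext a b
    rw [Blossom.edgeGraph_adj, Blossom.edgeGraph_adj]
    refine and_congr_right fun _ => exists_congr fun j => and_congr_right fun h => ?_
    rw [(hj j h).1, (hj j h).2.1, (hj j h).2.2]
  have hE : Blossom.ValidEdges s := by
    intro j h hne
    rw [hv] at h
    rw [(hj j h).2.2] at hne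
    obtain ⟨p, q, hpq, h1, h2⟩ := I.auxArc_of_present hne
    rw [(hj j h).1, (hj j h).2.1, h1, h2, hv]
    exact ⟨I.code_lt p, I.code_lt q, fun h =>
      (MultiDigraph.auxGraph_adj.2 (Or.inl hpq)).ne (I.code.injective h)⟩
  obtain ⟨hm, hmax⟩ := Blossom.maxMatching_spec hE
  have hval : (maxPaths.run I.initial).var 0 =
      #{u ∈ range I.encode.length | u < (Blossom.maxMatching.run s).arr 4 u} -
        ((I.X ∪ I.Y)ᶜ).card := by
    have e : maxPaths.run I.initial = evaluate.run (Blossom.maxMatching.run s) := rfl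
    rw [e]
    refine I.evaluate_spec _ (fun i => ?_) ?_ ?_ ?_
    · rw [run_arr (by decide), hs, run_arr (by decide), initial_zero]
    · rw [run_var (by decide), hv]
    · rw [run_var (by decide), hs, run_var (by decide), I.initial_var (by decide)]
    · rw [run_var (by decide), hs, run_var (by decide), I.initial_var (by decide)]
  rw [hgraph, hv] at hm hmax
  have key : ∀ k, I.graph.HasDisjointPaths I.X I.Y k ↔ k + ((I.X ∪ I.Y)ᶜ).card ≤
      #{u ∈ range I.encode.length | u < (Blossom.maxMatching.run s).arr 4 u} := by
    intro k
    rw [MultiDigraph.hasDisjointPaths_iff_involution]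
    have h := Blossom.card_moved_add_deficiency I.encode.length ((Blossom.maxMatching.run s).arr 4)
    have h' := hm.card_moved
    constructor
    · rintro ⟨f, hinv, hadj, hc⟩
      obtain ⟨g, hg, hcard⟩ := Blossom.exists_isMatch_of_involution I.code_lt hinv hadj
      have h1 := hmax g hg
      have h2 := Blossom.card_moved_add_deficiency I.encode.length g
      omega
    · intro hk
      obtain ⟨f, hinv, hadj, hcard⟩ := hm.exists_involution I.code_lt
      exact ⟨f, hinv, hadj, by omega⟩
  -- The case of no paths shows that the final subtraction is not truncated.
  have hzero := (key 0).1 ⟨Fin.elim0, fun i => i.elim0, fun i => i.elim0⟩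
  rw [hval]
  refine ⟨(key _).2 (by omega), fun k hk => ?_⟩
  have := (key k).1 hk
  omega

theorem solvableInPolyTime : SolvableInPolyTime encode
    fun I m => IsGreatest {k : ℕ | I.graph.HasDisjointPaths I.X I.Y k} m := by
  obtain ⟨p, hp⟩ := exists_polynomial_runs (c := maxPaths) (by decide) (by decide)
  -- The loop bound itself is set by one assignment outside the language of bounded loops;
  -- afterwards variable `1` is never written.
  refine ⟨.seq (.assign 1 lengthExpr) maxPaths.toProg, Polynomial.C (lengthExpr.cost + 1) + p,
    fun I => ?_⟩
  obtain ⟨t, ht, hle⟩ := hp I.initial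
  refine ⟨_, _, .seq (.assign _ _ _) ht, ?_, I.maxPaths_spec⟩
  rw [Polynomial.eval_add, Polynomial.eval_C, ← I.initial_one]
  exact Nat.add_le_add_left hle _

end PathsInstance

theorem mainTheorem6 :
    RAM.SolvableInPolyTime PathsInstance.encode
      (fun I m => IsGreatest {k : ℕ | I.graph.HasDisjointPaths I.X I.Y k} m) ∧
    ∀ (V : Type*) [Fintype V] [DecidableEq V] (G : MultiDigraph V) (X Y : Finset V) (k : ℕ),
      G.HasDisjointPaths X Y k ↔
        ∃ M : (G.auxGraph X Y).Subgraph,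
          M.IsMatching ∧ M.edgeSet.ncard = k + ((X ∪ Y)ᶜ).card :=
  ⟨PathsInstance.solvableInPolyTime, fun _ _ _ _ _ _ _ =>
    MultiDigraph.hasDisjointPaths_iff_matching⟩
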